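/- Let $\mathbf{gr}$ be the (small, skeletal) category of free groups of finite rank, with objects the groups $\mathbb{Z}^{*n}$, $n\in\mathbb{N}$, and all group homomorphisms as morphisms, and let $\mathcal{F}(\mathbf{gr})$ be the abelian category of functors from $\mathbf{gr}$ to abelian groups. For $F$ in $\mathcal{F}(\mathbf{gr})$ and $X_1,\dots,X_n$ in $\mathbf{gr}$, the cross effect $cr_n(F)(X_1,\dots,X_n)$ is the subgroup of $F(X_1*\dots*X_n)$ of the elements which, for every $i$, are killed by the map to $F(X_1*\dots*\widehat{X_i}*\dots*X_n)$ induced by the homomorphism that is trivial on $X_i$ and the identity on the other factors. For $d\in\mathbb{N}$, let $\mathcal{F}_d(\mathbf{gr})$ be the full subcategory of $\mathcal{F}(\mathbf{gr})$ of the polynomial functors of degree at most $d$, i.e. of those $F$ with $cr_{d+1}(F)(X_1,\dots,X_{d+1})=0$ for all $X_1,\dots,X_{d+1}$; it is an abelian category and its inclusion into $\mathcal{F}(\mathbf{gr})$ is exact. Let $\mathrm{cr}_d:\mathcal{F}_d(\mathbf{gr})\to\mathbb{Z}[\mathfrak{S}_d]\text{-}\mathbf{Mod}$ be the functor $F\mapsto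 cr_d(F)(\mathbb{Z},\dots,\mathbb{Z})$, where the symmetric group $\mathfrak{S}_d$ acts by permuting the $d$ copies of $\mathbb{Z}$. **Proposition.** For every $d\in\mathbb{N}$, the functor $\mathrm{cr}_d$ has a right adjoint, and every right adjoint $\beta_d:\mathbb{Z}[\mathfrak{S}_d]\text{-}\mathbf{Mod}\to\mathcal{F}_d(\mathbf{gr})$ of it is exact. For all $\mathbb{Z}[\mathfrak{S}_d]$-modules $M$ and $N$ and every $n\in\mathbb{N}$, the homomorphisms $$\mathrm{Ext}^n_{\mathbb{Z}[\mathfrak{S}_d]}(M,N)\longrightarrow\mathrm{Ext}^n_{\mathcal{F}_d(\mathbf{gr})}(\beta_d(M),\beta_d(N))\longrightarrow\mathrm{Ext}^n_{\mathcal{F}(\mathbf{gr})}(\beta_d(M),\beta_d(N))$$ induced by the exact functor $\beta_d$ and by the exact inclusion $\mathcal{F}_d(\mathbf{gr})\to\mathcal{F}(\mathbf{gr})$ are isomorphisms of abelian groups, natural in $M$ and in $N$. -/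

import Mathlib

open CategoryTheory CategoryTheory.Limits CategoryTheory.Abelian

noncomputable section

/-! ### The skeletal category of free groups of finite rank -/

/-- An object of the (small, skeletal) category `gr` of free groups of finite rank: the natural
number `n` stands for the free group on `n` generators, i.e. the `n`-fold free product of `ℤ`. -/
structure FreeGr : Type where
  rank : ℕ

namespace FreeGr

/-- The free group which an object of `gr` stands for. -/
abbrev group (X : FreeGr) : Type := FreeGroup (Fin X.rank)

/-- Morphisms in `gr` are all the group homomorphisms. -/
@[ext]
structure Hom (X Y : FreeGr) : Type where
  toMonoidHom : X.group →* Y.group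

instance : SmallCategory FreeGr where
  Hom X Y := Hom X Y
  id X := ⟨MonoidHom.id X.group⟩
  comp f g := ⟨g.toMonoidHom.comp f.toMonoidHom⟩

@[ext]
lemma hom_ext {X Y : FreeGr} {f g : X ⟶ Y}
    (h : ∀ i : Fin X.rank, f.toMonoidHom (FreeGroup.of i) = g.toMonoidHom (FreeGroup.of i)) :
    f = g :=
  Hom.ext (FreeGroup.ext_hom _ _ h)

@[simp]
lemma id_toMonoidHom (X : FreeGr) : Hom.toMonoidHom (𝟙 X) = MonoidHom.id X.group := rfl

@[simp]
lemma comp_toMonoidHom {X Y Z : FreeGr} (f : X ⟶ Y) (g : Y ⟶ Z) :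
    (f ≫ g).toMonoidHom = g.toMonoidHom.comp f.toMonoidHom := rfl

/-- The zero morphisms of `gr` are the trivial homomorphisms. -/
instance : HasZeroMorphisms FreeGr where
  zero _ _ := ⟨⟨1⟩⟩
  comp_zero f _ := Hom.ext (MonoidHom.one_comp f.toMonoidHom)
  zero_comp _ _ _ f := Hom.ext (MonoidHom.comp_one f.toMonoidHom)

@[simp]
lemma zero_toMonoidHom (X Y : FreeGr) : Hom.toMonoidHom (0 : X ⟶ Y) = 1 := rfl

/-- The object `ℤ` of `gr`. -/
def int : FreeGr := ⟨1⟩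

/-- The free product of finitely many objects of `gr`, with its canonical inclusions. -/
def cofan {n : ℕ} (X : Fin n → FreeGr) : Cofan X :=
  Cofan.mk ⟨∑ i, (X i).rank⟩ fun i =>
    ⟨FreeGroup.map fun j : Fin (X i).rank => finSigmaFinEquiv ⟨i, j⟩⟩

/-- The free product is the coproduct in `gr`. -/
def cofanIsColimit {n : ℕ} (X : Fin n → FreeGr) : IsColimit (cofan X) :=
  Cofan.IsColimit.mk _
    (fun s => ⟨FreeGroup.lift fun k =>
      (s.inj (finSigmaFinEquiv.symm k).1).toMonoidHom
        (FreeGroup.of (finSigmaFinEquiv.symm k).2)⟩)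
    (fun s i => by
      ext j
      change FreeGroup.lift (fun k : Fin (∑ i, (X i).rank) =>
        (s.inj (finSigmaFinEquiv.symm k).1).toMonoidHom
          (FreeGroup.of (finSigmaFinEquiv.symm k).2))
        (FreeGroup.map (fun j : Fin (X i).rank => finSigmaFinEquiv ⟨i, j⟩) (FreeGroup.of j)) = _
      rw [FreeGroup.map.of, FreeGroup.lift_apply_of, Equiv.symm_apply_apply])
    (fun s m h => by
      ext k
      obtain ⟨⟨i, j⟩, rfl⟩ := finSigmaFinEquiv.surjective k
      change _ = FreeGroup.lift (fun k : Fin (∑ i, (X i).rank) =>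
        (s.inj (finSigmaFinEquiv.symm k).1).toMonoidHom
          (FreeGroup.of (finSigmaFinEquiv.symm k).2)) (FreeGroup.of (finSigmaFinEquiv ⟨i, j⟩))
      rw [FreeGroup.lift_apply_of, Equiv.symm_apply_apply, ← h i]
      change _ = m.toMonoidHom
        (FreeGroup.map (fun j : Fin (X i).rank => finSigmaFinEquiv ⟨i, j⟩) (FreeGroup.of j))
      rw [FreeGroup.map.of]
      rfl)

instance : HasFiniteCoproducts FreeGr where
  out n := by
    have (X : Fin n → FreeGr) : HasCoproduct X := ⟨⟨⟨cofan X, cofanIsColimit X⟩⟩⟩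
    exact { has_colimit := fun K => hasColimit_of_iso Discrete.natIsoFunctor }

end FreeGr

/-! ### Cross effects and polynomial functors -/

section CrossEffect

lemma app_map_apply {C : Type*} [Category* C] {F G : C ⥤ AddCommGrpCat.{0}} (f : F ⟶ G) {A B : C} (g : A ⟶ B)
    (x : F.obj A) : f.app B (F.map g x) = G.map g (f.app A x) := by
  rw [← ConcreteCategory.comp_apply, ← ConcreteCategory.comp_apply, f.naturality]

lemma app_injective_of_mono {C : Type*} [Category* C] {F G : C ⥤ AddCommGrpCat.{0}} (f : F ⟶ G) [Mono f] (A : C) :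
    Function.Injective (f.app A) :=
  (AddCommGrpCat.mono_iff_injective _).1 inferInstance

variable {C : Type*} [Category* C] [HasZeroMorphisms C] [HasFiniteCoproducts C]

/-- The retraction `X₁ ∨ ⋯ ∨ Xₙ ⟶ X₁ ∨ ⋯ ∨ X̂ᵢ ∨ ⋯ ∨ Xₙ` which omits the `i`-th summand: it is
trivial on `Xᵢ` and the canonical inclusion on every other summand. -/
def omitSummand {n : ℕ} (X : Fin n → C) (i : Fin n) :
    (∐ X) ⟶ ∐ fun j : {j : Fin n // j ≠ i} => X j :=
  Sigma.desc fun j =>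
    if h : j = i then 0 else Sigma.ι (fun j : {j : Fin n // j ≠ i} => X j) ⟨j, h⟩

/-- The cross effect `crₙ(F)(X₁, …, Xₙ)`: the subgroup of `F(X₁ ∨ ⋯ ∨ Xₙ)` of the elements whose
image in `F(X₁ ∨ ⋯ ∨ X̂ᵢ ∨ ⋯ ∨ Xₙ)` vanishes for every `i`. -/
def crossEffect (F : C ⥤ AddCommGrpCat.{0}) {n : ℕ} (X : Fin n → C) :
    AddSubgroup (F.obj (∐ X)) :=
  ⨅ i : Fin n, (F.map (omitSummand X i)).hom.ker

variable (C) in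
/-- `F` is polynomial of degree at most `d` if all its cross effects `cr_{d+1}(F)` vanish. -/
def IsPolynomial (d : ℕ) : ObjectProperty (C ⥤ AddCommGrpCat.{0}) :=
  fun F => ∀ X : Fin (d + 1) → C, crossEffect F X = ⊥

lemma mem_crossEffect {F : C ⥤ AddCommGrpCat.{0}} {n : ℕ} {X : Fin n → C} {x : F.obj (∐ X)} :
    x ∈ crossEffect F X ↔ ∀ i, F.map (omitSummand X i) x = 0 := by
  simp only [crossEffect, AddSubgroup.mem_iInf]
  rfl

/-- The endomorphism of `X₁ ∨ ⋯ ∨ Xₙ` which is trivial on `Xᵢ` and the identity on every other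
summand. -/
def killSummand {n : ℕ} (X : Fin n → C) (i : Fin n) : (∐ X) ⟶ ∐ X :=
  Sigma.desc fun j => if j = i then 0 else Sigma.ι X j

lemma ι_killSummand {n : ℕ} (X : Fin n → C) (i j : Fin n) :
    Sigma.ι X j ≫ killSummand X i = if j = i then 0 else Sigma.ι X j := by
  simp [killSummand]

lemma ι_killSummand_assoc {n : ℕ} (X : Fin n → C) (i j : Fin n) {Z : C} (h : (∐ X) ⟶ Z) :
    Sigma.ι X j ≫ killSummand X i ≫ h = (if j = i then 0 else Sigma.ι X j) ≫ h := by
  rw [← Category.assoc, ι_killSummand]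

lemma omitSummand_comp_desc {n : ℕ} (X : Fin n → C) (i : Fin n) :
    omitSummand X i ≫ Sigma.desc (fun j : {j : Fin n // j ≠ i} => Sigma.ι X j) =
      killSummand X i := by
  refine Sigma.hom_ext _ _ fun j => ?_
  by_cases h : j = i <;> simp [omitSummand, killSummand, h]

lemma killSummand_comp_omitSummand {n : ℕ} (X : Fin n → C) (i : Fin n) :
    killSummand X i ≫ omitSummand X i = omitSummand X i := by
  refine Sigma.hom_ext _ _ fun j => ?_
  by_cases h : j = i <;> simp [omitSummand, killSummand, h]

lemma killSummand_idem {n : ℕ} (X : Fin n → C) (i : Fin n) :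
    killSummand X i ≫ killSummand X i = killSummand X i := by
  refine Sigma.hom_ext _ _ fun j => ?_
  by_cases h : j = i <;> simp [killSummand, h]

lemma killSummand_comm {n : ℕ} (X : Fin n → C) (i k : Fin n) :
    killSummand X i ≫ killSummand X k = killSummand X k ≫ killSummand X i := by
  refine Sigma.hom_ext _ _ fun j => ?_
  rw [ι_killSummand_assoc, ι_killSummand_assoc]
  split_ifs with h h' h' <;> simp [ι_killSummand, h, h']

/-- The cross effect is also the subgroup of the elements annihilated by the endomorphisms
`F(killSummand X i)`. -/
lemma mem_crossEffect' {F : C ⥤ AddCommGrpCat.{0}} {n : ℕ} {X : Fin n → C} {x : F.obj (∐ X)} :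
    x ∈ crossEffect F X ↔ ∀ i, F.map (killSummand X i) x = 0 := by
  rw [mem_crossEffect]
  refine forall_congr' fun i => ⟨fun h => ?_, fun h => ?_⟩
  · rw [← omitSummand_comp_desc, F.map_comp, ConcreteCategory.comp_apply, h, map_zero]
  · rw [← killSummand_comp_omitSummand, F.map_comp, ConcreteCategory.comp_apply, h, map_zero]

/-- Cross effects are functorial in the functor. -/
lemma app_mem_crossEffect {F G : C ⥤ AddCommGrpCat.{0}} (f : F ⟶ G) {n : ℕ} {X : Fin n → C}
    {x : F.obj (∐ X)} (hx : x ∈ crossEffect F X) : f.app _ x ∈ crossEffect G X := by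
  rw [mem_crossEffect] at hx ⊢
  intro i
  rw [← app_map_apply, hx, map_zero]

lemma exists_mem_crossEffect_of_epi {F G : C ⥤ AddCommGrpCat.{0}} (f : F ⟶ G) [Epi f] {n : ℕ}
    {X : Fin n → C} {y : G.obj (∐ X)} (hy : y ∈ crossEffect G X) :
    ∃ x ∈ crossEffect F X, f.app _ x = y := by
  have hsurj : Function.Surjective (f.app (∐ X)) :=
    (AddCommGrpCat.epi_iff_surjective _).1 inferInstance
  rw [mem_crossEffect'] at hy
  suffices H : ∀ s : Finset (Fin n), ∃ x : F.obj (∐ X), f.app _ x = y ∧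
      ∀ i ∈ s, F.map (killSummand X i) x = 0 by
    obtain ⟨x, hx, h⟩ := H Finset.univ
    exact ⟨x, mem_crossEffect'.2 fun i => h i (Finset.mem_univ i), hx⟩
  intro s
  induction s using Finset.induction_on with
  | empty =>
    obtain ⟨x, hx⟩ := hsurj y
    exact ⟨x, hx, by simp⟩
  | insert a s ha ih =>
    obtain ⟨x, hx, h⟩ := ih
    refine ⟨x - F.map (killSummand X a) x, ?_, fun i hi => ?_⟩
    · rw [map_sub, app_map_apply, hx, hy, sub_zero]
    · rw [map_sub, ← ConcreteCategory.comp_apply, ← F.map_comp]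
      rcases Finset.mem_insert.1 hi with rfl | hi
      · rw [killSummand_idem, sub_self]
      · rw [killSummand_comm, F.map_comp, ConcreteCategory.comp_apply, h i hi, map_zero, sub_zero]

/-- Polynomial functors of degree at most `d` form a thick subcategory. -/
instance (d : ℕ) : (IsPolynomial C d).IsSerreClass where
  exists_zero := by
    have hZ := isZero_zero (C ⥤ AddCommGrpCat.{0})
    refine ⟨_, hZ, fun X => ?_⟩
    have := AddCommGrpCat.subsingleton_of_isZero (hZ.obj (∐ X))
    exact Subsingleton.elim _ _
  prop_of_mono {F G} f _ hG X := by
    rw [eq_bot_iff]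
    intro x hx
    have h := app_mem_crossEffect f hx
    rw [hG X, AddSubgroup.mem_bot] at h
    exact app_injective_of_mono f _ (by rw [h, map_zero])
  prop_of_epi {F G} f _ hF X := by
    rw [eq_bot_iff]
    intro y hy
    obtain ⟨x, hx, rfl⟩ := exists_mem_crossEffect_of_epi f hy
    rw [hF X, AddSubgroup.mem_bot] at hx
    rw [hx, map_zero]
    exact zero_mem _
  prop_X₂_of_shortExact {S} hS h₁ h₃ X := by
    rw [eq_bot_iff]
    intro x hx
    have := hS.mono_f
    have h := app_mem_crossEffect S.g hx
    rw [h₃ X, AddSubgroup.mem_bot] at h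
    have hex := hS.exact.map ((evaluation C AddCommGrpCat.{0}).obj (∐ X))
    rw [ShortComplex.ab_exact_iff] at hex
    obtain ⟨y, hy'⟩ : ∃ y : S.X₁.obj (∐ X), S.f.app _ y = x := hex x h
    have hy₁ : y ∈ crossEffect S.X₁ X := by
      rw [mem_crossEffect] at hx ⊢
      intro i
      apply app_injective_of_mono S.f
      rw [app_map_apply, hy', hx, map_zero]
    rw [h₁ X, AddSubgroup.mem_bot] at hy₁
    rw [← hy', hy₁, map_zero]
    exact zero_mem _

instance (d : ℕ) : (IsPolynomial C d).IsClosedUnderFiniteProducts :=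
  have : (IsPolynomial C d).IsClosedUnderBinaryProducts := ⟨by
    rintro F ⟨p, hp⟩
    have e : F ≅ p.diag.obj ⟨.left⟩ ⊞ p.diag.obj ⟨.right⟩ :=
      p.isLimit.conePointUniqueUpToIso (limit.isLimit _) ≪≫
        HasLimit.isoOfNatIso (diagramIsoPair p.diag) ≪≫ (biprod.isoProd _ _).symm
    exact (IsPolynomial C d).prop_of_iso e.symm
      ((IsPolynomial C d).prop_biprod (hp _) (hp _))⟩
  .mk'

end CrossEffect

/-! ### The categories `𝓕(gr)` and `𝓕_d(gr)` -/

/-- The category `𝓕(gr)` of all functors from `gr` to abelian groups. -/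
abbrev GrFunctor : Type 1 := FreeGr ⥤ AddCommGrpCat.{0}

/-- The full subcategory `𝓕_d(gr)` of `𝓕(gr)` of the polynomial functors of degree at most `d`;
it is an abelian category. -/
abbrev PolyGrFunctor (d : ℕ) : Type 1 := (IsPolynomial FreeGr d).FullSubcategory

/-- The inclusion `𝓕_d(gr) ⥤ 𝓕(gr)`. -/
abbrev polyInclusion (d : ℕ) : PolyGrFunctor d ⥤ GrFunctor := (IsPolynomial FreeGr d).ι

instance (d : ℕ) : PreservesFiniteLimits (polyInclusion d) := by
  have (X Y : PolyGrFunctor d) (f : X ⟶ Y) : PreservesLimit (parallelPair f 0) (polyInclusion d) :=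
    (IsPolynomial FreeGr d).preservesKernels_ι f
  exact Functor.preservesFiniteLimits_of_preservesKernels _

instance (d : ℕ) : PreservesFiniteColimits (polyInclusion d) := by
  have (X Y : PolyGrFunctor d) (f : X ⟶ Y) :
      PreservesColimit (parallelPair f 0) (polyInclusion d) :=
    (IsPolynomial FreeGr d).preservesCokernels_ι f
  exact Functor.preservesFiniteColimits_of_preservesCokernels _

/-! ### The functor `cr_d : 𝓕_d(gr) ⥤ ℤ[S_d]-Mod` -/

/-- The constant family `(ℤ, …, ℤ)` of `d` objects of `gr`. -/
abbrev ints (d : ℕ) : Fin d → FreeGr := fun _ => FreeGr.int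

/-- The automorphism of `ℤ ∗ ⋯ ∗ ℤ` which maps the `i`-th factor identically onto the `σ i`-th. -/
def permMap {d : ℕ} (σ : Equiv.Perm (Fin d)) : (∐ ints d) ⟶ ∐ ints d :=
  Sigma.desc fun i => Sigma.ι (ints d) (σ i)

@[simp]
lemma ι_permMap {d : ℕ} (σ : Equiv.Perm (Fin d)) (i : Fin d) :
    Sigma.ι (ints d) i ≫ permMap σ = Sigma.ι (ints d) (σ i) := by
  simp [permMap]

@[simp]
lemma ι_permMap_assoc {d : ℕ} (σ : Equiv.Perm (Fin d)) (i : Fin d) {Z : FreeGr}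
    (h : (∐ ints d) ⟶ Z) :
    Sigma.ι (ints d) i ≫ permMap σ ≫ h = Sigma.ι (ints d) (σ i) ≫ h := by
  rw [← Category.assoc, ι_permMap]

lemma permMap_one (d : ℕ) : permMap (1 : Equiv.Perm (Fin d)) = 𝟙 _ :=
  Sigma.hom_ext _ _ fun i => by simp

lemma permMap_mul {d : ℕ} (σ τ : Equiv.Perm (Fin d)) :
    permMap (σ * τ) = permMap τ ≫ permMap σ :=
  Sigma.hom_ext _ _ fun i => by simp

lemma permMap_comp_killSummand {d : ℕ} (σ : Equiv.Perm (Fin d)) (i : Fin d) :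
    permMap σ ≫ killSummand (ints d) i = killSummand (ints d) (σ⁻¹ i) ≫ permMap σ := by
  refine Sigma.hom_ext _ _ fun j => ?_
  rw [ι_permMap_assoc, ι_killSummand, ι_killSummand_assoc]
  by_cases h : σ j = i
  · subst h; simp
  · have : ¬ j = σ⁻¹ i := fun h' => h (by simp [h'])
    rw [if_neg h, if_neg this, ι_permMap]

lemma map_permMap_mem_crossEffect (F : GrFunctor) {d : ℕ} (σ : Equiv.Perm (Fin d))
    {x : F.obj (∐ ints d)} (hx : x ∈ crossEffect F (ints d)) :
    F.map (permMap σ) x ∈ crossEffect F (ints d) := by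
  rw [mem_crossEffect'] at hx ⊢
  intro i
  rw [← ConcreteCategory.comp_apply, ← F.map_comp, permMap_comp_killSummand, F.map_comp,
    ConcreteCategory.comp_apply, hx, map_zero]

/-- The action of the symmetric group `S_d` on `cr_d(F)(ℤ, …, ℤ)` by permutation of the `d`
copies of `ℤ`. -/
def crossEffectRep (F : GrFunctor) (d : ℕ) :
    Representation ℤ (Equiv.Perm (Fin d)) (crossEffect F (ints d)) where
  toFun σ := AddMonoidHom.toIntLinearMap
    (((F.map (permMap σ)).hom.comp (crossEffect F (ints d)).subtype).codRestrict
      (crossEffect F (ints d)) fun x => map_permMap_mem_crossEffect F σ x.2)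
  map_one' := by
    ext x
    change F.map (permMap 1) x.1 = x.1
    rw [permMap_one, F.map_id, ConcreteCategory.id_apply]
  map_mul' σ τ := by
    ext x
    change F.map (permMap (σ * τ)) x.1 = F.map (permMap σ) (F.map (permMap τ) x.1)
    rw [permMap_mul, F.map_comp, ConcreteCategory.comp_apply]

/-- The map `cr_d(F)(ℤ, …, ℤ) → cr_d(G)(ℤ, …, ℤ)` induced by a natural transformation. -/
def crossEffectMap {F G : GrFunctor} (f : F ⟶ G) (d : ℕ) :
    (crossEffectRep F d).IntertwiningMap (crossEffectRep G d) where
  toLinearMap := AddMonoidHom.toIntLinearMap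
    (((f.app (∐ ints d)).hom.comp (crossEffect F (ints d)).subtype).codRestrict
      (crossEffect G (ints d)) fun x => app_mem_crossEffect f x.2)
  isIntertwining' σ := by
    ext x
    exact app_map_apply f (permMap σ) x.1

/-- The functor `cr_d`, with values in the integral representations of `S_d`. -/
def crRep (d : ℕ) : PolyGrFunctor d ⥤ Rep.{0} ℤ (Equiv.Perm (Fin d)) where
  obj F := Rep.of (crossEffectRep F.obj d)
  map f := Rep.ofHom (crossEffectMap f.hom d)

/-- The functor `cr_d : 𝓕_d(gr) ⥤ ℤ[S_d]-Mod`, `F ↦ cr_d(F)(ℤ, …, ℤ)`. -/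
def cr (d : ℕ) : PolyGrFunctor d ⥤ ModuleCat.{0} (MonoidAlgebra ℤ (Equiv.Perm (Fin d))) :=
  crRep d ⋙ Rep.toModuleMonoidAlgebra

end

universe w₁ w₂ w₃

open scoped TensorProduct

noncomputable section

/-! ### Vanishing of `Ext` -/

section ExtVanishing

universe w v u

variable {C : Type u} [Category.{v} C] [Abelian C] [HasExt.{w} C]

/-! Write `I` for the augmentation ideal functor `Ipow 1`, `R` for the group ring functor `Ipow 0`,
and `gr s` for `I^s/I^{s+1}`. Everything rests on two kinds of test objects in `𝓕_d(gr)`.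

One is `polyPow d`, the `d`-th tensor power of the abelianization `gr 1`. Its cross effect is a free
`ℤ[S_d]`-module of rank one, and each element of `cr_d(F)`, for `F` polynomial of degree at most
`d`, is the image of the generator under some morphism from `polyPow d` (`exists_polyPow_hom`).
Testing the counit of `cr_d ⊣ β` on this object shows that the counit is invertible
(`isIso_crRep_counit`), so `β` is fully faithful.

The other is `polyFree d S`, a quotient of the projective functor `R^{⊗d} ⊗ ℤ[S]`. These objects are
projective in `𝓕_d(gr)`, they have projective cross effects, every polynomial functor of degree at
most `d` is a quotient of one of them (`exists_epi_polyFree`), and they have no higher extensions in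
`𝓕(gr)` by polynomial functors of degree at most `d` (`subsingleton_ext_polyFree`).

The theorem follows formally. Since `cr_d` preserves monomorphisms, `β` preserves injectives. It is
left exact as a right adjoint, and it preserves epimorphisms because a cover of `β N` by some
`polyFree d S` corresponds to a map out of a projective module, which lifts. A fully faithful exact
functor preserving injectives is bijective on `Ext`; this settles `β`. The inclusion of `𝓕_d(gr)` is
settled by dimension shifting along the covers `polyFree d S`. The right adjoint itself is written
down directly, as a functor of equivariant functions (`coindEquiv`).

The substance is the study of `polyFree`. Filter `R^{⊗d} ⊗ ℤ[S]` by total augmentation degree, the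
`m`-th step being the sum of the `I^{a_1} ⊗ ⋯ ⊗ I^{a_d} ⊗ ℤ[S]` with `a_1 + ⋯ + a_d = m`, and divide
by the step `d + 1`. Two facts are needed.

The quotient by the step `m + 1` is polynomial of degree at most `m` with projective `m`-th cross
effect. For free groups `gr s ⊗ gr 1 ≅ gr (s + 1)`, so the quotient is built by extensions from
tensor powers of `gr 1`, whose cross effects are computed by hand. This is the predicate
`HasProjCr`.

The step `m` has no extensions, in any degree, by polynomial functors of degree less than `m`. This
is the predicate `Orth`. Its source is that `I^{⊗p} ⊗ ℤ[S]` is projective and generated by elements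
of its `p`-th cross effect, hence has no nonzero map to a functor of degree less than `p`. Powers
`I^s` are reached through the bar complex `⋯ → I ⊗ I ⊗ I^s → I ⊗ I^s → I^{s+1}`, which is exact
because `I^{s+1}` is, as a left module, a sum of copies of `I^s` by the Fox calculus; its terms
contain one factor `I` more, and the bound grows by one (`Orth.tens_Ipow_succ`). Both predicates
allow further tensor factors, so that they pass through these inductions. -/

/-- All the groups `Ext X B i` are trivial. -/
def ExtVanish (X B : C) : Prop := ∀ i : ℕ, ∀ x : Ext.{w} X B i, x = 0

lemma ExtVanish.of_iso {X Y B : C} (e : X ≅ Y) (h : ExtVanish.{w} X B) : ExtVanish.{w} Y B := by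
  intro i x
  have h₁ := h i ((Ext.mk₀ e.hom).comp x (zero_add i))
  have h₂ : (Ext.mk₀ e.inv).comp ((Ext.mk₀ e.hom).comp x (zero_add i)) (zero_add i) = x := by
    rw [Ext.mk₀_comp_mk₀_assoc, e.inv_hom_id, Ext.mk₀_id_comp]
  rw [← h₂, h₁, Ext.comp_zero]

lemma ExtVanish.of_isZero {X : C} (hX : IsZero X) (B : C) : ExtVanish.{w} X B := by
  intro i x
  have : (Ext.mk₀ (𝟙 X)).comp x (zero_add i) = x := Ext.mk₀_id_comp x
  rw [← this, hX.eq_of_src (𝟙 X) 0, Ext.mk₀_zero, Ext.zero_comp]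

lemma ExtVanish.ext {S : ShortComplex C} (hS : S.ShortExact) {B : C}
    (h₁ : ExtVanish.{w} S.X₁ B) (h₃ : ExtVanish.{w} S.X₃ B) : ExtVanish.{w} S.X₂ B := by
  intro i x
  obtain ⟨y, rfl⟩ := Ext.contravariant_sequence_exact₂ hS B x (h₁ _ _)
  rw [h₃ _ y, Ext.comp_zero]

lemma ExtVanish.quot {S : ShortComplex C} (hS : S.ShortExact) {B : C}
    (h₁ : ExtVanish.{w} S.X₁ B) (h₂ : ExtVanish.{w} S.X₂ B) : ExtVanish.{w} S.X₃ B := by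
  intro i x
  cases i with
  | zero =>
    have := hS.epi_g
    exact Ext.precomp_mk₀_injective_of_epi B S.g ((h₂ _ _).trans (h₂ _ _).symm)
  | succ n =>
    obtain ⟨y, rfl⟩ := Ext.contravariant_sequence_exact₃ hS B x (h₂ _ _) (add_comm 1 n)
    rw [h₁ _ y, Ext.comp_zero]

lemma ExtVanish.hom_eq_zero {X B : C} (h : ExtVanish.{w} X B) (f : X ⟶ B) : f = 0 := by
  have := h 0 (Ext.mk₀ f)
  rwa [Ext.mk₀_eq_zero_iff] at this

lemma ExtVanish.of_projective {X B : C} [Projective X] (h : ∀ f : X ⟶ B, f = 0) :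
    ExtVanish.{w} X B := by
  intro i x
  cases i with
  | zero =>
    obtain ⟨f, rfl⟩ := (Ext.mk₀_bijective X B).2 x
    rw [h f, Ext.mk₀_zero]
  | succ n => exact Ext.eq_zero_of_projective x

/-- An object with a left resolution by objects without extensions by `B` has no extensions
by `B` either. -/
lemma ExtVanish.of_resolution {B : C} (E : ℕ → C) (d : ∀ q, E (q + 1) ⟶ E q)
    (w : ∀ q, d (q + 1) ≫ d q = 0) (hE : ∀ q, ExtVanish.{w} (E q) B)
    (hex : ∀ q, (ShortComplex.mk (d (q + 1)) (d q) (w q)).Exact)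
    {X : C} (g : E 0 ⟶ X) [Epi g] (w' : d 0 ≫ g = 0) (hg : (ShortComplex.mk (d 0) g w').Exact) :
    ExtVanish.{w} X B := by
  -- The starting index `q` has to vary: the kernel of `E q ⟶ X` is resolved by the tail starting at
  -- `E (q + 1)`, and its extensions have degree one less.
  suffices H : ∀ (i q : ℕ) (X : C) (g : E q ⟶ X) (_ : Epi g) (w' : d q ≫ g = 0)
      (_ : (ShortComplex.mk (d q) g w').Exact) (x : Ext.{w} X B i), x = 0 from
    fun i => H i 0 X g inferInstance w' hg
  intro i
  induction i with
  | zero =>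
    intro q X g _ w' hg x
    exact Ext.precomp_mk₀_injective_of_epi B g ((hE q _ _).trans (hE q _ _).symm)
  | succ n ih =>
    intro q X g _ w' hg x
    let S := ShortComplex.mk (kernel.ι g) g (kernel.condition _)
    have hS : S.ShortExact := { exact := ShortComplex.exact_kernel _ }
    obtain ⟨y, rfl⟩ := Ext.contravariant_sequence_exact₃ hS B x (hE q _ _) (add_comm 1 n)
    have hepi : Epi (kernel.lift g (d q) w') := hg.epi_kernelLift
    have w'' : d (q + 1) ≫ kernel.lift g (d q) w' = 0 := by
      rw [← cancel_mono (kernel.ι g), Category.assoc, kernel.lift_ι, w, zero_comp]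
    let φ : ShortComplex.mk (d (q + 1)) (kernel.lift g (d q) w') w'' ⟶
        ShortComplex.mk (d (q + 1)) (d q) (w q) :=
      { τ₁ := 𝟙 _
        τ₂ := 𝟙 _
        τ₃ := kernel.ι g }
    have : Epi φ.τ₁ := by dsimp [φ]; infer_instance
    have : IsIso φ.τ₂ := by dsimp [φ]; infer_instance
    have : Mono φ.τ₃ := by dsimp [φ]; infer_instance
    have hy : y = 0 := ih (q + 1) (kernel g) _ hepi w''
      ((ShortComplex.exact_iff_of_epi_of_isIso_of_mono φ).2 (hex q)) y
    rw [hy, Ext.comp_zero]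

end ExtVanishing

/-- A fully faithful exact functor induces bijections on `Ext` if its source has enough
projective objects whose images have no higher extensions by objects in the image. -/
lemma mapExt_bijective_of_acyclic {C D : Type*} [Category* C] [Category* D] [Abelian C] [Abelian D]
    (F : C ⥤ D) [F.Additive] [PreservesFiniteLimits F] [PreservesFiniteColimits F]
    [F.Full] [F.Faithful] [HasExt C] [HasExt D]
    (h : ∀ X : C, ∃ (P : C) (p : P ⟶ X), Epi p ∧ Projective P ∧
      ∀ (Y : C) (n : ℕ), Subsingleton (Ext (F.obj P) (F.obj Y) (n + 1))) (X Y : C) (n : ℕ) :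
    Function.Bijective (F.mapExtAddHom X Y n) := by
  induction n generalizing X with
  | zero =>
    simpa [Ext.mapExactFunctor₀] using ⟨Functor.Faithful.map_injective, Functor.Full.map_surjective⟩
  | succ n hn =>
    -- Dimension shifting: `Ext (n + 1)` vanishes at `P` and at `F P`, so on both sides `Ext (n +
    -- 1)` of the cover's target is the cokernel of a map from `Ext n` of `P` to `Ext n` of the
    -- kernel of `p`.
    obtain ⟨P, p, _, _, hP⟩ := h X
    let S := ShortComplex.mk _ _ (kernel.condition p)
    have hS : S.ShortExact := { exact := ShortComplex.exact_kernel p }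
    have h₁ : Subsingleton (Ext S.X₂ Y (n + 1)) := Ext.subsingleton_of_projective P Y n
    have h₂ : Subsingleton (Ext (S.map F).X₂ (F.obj Y) (n + 1)) := hP Y n
    exact AddMonoidHom.bijective_of_surjective_of_bijective_of_right_exact _ _ _ _
      (F.mapExtAddHom S.X₂ Y n) (F.mapExtAddHom S.X₁ Y n) (F.mapExtAddHom S.X₃ Y (n + 1))
      (by ext; simp [Ext.mapExactFunctor_comp, Ext.mapExactFunctor_mk₀]; rfl)
      (by ext; simp [Ext.mapExactFunctor_comp, Ext.mapExactFunctor_extClass]; rfl)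
      ((ShortComplex.ab_exact_iff_function_exact _).1
        (Ext.contravariant_sequence_exact₁' hS Y n (n + 1) (add_comm 1 n)))
      ((ShortComplex.ab_exact_iff_function_exact _).1
        (Ext.contravariant_sequence_exact₁' (hS.map F) (F.obj Y) n (n + 1) (add_comm 1 n)))
      (hn _).surjective (hn _)
      (fun x₃ ↦ Ext.contravariant_sequence_exact₃ hS _ x₃ (by subsingleton) (add_comm 1 n))
      (fun y₃ ↦ Ext.contravariant_sequence_exact₃ (hS.map F) _ y₃ (by subsingleton) (add_comm 1 n))
end

noncomputable section

/-! ### Functors to abelian groups, elementwise -/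

section Elementwise

variable {F G H : GrFunctor}

/-- A natural transformation from a natural family of additive maps. -/
def natHom (φ : ∀ X : FreeGr, F.obj X →+ G.obj X)
    (h : ∀ {X Y : FreeGr} (f : X ⟶ Y) (x : F.obj X), φ Y (F.map f x) = G.map f (φ X x)) :
    F ⟶ G where
  app X := AddCommGrpCat.ofHom (φ X)
  naturality X Y f := by ext x; exact h f x

@[simp]
lemma natHom_app (φ : ∀ X : FreeGr, F.obj X →+ G.obj X) (h) (X : FreeGr) (x : F.obj X) :
    (natHom (F := F) (G := G) φ h).app X x = φ X x := rfl

lemma nat_hom_ext {f g : F ⟶ G} (h : ∀ X (x : F.obj X), f.app X x = g.app X x) : f = g := by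
  ext X x; exact h X x

@[simp]
lemma comp_app_apply (f : F ⟶ G) (g : G ⟶ H) (X : FreeGr) (x : F.obj X) :
    (f ≫ g).app X x = g.app X (f.app X x) := rfl

@[simp]
lemma zero_app_apply (X : FreeGr) (x : F.obj X) : (0 : F ⟶ G).app X x = 0 := rfl

lemma map_comp_apply' (F : GrFunctor) {X Y Z : FreeGr} (f : X ⟶ Y) (g : Y ⟶ Z) (x : F.obj X) :
    F.map (f ≫ g) x = F.map g (F.map f x) := by
  rw [F.map_comp, ConcreteCategory.comp_apply]

lemma map_id_apply' (F : GrFunctor) {X : FreeGr} (x : F.obj X) : F.map (𝟙 X) x = x := by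
  rw [F.map_id, ConcreteCategory.id_apply]

lemma isIso_of_bijective (f : F ⟶ G) (h : ∀ X, Function.Bijective (f.app X)) : IsIso f := by
  have : ∀ X, IsIso (f.app X) := fun X =>
    (ConcreteCategory.isIso_iff_bijective (f.app X)).2 (h X)
  exact NatIso.isIso_of_isIso_app f

lemma mono_of_injective (f : F ⟶ G) (h : ∀ X, Function.Injective (f.app X)) : Mono f := by
  have : ∀ X, Mono (f.app X) := fun X => (AddCommGrpCat.mono_iff_injective _).2 (h X)
  exact NatTrans.mono_of_mono_app f

lemma epi_of_surjective (f : F ⟶ G) (h : ∀ X, Function.Surjective (f.app X)) : Epi f := by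
  have : ∀ X, Epi (f.app X) := fun X => (AddCommGrpCat.epi_iff_surjective _).2 (h X)
  exact NatTrans.epi_of_epi_app f

lemma app_surjective_of_epi (f : F ⟶ G) [Epi f] (X : FreeGr) :
    Function.Surjective (f.app X) :=
  (AddCommGrpCat.epi_iff_surjective _).1 inferInstance

lemma evaluation_jointlyReflectIsomorphisms :
    JointlyReflectIsomorphisms fun X : FreeGr => (evaluation FreeGr AddCommGrpCat.{0}).obj X where
  isIso {F G} f _ := by
    have : ∀ X, IsIso (f.app X) := fun X =>
      inferInstanceAs (IsIso (((evaluation FreeGr AddCommGrpCat.{0}).obj X).map f))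
    exact NatIso.isIso_of_isIso_app f

lemma exact_of_elements (f : F ⟶ G) (g : G ⟶ H) (w : f ≫ g = 0)
    (h : ∀ X (y : G.obj X), g.app X y = 0 → ∃ x, f.app X x = y) :
    (ShortComplex.mk f g w).Exact := by
  rw [evaluation_jointlyReflectIsomorphisms.exact_iff]
  intro X
  rw [ShortComplex.ab_exact_iff]
  exact h X

lemma shortExact_of_elements (f : F ⟶ G) (g : G ⟶ H) (w : f ≫ g = 0)
    (hf : ∀ X, Function.Injective (f.app X)) (hg : ∀ X, Function.Surjective (g.app X))
    (h : ∀ X (y : G.obj X), g.app X y = 0 → ∃ x, f.app X x = y) :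
    (ShortComplex.mk f g w).ShortExact :=
  have := mono_of_injective f hf
  have := epi_of_surjective g hg
  { exact := exact_of_elements f g w h }

lemma exists_of_shortExact {S : ShortComplex GrFunctor} (hS : S.ShortExact) (X : FreeGr)
    (y : S.X₂.obj X) (hy : S.g.app X y = 0) : ∃ x, S.f.app X x = y := by
  have h := hS.exact.map ((evaluation FreeGr AddCommGrpCat.{0}).obj X)
  rw [ShortComplex.ab_exact_iff] at h
  exact h y hy

end Elementwise

/-! ### Pointwise tensor products -/

section Tensor

/-- The pointwise tensor product of two functors. -/
def tens (X A : GrFunctor) : GrFunctor where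
  obj G := AddCommGrpCat.of (X.obj G ⊗[ℤ] A.obj G)
  map f := AddCommGrpCat.ofHom
    (TensorProduct.map (X.map f).hom.toIntLinearMap (A.map f).hom.toIntLinearMap).toAddMonoidHom
  map_id G := by
    ext x
    change TensorProduct.map _ _ x = x
    induction x using TensorProduct.induction_on with
    | zero => simp
    | tmul x a => 
      simp only [TensorProduct.map_tmul]
      exact congrArg₂ _ (map_id_apply' X x) (map_id_apply' A a)
    | add x y hx hy => rw [map_add, hx, hy]
  map_comp f g := by
    ext x
    change TensorProduct.map _ _ x = TensorProduct.map _ _ (TensorProduct.map _ _ x)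
    induction x using TensorProduct.induction_on with
    | zero => simp
    | tmul x a =>
      simp only [TensorProduct.map_tmul]
      exact congrArg₂ _ (map_comp_apply' X f g x) (map_comp_apply' A f g a)
    | add x y hx hy => simp only [map_add, hx, hy]

variable {X Y Z A B D : GrFunctor}

/-- A pure tensor. -/
def tm {G : FreeGr} (x : X.obj G) (a : A.obj G) : (tens X A).obj G := x ⊗ₜ[ℤ] a

@[simp]
lemma tens_map_tm {G H : FreeGr} (f : G ⟶ H) (x : X.obj G) (a : A.obj G) :
    (tens X A).map f (tm x a) = tm (X.map f x) (A.map f a) := rfl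

lemma tm_add {G : FreeGr} (x : X.obj G) (a b : A.obj G) : tm x (a + b) = tm x a + tm x b :=
  TensorProduct.tmul_add x a b

lemma add_tm {G : FreeGr} (x y : X.obj G) (a : A.obj G) : tm (x + y) a = tm x a + tm y a :=
  TensorProduct.add_tmul x y a

lemma sub_tm {G : FreeGr} (x y : X.obj G) (a : A.obj G) : tm (x - y) a = tm x a - tm y a :=
  TensorProduct.sub_tmul x y a

lemma tm_sub {G : FreeGr} (x : X.obj G) (a b : A.obj G) : tm x (a - b) = tm x a - tm x b :=
  TensorProduct.tmul_sub x a b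

@[simp]
lemma zero_tm {G : FreeGr} (a : A.obj G) : tm (0 : X.obj G) a = 0 :=
  TensorProduct.zero_tmul _ a

@[simp]
lemma tm_zero {G : FreeGr} (x : X.obj G) : tm x (0 : A.obj G) = 0 :=
  TensorProduct.tmul_zero _ x

@[elab_as_elim]
lemma tens_induction {G : FreeGr} {p : (tens X A).obj G → Prop} (z : (tens X A).obj G)
    (zero : p 0) (tm : ∀ x a, p (tm x a)) (add : ∀ x y, p x → p y → p (x + y)) : p z :=
  TensorProduct.induction_on (motive := p) z zero tm add

lemma tens_addHom_ext {G : FreeGr} {M : Type*} [AddCommGroup M] {f g : (tens X A).obj G →+ M}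
    (h : ∀ x a, f (tm x a) = g (tm x a)) : f = g := by
  ext z
  induction z using tens_induction with
  | zero => simp
  | tm x a => exact h x a
  | add x y hx hy => rw [map_add, map_add, hx, hy]

lemma tens_natural {F : GrFunctor} (φ : ∀ G : FreeGr, (tens X A).obj G →+ F.obj G) {G H : FreeGr}
    (f : G ⟶ H)
    (h : ∀ x a, φ H (tm (X.map f x) (A.map f a)) = F.map f (φ G (tm x a))) (z : (tens X A).obj G) :
    φ H ((tens X A).map f z) = F.map f (φ G z) :=
  DFunLike.congr_fun (tens_addHom_ext (f := (φ H).comp ((tens X A).map f).hom)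
    (g := (F.map f).hom.comp (φ G)) h) z

/-- Functoriality of the pointwise tensor product. -/
def tensMap (f : X ⟶ Y) (g : A ⟶ B) : tens X A ⟶ tens Y B :=
  natHom (fun G => (TensorProduct.map (f.app G).hom.toIntLinearMap
    (g.app G).hom.toIntLinearMap).toAddMonoidHom) (by
    intro G H φ z
    refine tens_natural (F := tens Y B) (fun G => (TensorProduct.map
      (f.app G).hom.toIntLinearMap (g.app G).hom.toIntLinearMap).toAddMonoidHom) φ
      (fun x a => ?_) z
    exact congrArg₂ (fun y b => tm y b) (app_map_apply f φ x) (app_map_apply g φ a))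

@[simp]
lemma tensMap_tm (f : X ⟶ Y) (g : A ⟶ B) {G : FreeGr} (x : X.obj G) (a : A.obj G) :
    (tensMap f g).app G (tm x a) = tm (f.app G x) (g.app G a) := rfl

lemma tens_hom_ext {F : GrFunctor} {f g : tens X A ⟶ F}
    (h : ∀ G x a, f.app G (tm x a) = g.app G (tm x a)) : f = g := by
  ext G : 2
  exact AddCommGrpCat.hom_ext (tens_addHom_ext (h G))

lemma tensMap_comp (f : X ⟶ Y) (g : A ⟶ B) (f' : Y ⟶ Z) (g' : B ⟶ D) :
    tensMap f g ≫ tensMap f' g' = tensMap (f ≫ f') (g ≫ g') :=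
  tens_hom_ext fun _ _ _ => rfl

@[simp]
lemma tensMap_id (X A : GrFunctor) : tensMap (𝟙 X) (𝟙 A) = 𝟙 _ :=
  tens_hom_ext fun _ _ _ => rfl

lemma tensMap_zero_right (f : X ⟶ Y) : tensMap f (0 : A ⟶ B) = 0 :=
  tens_hom_ext fun _ _ _ => by simp

lemma tensMap_zero_left (g : A ⟶ B) : tensMap (0 : X ⟶ Y) g = 0 :=
  tens_hom_ext fun _ _ _ => by simp

/-- The pointwise tensor product of isomorphisms. -/
def tensIso (e : X ≅ Y) (e' : A ≅ B) : tens X A ≅ tens Y B where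
  hom := tensMap e.hom e'.hom
  inv := tensMap e.inv e'.inv
  hom_inv_id := by simp [tensMap_comp]
  inv_hom_id := by simp [tensMap_comp]

/-- A biadditive map, curried. -/
def biHom {M N P : Type*} [AddCommGroup M] [AddCommGroup N] [AddCommGroup P] (f : M → N → P)
    (h₁ : ∀ x y z, f (x + y) z = f x z + f y z) (h₂ : ∀ x y z, f x (y + z) = f x y + f x z) :
    M →+ N →+ P :=
  AddMonoidHom.mk' (fun x => AddMonoidHom.mk' (f x) (h₂ x)) fun x y => by
    ext z; exact h₁ x y z

@[simp]
lemma biHom_apply {M N P : Type*} [AddCommGroup M] [AddCommGroup N] [AddCommGroup P]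
    (f : M → N → P) (h₁ h₂) (x : M) (y : N) : biHom f h₁ h₂ x y = f x y := rfl

/-- Pure tensors as a biadditive map. -/
def tmHom (G : FreeGr) : X.obj G →+ A.obj G →+ (tens X A).obj G :=
  biHom tm add_tm tm_add

@[simp]
lemma tmHom_apply {G : FreeGr} (x : X.obj G) (a : A.obj G) : tmHom G x a = tm x a := rfl

/-- The universal property of the pointwise tensor product at one object. -/
def tensLiftAt {G : FreeGr} {M : Type*} [AddCommGroup M] (φ : X.obj G →+ A.obj G →+ M) :
    (tens X A).obj G →+ M :=
  TensorProduct.liftAddHom φ fun r x a => by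
    rw [map_zsmul, map_zsmul, AddMonoidHom.smul_apply]

@[simp]
lemma tensLiftAt_tm {G : FreeGr} {M : Type*} [AddCommGroup M] (φ : X.obj G →+ A.obj G →+ M)
    (x : X.obj G) (a : A.obj G) : tensLiftAt φ (tm x a) = φ x a := rfl

/-- The universal property of the pointwise tensor product. -/
def tensLift {F : GrFunctor} (φ : ∀ G : FreeGr, X.obj G →+ A.obj G →+ F.obj G)
    (h : ∀ {G H : FreeGr} (f : G ⟶ H) (x : X.obj G) (a : A.obj G),
      φ H (X.map f x) (A.map f a) = F.map f (φ G x a)) : tens X A ⟶ F :=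
  natHom (fun G => tensLiftAt (φ G)) fun f z =>
    tens_natural (fun G => tensLiftAt (φ G)) f (h f) z

/-- Associativity of the pointwise tensor product. -/
def tensAssocHom (X Y A : GrFunctor) : tens (tens X Y) A ⟶ tens X (tens Y A) :=
  tensLift (fun G => tensLiftAt (biHom (fun x y => (tmHom G x).comp (tmHom G y))
    (fun x y z => by ext; simp [add_tm]) (fun x y z => by ext; simp [tm_add]))) (by
    intro G H f z a
    induction z using tens_induction with
    | zero => simp
    | tm x y => simp
    | add x y hx hy => simp only [map_add, AddMonoidHom.add_apply, hx, hy])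

/-- Associativity of the pointwise tensor product, in the other direction. -/
def tensAssocInv (X Y A : GrFunctor) : tens X (tens Y A) ⟶ tens (tens X Y) A :=
  tensLift (fun G => biHom (fun x => tensLiftAt (biHom (fun y a => tm (tm x y) a)
    (fun x y z => by simp [add_tm, tm_add]) (fun x y z => by simp [tm_add])))
    (fun x y z => by
      induction z using tens_induction with
      | zero => simp
      | tm x y => simp [add_tm]
      | add x y hx hy => rw [map_add, hx, hy, map_add, map_add]; abel)
    (fun x y z => by simp)) (by
    intro G H f z a
    induction a using tens_induction with
    | zero => simp
    | tm x y => simp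
    | add x y hx hy => simp only [map_add, hx, hy])

/-- The associativity isomorphism of the pointwise tensor product. -/
def tensAssoc (X Y A : GrFunctor) : tens (tens X Y) A ≅ tens X (tens Y A) where
  hom := tensAssocHom X Y A
  inv := tensAssocInv X Y A
  hom_inv_id := by
    refine tens_hom_ext fun G z a => ?_
    induction z using tens_induction with
    | zero => simp
    | tm x y => rfl
    | add x y hx hy => simp only [map_add, add_tm, hx, hy]
  inv_hom_id := by
    refine tens_hom_ext fun G x z => ?_
    induction z using tens_induction with
    | zero => simp
    | tm x y => rfl
    | add x y hx hy => simp only [map_add, tm_add, hx, hy]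

/-- The values of the functor are flat abelian groups. -/
class IsFlat (X : GrFunctor) : Prop where
  flat (G : FreeGr) : Module.Flat ℤ (X.obj G)

instance [IsFlat X] (G : FreeGr) : Module.Flat ℤ (X.obj G) := IsFlat.flat G

instance [IsFlat X] [IsFlat A] : IsFlat (tens X A) where
  flat G := by
    have h : Module.Flat ℤ (X.obj G ⊗[ℤ] A.obj G) := Module.Flat.instTensorProduct ..
    exact h

lemma flat_int_iff {M : Type*} [AddCommGroup M] :
    Module.Flat ℤ M ↔ ∀ (n : ℤ) (x : M), n • x = 0 → n = 0 ∨ x = 0 := by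
  rw [Module.Flat.flat_iff_torsion_eq_bot_of_isBezout]
  constructor
  · intro h n x hx
    by_cases hn : n = 0
    · exact Or.inl hn
    · right
      rw [← Submodule.mem_bot ℤ, ← h]
      exact ⟨⟨n, mem_nonZeroDivisors_of_ne_zero hn⟩, hx⟩
  · intro h
    rw [eq_bot_iff]
    rintro x ⟨⟨n, hn⟩, hx⟩
    exact (h n x hx).resolve_left (nonZeroDivisors.ne_zero hn)

/-- Over `ℤ` flat means torsion free, and this passes to subgroups. -/
lemma IsFlat.of_mono (f : X ⟶ Y) (hf : ∀ G, Function.Injective (f.app G)) [IsFlat Y] :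
    IsFlat X where
  flat G := by
    rw [flat_int_iff]
    intro n x hx
    refine (flat_int_iff.1 (IsFlat.flat (X := Y) G) n (f.app G x) ?_).imp_right fun h =>
      hf G (by rw [h, map_zero])
    rw [← map_zsmul, hx, map_zero]

lemma tensMap_injective_left [IsFlat A] (f : X ⟶ Y) (G : FreeGr)
    (hf : Function.Injective (f.app G)) : Function.Injective ((tensMap f (𝟙 A)).app G) :=
  Module.Flat.rTensor_preserves_injective_linearMap (M := A.obj G)
    (f.app G).hom.toIntLinearMap hf

lemma tensMap_injective_right [IsFlat X] (g : A ⟶ B) (G : FreeGr)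
    (hg : Function.Injective (g.app G)) : Function.Injective ((tensMap (𝟙 X) g).app G) :=
  Module.Flat.lTensor_preserves_injective_linearMap (M := X.obj G)
    (g.app G).hom.toIntLinearMap hg

lemma tensMap_surjective (f : X ⟶ Y) (g : A ⟶ B) (G : FreeGr)
    (hf : Function.Surjective (f.app G)) (hg : Function.Surjective (g.app G)) :
    Function.Surjective ((tensMap f g).app G) :=
  TensorProduct.map_surjective (g := (f.app G).hom.toIntLinearMap)
    (g' := (g.app G).hom.toIntLinearMap) hf hg

lemma tensMap_exact_right (X : GrFunctor) (f : A ⟶ B) (g : B ⟶ D) (G : FreeGr)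
    (hg : Function.Surjective (g.app G)) (h : ∀ y, g.app G y = 0 ↔ ∃ x, f.app G x = y)
    (z : (tens X B).obj G) :
    (tensMap (𝟙 X) g).app G z = 0 ↔ ∃ y, (tensMap (𝟙 X) f).app G y = z :=
  lTensor_exact (f := (f.app G).hom.toIntLinearMap)
    (g := (g.app G).hom.toIntLinearMap) (X.obj G) (fun y => h y) hg z

lemma tensMap_exact_left (A : GrFunctor) (f : X ⟶ Y) (g : Y ⟶ Z) (G : FreeGr)
    (hg : Function.Surjective (g.app G)) (h : ∀ y, g.app G y = 0 ↔ ∃ x, f.app G x = y)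
    (z : (tens Y A).obj G) :
    (tensMap g (𝟙 A)).app G z = 0 ↔ ∃ y, (tensMap f (𝟙 A)).app G y = z :=
  rTensor_exact (f := (f.app G).hom.toIntLinearMap)
    (g := (g.app G).hom.toIntLinearMap) (A.obj G) (fun y => h y) hg z

lemma exact_elements {S : ShortComplex GrFunctor} (hS : S.ShortExact) (X : FreeGr)
    (y : S.X₂.obj X) : S.g.app X y = 0 ↔ ∃ x, S.f.app X x = y := by
  refine ⟨exists_of_shortExact hS X y, ?_⟩
  rintro ⟨x, rfl⟩
  rw [← comp_app_apply, S.zero, zero_app_apply]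

/-- Tensoring with a flat functor preserves short exact sequences. -/
lemma shortExact_tens_left [IsFlat X] {S : ShortComplex GrFunctor} (hS : S.ShortExact) :
    (ShortComplex.mk (tensMap (𝟙 X) S.f) (tensMap (𝟙 X) S.g)
      (by rw [tensMap_comp, S.zero, tensMap_zero_right])).ShortExact := by
  have := hS.mono_f
  have := hS.epi_g
  refine shortExact_of_elements _ _ _
    (fun G => tensMap_injective_right _ _ (app_injective_of_mono S.f G))
    (fun G => tensMap_surjective _ _ _ (fun x => ⟨x, rfl⟩) (app_surjective_of_epi S.g G))
    (fun G z hz => (tensMap_exact_right X S.f S.g G (app_surjective_of_epi S.g G)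
      (exact_elements hS G) z).1 hz)

end Tensor
end

noncomputable section

/-! ### Group rings, powers of the augmentation ideal, Fox derivatives -/

section GroupRing

/-- The integral group ring of an object of `gr`. -/
abbrev ZG (G : FreeGr) : Type := MonoidAlgebra ℤ G.group

/-- A group element, viewed in the group ring. -/
def el {G : FreeGr} : G.group →* ZG G := MonoidAlgebra.of ℤ G.group

/-- The augmentation. -/
def aug (G : FreeGr) : ZG G →+* ℤ :=
  (MonoidAlgebra.lift ℤ ℤ G.group (1 : G.group →* ℤ)).toRingHom

variable {G H : FreeGr}

@[simp]
lemma aug_el (g : G.group) : aug G (el g) = 1 :=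
  MonoidAlgebra.lift_of (R := ℤ) (1 : G.group →* ℤ) g

/-- Functoriality of the group ring. -/
def ZGmap (f : G ⟶ H) : ZG G →+* ZG H := MonoidAlgebra.mapDomainRingHom ℤ f.toMonoidHom

@[simp]
lemma ZGmap_el (f : G ⟶ H) (g : G.group) : ZGmap f (el g) = el (f.toMonoidHom g) := by
  simp [ZGmap, el, MonoidAlgebra.mapDomain_single]

@[elab_as_elim]
lemma zg_induction {p : ZG G → Prop} (x : ZG G) (of : ∀ g, p (el g))
    (add : ∀ x y, p x → p y → p (x + y)) (smul : ∀ (n : ℤ) x, p x → p (n • x)) : p x :=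
  MonoidAlgebra.induction_on x of add smul

lemma zg_hom_ext {M : Type*} [AddCommGroup M] {f g : ZG G →+ M} (h : ∀ x, f (el x) = g (el x)) :
    f = g := by
  refine AddMonoidHom.ext fun x => ?_
  induction x using zg_induction with
  | of x => exact h x
  | add x y hx hy => rw [map_add, map_add, hx, hy]
  | smul n x hx => rw [map_zsmul, map_zsmul, hx]

@[simp]
lemma aug_ZGmap (f : G ⟶ H) (x : ZG G) : aug H (ZGmap f x) = aug G x :=
  DFunLike.congr_fun (zg_hom_ext (f := (aug H).toAddMonoidHom.comp (ZGmap f).toAddMonoidHom)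
    (g := (aug G).toAddMonoidHom) fun g => by
      change aug H (ZGmap f (el g)) = aug G (el g); simp only [ZGmap_el, aug_el]) x

/-- The powers of the augmentation ideal. -/
def augPow (G : FreeGr) : ℕ → Submodule ℤ (ZG G)
  | 0 => ⊤
  | s + 1 => augPow G s * LinearMap.ker (aug G).toAddMonoidHom.toIntLinearMap

lemma mul_mem_augPow_succ {s : ℕ} {a b : ZG G} (ha : a ∈ augPow G s) (hb : aug G b = 0) :
    a * b ∈ augPow G (s + 1) := Submodule.mul_mem_mul ha hb

@[elab_as_elim]
lemma augPow_succ_induction {s : ℕ} {p : ZG G → Prop} {x : ZG G} (hx : x ∈ augPow G (s + 1))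
    (mul : ∀ a ∈ augPow G s, ∀ b, aug G b = 0 → p (a * b))
    (add : ∀ x y, p x → p y → p (x + y)) : p x :=
  Submodule.mul_induction_on hx mul add

lemma mem_augPow_zero (x : ZG G) : x ∈ augPow G 0 := Submodule.mem_top

lemma mem_augPow_one {x : ZG G} : x ∈ augPow G 1 ↔ aug G x = 0 := by
  constructor
  · intro hx
    refine augPow_succ_induction hx (fun a _ b hb => ?_) fun x y hx hy => ?_
    · rw [map_mul, hb, mul_zero]
    · rw [map_add, hx, hy, add_zero]
  · intro hx
    rw [← one_mul x]
    exact mul_mem_augPow_succ (mem_augPow_zero 1) hx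

lemma mul_mem_augPow_left {s : ℕ} (a : ZG G) {b : ZG G} (hb : b ∈ augPow G s) :
    a * b ∈ augPow G s := by
  induction s generalizing b with
  | zero => exact mem_augPow_zero _
  | succ s ih =>
    refine augPow_succ_induction hb (fun c hc d hd => ?_) fun x y hx hy => ?_
    · rw [← mul_assoc]
      exact mul_mem_augPow_succ (ih hc) hd
    · rw [mul_add]
      exact add_mem hx hy

/-- `augPow` appends factors of augmentation zero on the right, whereas the bar complex multiplies
on the left; this bridges the two conventions. -/
lemma aug_mul_mem_augPow {s : ℕ} {a b : ZG G} (ha : aug G a = 0) (hb : b ∈ augPow G s) :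
    a * b ∈ augPow G (s + 1) := by
  induction s generalizing b with
  | zero => rw [mem_augPow_one, map_mul, ha, zero_mul]
  | succ s ih =>
    refine augPow_succ_induction hb (fun c hc d hd => ?_) fun x y hx hy => ?_
    · rw [← mul_assoc]
      exact mul_mem_augPow_succ (ih hc) hd
    · rw [mul_add]
      exact add_mem hx hy

lemma augPow_succ_le (s : ℕ) : augPow G (s + 1) ≤ augPow G s := by
  intro x hx
  induction s generalizing x with
  | zero => exact mem_augPow_zero x
  | succ s ih =>
    refine augPow_succ_induction hx (fun c hc d hd => ?_) fun x y hx hy => ?_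
    · exact mul_mem_augPow_succ (ih hc) hd
    · exact add_mem hx hy

lemma map_mem_augPow (f : G ⟶ H) {s : ℕ} {x : ZG G} (hx : x ∈ augPow G s) :
    ZGmap f x ∈ augPow H s := by
  induction s generalizing x with
  | zero => exact mem_augPow_zero _
  | succ s ih =>
    refine augPow_succ_induction hx (fun c hc d hd => ?_) fun x y hx hy => ?_
    · rw [map_mul]
      exact mul_mem_augPow_succ (ih hc) (by rw [aug_ZGmap, hd])
    · rw [map_add]
      exact add_mem hx hy

/-- The elements `xⱼ - 1` of the augmentation ideal. -/
def genSub (j : Fin G.rank) : ZG G := el (FreeGroup.of j) - 1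

lemma aug_genSub (j : Fin G.rank) : aug G (genSub j) = 0 := by
  rw [genSub, map_sub, aug_el, map_one, sub_self]

/-- The action of the free group on its group ring by affine maps, the `j`-th generator `xⱼ`
acting by `r ↦ xⱼ r + 1` and the other ones by multiplication. -/
def foxPerm (j : Fin G.rank) : G.group →* Equiv.Perm (ZG G) :=
  FreeGroup.lift fun i =>
    { toFun r := el (FreeGroup.of i) * r + if i = j then 1 else 0
      invFun r := el (FreeGroup.of i)⁻¹ * (r - if i = j then 1 else 0)
      left_inv r := by
        beta_reduce
        rw [add_sub_cancel_right, ← mul_assoc, ← map_mul, inv_mul_cancel, map_one, one_mul]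
      right_inv r := by
        beta_reduce
        rw [← mul_assoc, ← map_mul, mul_inv_cancel, map_one, one_mul, sub_add_cancel] }

/-- The action is affine with linear part left multiplication, so its translation part `g ↦ foxPerm
j g 0` is a crossed homomorphism. It sends the `j`-th generator to `1` and the others to `0`, which
characterizes the Fox derivative. -/
lemma foxPerm_apply (j : Fin G.rank) (g : G.group) (r : ZG G) :
    foxPerm j g r = el g * r + foxPerm j g 0 := by
  induction g using FreeGroup.induction_on generalizing r with
  | C1 => simp
  | of i => simp [foxPerm]
  | inv_of i _ =>
    rw [map_inv]
    simp [foxPerm, Equiv.Perm.inv_def, mul_add, sub_eq_add_neg]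
  | mul x y hx hy =>
    rw [map_mul, Equiv.Perm.mul_apply, Equiv.Perm.mul_apply, hx, hy, hx (foxPerm j y 0),
      map_mul, mul_add, mul_assoc, add_assoc]

/-- The Fox derivative with respect to the `j`-th generator. -/
def foxD (j : Fin G.rank) : ZG G →+ ZG G :=
  MonoidAlgebra.liftNC (Int.castAddHom (ZG G)) fun g => foxPerm j g 0

lemma foxD_el (j : Fin G.rank) (g : G.group) : foxD j (el g) = foxPerm j g 0 := by
  simp [foxD, el]

lemma foxD_mul (j : Fin G.rank) (a b : ZG G) :
    foxD j (a * b) = a * foxD j b + aug G b • foxD j a := by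
  induction a using zg_induction with
  | of g =>
    induction b using zg_induction with
    | of h =>
      rw [aug_el, one_smul, ← map_mul, foxD_el, foxD_el, foxD_el, map_mul,
        Equiv.Perm.mul_apply, foxPerm_apply]
    | add x y hx hy => simp only [mul_add, map_add, hx, hy, add_smul]; abel
    | smul n x hx =>
      rw [mul_smul_comm, map_zsmul, hx, map_zsmul, map_zsmul, mul_smul_comm, smul_add, smul_assoc]
  | add x y hx hy => simp only [add_mul, map_add, hx, hy, smul_add]; abel
  | smul n x hx =>
    rw [smul_mul_assoc, map_zsmul, hx, map_zsmul, smul_add, smul_mul_assoc, smul_comm]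

lemma foxD_one (j : Fin G.rank) : foxD j (1 : ZG G) = 0 := by
  rw [← map_one (el (G := G)), foxD_el, map_one, Equiv.Perm.one_apply]

lemma foxD_genSub (i j : Fin G.rank) : foxD j (genSub i) = if i = j then 1 else 0 := by
  rw [genSub, map_sub, foxD_el, foxD_one, sub_zero]
  simp [foxPerm]

/-- The fundamental formula of the Fox calculus. -/
lemma fox_formula (v : ZG G) : v = aug G v • 1 + ∑ j, foxD j v * genSub j := by
  induction v using zg_induction with
  | of g =>
    rw [aug_el, one_smul]
    induction g using FreeGroup.induction_on with
    | C1 => simp [foxD_one]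
    | of i =>
      have h (j : Fin G.rank) : foxD j (el (FreeGroup.of i)) = if i = j then (1 : ZG G) else 0 := by
        rw [foxD_el]; simp [foxPerm]
      simp only [h, ite_mul, one_mul, zero_mul, Finset.sum_ite_eq, Finset.mem_univ, if_true]
      rw [genSub]; abel
    | inv_of i h =>
      -- Differentiate the relation `x⁻¹ x = 1`.
      have key (j : Fin G.rank) : foxD j (el (FreeGroup.of i)⁻¹) =
          - (el (FreeGroup.of i)⁻¹ * foxD j (el (FreeGroup.of i))) := by
        have := foxD_mul j (el (FreeGroup.of i)⁻¹) (el (FreeGroup.of i))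
        rw [← map_mul, inv_mul_cancel, aug_el, one_smul] at this
        rw [eq_neg_iff_add_eq_zero, add_comm, ← this, foxD_el, map_one, Equiv.Perm.one_apply]
      simp only [key, neg_mul, mul_assoc, Finset.sum_neg_distrib, ← Finset.mul_sum]
      rw [← sub_eq_iff_eq_add'.2 h, mul_sub, ← map_mul, inv_mul_cancel, map_one]
      simp
    | mul x y hx hy =>
      have hxy : el (x * y) = el x * el y := map_mul _ _ _
      simp only [hxy, foxD_mul, aug_el, one_smul, add_mul, Finset.sum_add_distrib, mul_assoc,
        ← Finset.mul_sum]
      rw [← sub_eq_iff_eq_add'.2 hx, ← sub_eq_iff_eq_add'.2 hy]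
      rw [mul_sub, mul_one]; abel
  | add x y hx hy =>
    simp only [map_add, add_smul, add_mul, Finset.sum_add_distrib]
    nth_rw 1 [hx, hy]
    abel
  | smul n x hx =>
    simp only [map_zsmul, smul_mul_assoc, ← Finset.smul_sum]
    rw [smul_assoc, ← smul_add, ← hx]

lemma fox_formula_of_aug {v : ZG G} (hv : aug G v = 0) : ∑ j, foxD j v * genSub j = v := by
  conv_rhs => rw [fox_formula v, hv, zero_smul, zero_add]

/-- When `b` has augmentation zero the derivative of `a * b` is `a * foxD j b`, and powers of the
augmentation ideal are also right ideals. -/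
lemma foxD_mem {s : ℕ} (j : Fin G.rank) {v : ZG G} (hv : v ∈ augPow G (s + 1)) :
    foxD j v ∈ augPow G s := by
  refine augPow_succ_induction hv (fun a ha b hb => ?_) fun x y hx hy => ?_
  · rw [foxD_mul, hb, zero_smul, add_zero]
    cases s with
    | zero => exact mem_augPow_zero _
    | succ s =>
      refine augPow_succ_induction ha (fun c hc d hd => ?_) fun x y hx hy => ?_
      · rw [mul_assoc]
        exact mul_mem_augPow_succ hc (by rw [map_mul, hd, zero_mul])
      · rw [add_mul]
        exact add_mem hx hy
  · rw [map_add]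
    exact add_mem hx hy

lemma aug_eq_zero_of_mem {s : ℕ} {v : ZG G} (hv : v ∈ augPow G (s + 1)) : aug G v = 0 := by
  induction s with
  | zero => exact mem_augPow_one.1 hv
  | succ s ih => exact ih (augPow_succ_le _ hv)

/-- The quotients of successive powers of the augmentation ideal are torsion free. -/
lemma mem_augPow_of_smul_mem {s : ℕ} {n : ℤ} (hn : n ≠ 0) {v : ZG G} (hv : v ∈ augPow G s)
    (h : n • v ∈ augPow G (s + 1)) : v ∈ augPow G (s + 1) := by
  induction s generalizing v with
  | zero =>
    rw [mem_augPow_one, map_zsmul] at h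
    rw [mem_augPow_one]
    exact (smul_eq_zero.1 h).resolve_left hn
  | succ s ih =>
    -- The coefficients of `v` along the `genSub j` are its Fox derivatives, which lie one power
    -- lower and inherit the divisibility hypothesis.
    rw [← fox_formula_of_aug (aug_eq_zero_of_mem hv)]
    refine Submodule.sum_mem _ fun j _ => mul_mem_augPow_succ (ih (foxD_mem j hv) ?_) (aug_genSub j)
    rw [← map_zsmul]
    exact foxD_mem j h

end GroupRing
end

noncomputable section

/-! ### Subfunctors and quotient functors -/

/-- A subfunctor of a functor to abelian groups. -/
structure Subf (W : GrFunctor) where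
  carrier : ∀ G : FreeGr, AddSubgroup (W.obj G)
  map_mem : ∀ {G H : FreeGr} (f : G ⟶ H) {x : W.obj G}, x ∈ carrier G → W.map f x ∈ carrier H

namespace Subf

variable {W X Y : GrFunctor}

/-- A subfunctor, as a functor. -/
def fn (U : Subf W) : GrFunctor where
  obj G := AddCommGrpCat.of (U.carrier G)
  map f := AddCommGrpCat.ofHom (((W.map f).hom.comp (U.carrier _).subtype).codRestrict
    (U.carrier _) fun x => U.map_mem f x.2)
  map_id G := AddCommGrpCat.hom_ext (AddMonoidHom.ext fun x =>
    Subtype.ext (map_id_apply' W x.1))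
  map_comp f g := AddCommGrpCat.hom_ext (AddMonoidHom.ext fun x =>
    Subtype.ext (map_comp_apply' W f g x.1))

/-- The inclusion of a subfunctor. -/
def ι (U : Subf W) : U.fn ⟶ W := natHom (fun G => (U.carrier G).subtype) fun _ _ => rfl

lemma ι_injective (U : Subf W) (G : FreeGr) : Function.Injective (U.ι.app G) :=
  Subtype.val_injective

lemma ι_mem (U : Subf W) {G : FreeGr} (x : U.fn.obj G) : U.ι.app G x ∈ U.carrier G := x.2

lemma exists_ι (U : Subf W) {G : FreeGr} {x : W.obj G} (hx : x ∈ U.carrier G) :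
    ∃ y, U.ι.app G y = x := ⟨⟨x, hx⟩, rfl⟩

/-- A natural transformation with values in a subfunctor factors through it. -/
def lift (U : Subf W) (f : X ⟶ W) (h : ∀ G x, f.app G x ∈ U.carrier G) : X ⟶ U.fn :=
  natHom (fun G => (f.app G).hom.codRestrict (U.carrier G) (h G)) fun φ x =>
    Subtype.ext (app_map_apply f φ x)

/-- The quotient by a subfunctor. -/
def quo (U : Subf W) : GrFunctor where
  obj G := AddCommGrpCat.of (W.obj G ⧸ U.carrier G)
  map {G H} f := AddCommGrpCat.ofHom (QuotientAddGroup.map (U.carrier G) (U.carrier H)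
    (W.map f).hom fun _ hx => U.map_mem f hx)
  map_id G := by
    refine AddCommGrpCat.hom_ext (AddMonoidHom.ext fun x => ?_)
    obtain ⟨x, rfl⟩ := QuotientAddGroup.mk_surjective x
    exact congrArg (QuotientAddGroup.mk (s := U.carrier _)) (map_id_apply' W x)
  map_comp f g := by
    refine AddCommGrpCat.hom_ext (AddMonoidHom.ext fun x => ?_)
    obtain ⟨x, rfl⟩ := QuotientAddGroup.mk_surjective x
    exact congrArg (QuotientAddGroup.mk (s := U.carrier _)) (map_comp_apply' W f g x)

/-- The projection to the quotient. -/
def π (U : Subf W) : W ⟶ U.quo :=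
  natHom (fun G => QuotientAddGroup.mk' (U.carrier G)) fun _ _ => rfl

lemma π_surjective (U : Subf W) (G : FreeGr) : Function.Surjective (U.π.app G) :=
  QuotientAddGroup.mk'_surjective _

instance (U : Subf W) : Epi U.π := epi_of_surjective _ U.π_surjective

lemma π_eq_zero_iff (U : Subf W) {G : FreeGr} (x : W.obj G) :
    U.π.app G x = 0 ↔ x ∈ U.carrier G :=
  QuotientAddGroup.eq_zero_iff x

lemma ι_π (U : Subf W) : U.ι ≫ U.π = 0 :=
  nat_hom_ext fun G x => (U.π_eq_zero_iff _).2 x.2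

lemma shortExact (U : Subf W) : (ShortComplex.mk U.ι U.π U.ι_π).ShortExact :=
  shortExact_of_elements _ _ _ U.ι_injective U.π_surjective fun _ _ hy =>
    U.exists_ι ((U.π_eq_zero_iff _).1 hy)

/-- A natural transformation which kills a subfunctor factors through the quotient. -/
def desc (U : Subf W) (f : W ⟶ X) (h : ∀ G x, x ∈ U.carrier G → f.app G x = 0) : U.quo ⟶ X :=
  natHom (fun G => QuotientAddGroup.lift (U.carrier G) (f.app G).hom (h G)) fun φ x => by
    obtain ⟨x, rfl⟩ := QuotientAddGroup.mk_surjective x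
    exact app_map_apply f φ x

/-- The image of a natural transformation. -/
def range (f : X ⟶ W) : Subf W where
  carrier G := (f.app G).hom.range
  map_mem := by
    rintro G H φ _ ⟨x, rfl⟩
    exact ⟨X.map φ x, app_map_apply f φ x⟩

/-- The image of a subfunctor. -/
def map (f : X ⟶ W) (U : Subf X) : Subf W where
  carrier G := (U.carrier G).map (f.app G).hom
  map_mem := by
    rintro G H φ _ ⟨x, hx, rfl⟩
    exact ⟨X.map φ x, U.map_mem φ hx, app_map_apply f φ x⟩

instance : LE (Subf W) := ⟨fun U V => ∀ G, U.carrier G ≤ V.carrier G⟩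

instance : Max (Subf W) where
  max U V :=
    { carrier G := U.carrier G ⊔ V.carrier G
      map_mem := by
        intro G H φ x hx
        obtain ⟨y, hy, z, hz, rfl⟩ := AddSubgroup.mem_sup.1 hx
        rw [map_add]
        exact AddSubgroup.add_mem_sup (U.map_mem φ hy) (V.map_mem φ hz) }

instance : Top (Subf W) := ⟨⟨fun _ => ⊤, fun _ _ _ => AddSubgroup.mem_top _⟩⟩

instance : Bot (Subf W) := ⟨⟨fun _ => ⊥, by
  rintro G H φ _ rfl
  rw [map_zero]
  exact zero_mem _⟩⟩

lemma mem_sup {U V : Subf W} {G : FreeGr} {x : W.obj G} :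
    x ∈ (U ⊔ V).carrier G ↔ ∃ y ∈ U.carrier G, ∃ z ∈ V.carrier G, y + z = x :=
  AddSubgroup.mem_sup

lemma mem_top {G : FreeGr} (x : W.obj G) : x ∈ (⊤ : Subf W).carrier G := AddSubgroup.mem_top x

/-- The inclusion of a smaller subfunctor. -/
def homOfLE {U V : Subf W} (h : U ≤ V) : U.fn ⟶ V.fn := V.lift U.ι fun _ x => h _ x.2

@[simp]
lemma homOfLE_ι {U V : Subf W} (h : U ≤ V) : homOfLE h ≫ V.ι = U.ι := rfl

/-- The whole functor is isomorphic to the greatest subfunctor. -/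
def topIso (W : GrFunctor) : (⊤ : Subf W).fn ≅ W where
  hom := (⊤ : Subf W).ι
  inv := (⊤ : Subf W).lift (𝟙 W) fun _ _ => AddSubgroup.mem_top _

lemma isZero_bot (W : GrFunctor) : IsZero (⊥ : Subf W).fn := by
  rw [IsZero.iff_id_eq_zero]
  refine nat_hom_ext fun G x => ?_
  exact Subtype.ext x.2

lemma isZero_quo_top (W : GrFunctor) : IsZero (⊤ : Subf W).quo := by
  rw [IsZero.iff_id_eq_zero]
  refine nat_hom_ext fun G x => ?_
  obtain ⟨x, rfl⟩ := (⊤ : Subf W).π_surjective G x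
  exact (π_eq_zero_iff _ x).2 (AddSubgroup.mem_top _)

/-- The whole functor is isomorphic to its quotient by zero. -/
lemma isIso_π_bot (W : GrFunctor) : IsIso (⊥ : Subf W).π :=
  isIso_of_bijective _ fun G => ⟨by
    rw [injective_iff_map_eq_zero]
    intro x hx
    exact (π_eq_zero_iff _ x).1 hx, π_surjective _ G⟩

lemma isFlat_fn (U : Subf W) [IsFlat W] : IsFlat U.fn := .of_mono U.ι U.ι_injective

end Subf

/-! ### The functors given by the powers of the augmentation ideal -/

section Ipow

/-- The `s`-th power of the augmentation ideal. -/
def Ipow (s : ℕ) : GrFunctor where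
  obj G := AddCommGrpCat.of (augPow G s)
  map {G H} f := AddCommGrpCat.ofHom
    { toFun x := ⟨ZGmap f x.1, map_mem_augPow f x.2⟩
      map_zero' := Subtype.ext (map_zero _)
      map_add' x y := Subtype.ext (map_add _ _ _) }
  map_id G := by
    refine AddCommGrpCat.hom_ext (AddMonoidHom.ext fun x => ?_)
    refine Subtype.ext ?_
    refine DFunLike.congr_fun (zg_hom_ext (f := (ZGmap (𝟙 G)).toAddMonoidHom)
      (g := AddMonoidHom.id _) fun g => ?_) x.1
    exact ZGmap_el _ g
  map_comp {G H K} f g := by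
    refine AddCommGrpCat.hom_ext (AddMonoidHom.ext fun x => ?_)
    refine Subtype.ext ?_
    refine DFunLike.congr_fun (zg_hom_ext (f := (ZGmap (f ≫ g)).toAddMonoidHom)
      (g := (ZGmap g).toAddMonoidHom.comp (ZGmap f).toAddMonoidHom) fun x => ?_) x.1
    change ZGmap (f ≫ g) (el x) = ZGmap g (ZGmap f (el x))
    simp only [ZGmap_el]
    rfl

/-- The underlying element of the group ring. -/
def Ival {s : ℕ} {G : FreeGr} : (Ipow s).obj G →+ ZG G := (augPow G s).subtype.toAddMonoidHom

/-- An element of the group ring, viewed in a power of the augmentation ideal. -/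
def Imk {s : ℕ} {G : FreeGr} (x : ZG G) (hx : x ∈ augPow G s) : (Ipow s).obj G := ⟨x, hx⟩

variable {s : ℕ} {G H : FreeGr}

@[simp]
lemma Ival_Imk (x : ZG G) (hx : x ∈ augPow G s) : Ival (Imk x hx) = x := rfl

lemma Ival_injective : Function.Injective (Ival (s := s) (G := G)) := Subtype.val_injective

@[simp]
lemma Ival_map (f : G ⟶ H) (x : (Ipow s).obj G) : Ival ((Ipow s).map f x) = ZGmap f (Ival x) :=
  rfl

lemma aug_Ival (x : (Ipow (s + 1)).obj G) : aug G (Ival x) = 0 := aug_eq_zero_of_mem x.2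

/-- The inclusion of successive powers of the augmentation ideal. -/
def Iincl (s : ℕ) : Ipow (s + 1) ⟶ Ipow s :=
  natHom (fun G => (Submodule.inclusion (augPow_succ_le (G := G) s)).toAddMonoidHom)
    fun _ _ => rfl

@[simp]
lemma Ival_Iincl (x : (Ipow (s + 1)).obj G) : Ival ((Iincl s).app G x) = Ival x := rfl

lemma Iincl_injective (s : ℕ) (G : FreeGr) : Function.Injective ((Iincl s).app G) :=
  fun x y h => Ival_injective (congrArg (Ival (s := s)) h : _)

/-- The quotients of successive powers of the augmentation ideal. -/
def gr (s : ℕ) : GrFunctor := (Subf.range (Iincl s)).quo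

/-- The projection to the graded piece. -/
def grπ (s : ℕ) : Ipow s ⟶ gr s := (Subf.range (Iincl s)).π

lemma grπ_surjective (s : ℕ) (G : FreeGr) : Function.Surjective ((grπ s).app G) :=
  Subf.π_surjective _ G

lemma grπ_eq_zero_iff (x : (Ipow s).obj G) :
    (grπ s).app G x = 0 ↔ ∃ y, (Iincl s).app G y = x :=
  Subf.π_eq_zero_iff _ x

lemma grπ_eq_zero_iff' (x : (Ipow s).obj G) :
    (grπ s).app G x = 0 ↔ Ival x ∈ augPow G (s + 1) := by
  rw [grπ_eq_zero_iff]
  exact ⟨fun ⟨y, hy⟩ => hy ▸ y.2, fun h => ⟨⟨_, h⟩, rfl⟩⟩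

lemma Iincl_grπ (s : ℕ) : Iincl s ≫ grπ s = 0 :=
  nat_hom_ext fun _ x => (grπ_eq_zero_iff _).2 ⟨x, rfl⟩

instance (s : ℕ) : IsFlat (Ipow s) where
  flat G := by
    rw [flat_int_iff]
    intro n x hx
    refine (smul_eq_zero.1 (show n • Ival x = 0 by rw [← map_zsmul, hx, map_zero])).imp_right
      fun h => Ival_injective (h.trans (map_zero _).symm)

instance (s : ℕ) : IsFlat (gr s) where
  flat G := by
    rw [flat_int_iff]
    intro n x hx
    obtain ⟨x, rfl⟩ := grπ_surjective s G x
    by_cases hn : n = 0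
    · exact Or.inl hn
    · right
      rw [← map_zsmul, grπ_eq_zero_iff', map_zsmul] at hx
      rw [grπ_eq_zero_iff']
      exact mem_augPow_of_smul_mem hn x.2 hx

lemma shortExact_gr_tens (s : ℕ) (A : GrFunctor) [IsFlat A] :
    (ShortComplex.mk (tensMap (Iincl s) (𝟙 A)) (tensMap (grπ s) (𝟙 A))
      (by rw [tensMap_comp, Iincl_grπ, tensMap_zero_left])).ShortExact :=
  shortExact_of_elements _ _ _
    (fun G => tensMap_injective_left _ _ (Iincl_injective s G))
    (fun G => tensMap_surjective _ _ _ (grπ_surjective s G) fun x => ⟨x, rfl⟩)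
    (fun G z hz => (tensMap_exact_left A (Iincl s) (grπ s) G (grπ_surjective s G)
      (fun _ => grπ_eq_zero_iff _) z).1 hz)

/-- Multiplication of powers of the augmentation ideal by elements of the augmentation ideal, on
the left. -/
def Imul (s : ℕ) : tens (Ipow 1) (Ipow s) ⟶ Ipow (s + 1) :=
  tensLift (fun G => biHom
    (fun a b => Imk (Ival a * Ival b) (aug_mul_mem_augPow (aug_Ival a) b.2))
    (fun x y z => Ival_injective (by simp [add_mul]))
    (fun x y z => Ival_injective (by simp [mul_add])))
    (fun f x a => Ival_injective (by simp))

@[simp]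
lemma Ival_Imul_tm (a : (Ipow 1).obj G) (b : (Ipow s).obj G) :
    Ival ((Imul s).app G (tm a b)) = Ival a * Ival b := rfl

/-- By reassociation: a product `(c * d) * b`, with `c` split off on the left by induction, is `c *
(d * b)`. -/
lemma Imul_surjective (s : ℕ) (G : FreeGr) : Function.Surjective ((Imul s).app G) := by
  suffices h : ∀ x ∈ augPow G (s + 1), ∃ y, Ival ((Imul s).app G y) = x by
    intro x
    obtain ⟨y, hy⟩ := h x.1 x.2
    exact ⟨y, Ival_injective hy⟩
  induction s with
  | zero =>
    intro x hx
    exact ⟨tm (Imk x hx) (Imk 1 (mem_augPow_zero _)), by rw [Ival_Imul_tm]; exact mul_one x⟩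
  | succ s ih =>
    intro x hx
    refine augPow_succ_induction hx (fun a ha b hb => ?_) ?_
    · obtain ⟨y, rfl⟩ := ih a ha
      clear hx ha
      induction y using tens_induction with
      | zero => exact ⟨0, by simp⟩
      | tm c d =>
        exact ⟨tm c (Imk (Ival d * b) (mul_mem_augPow_succ d.2 hb)), by simp [mul_assoc]⟩
      | add x y hx hy =>
        obtain ⟨x', hx'⟩ := hx
        obtain ⟨y', hy'⟩ := hy
        exact ⟨x' + y', by simp only [map_add, hx', hy', add_mul]⟩
    · rintro _ _ ⟨x, rfl⟩ ⟨y, rfl⟩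
      exact ⟨x + y, by rw [map_add, map_add]⟩

end Ipow
end

noncomputable section

/-! ### Tensoring with a fixed flat functor -/

section TensFunctor

/-- Tensoring with a fixed functor. -/
def tensFunctor (X : GrFunctor) : GrFunctor ⥤ GrFunctor where
  obj A := tens X A
  map f := tensMap (𝟙 X) f
  map_id _ := tensMap_id _ _
  map_comp f g := by rw [tensMap_comp, Category.id_comp]

instance (X : GrFunctor) : (tensFunctor X).Additive where
  map_add := tens_hom_ext fun _ x _ => tm_add x _ _

lemma exact_tensFunctor (X : GrFunctor) [IsFlat X] :
    PreservesFiniteLimits (tensFunctor X) ∧ PreservesFiniteColimits (tensFunctor X) :=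
  ((tensFunctor X).exact_tfae.out 0 3).1 fun _ hS => shortExact_tens_left hS

instance (X : GrFunctor) [IsFlat X] : PreservesFiniteLimits (tensFunctor X) :=
  (exact_tensFunctor X).1

instance (X : GrFunctor) [IsFlat X] : PreservesFiniteColimits (tensFunctor X) :=
  (exact_tensFunctor X).2

/-- Iterated tensoring with a fixed functor. -/
def iterTens (X : GrFunctor) : ℕ → GrFunctor ⥤ GrFunctor
  | 0 => 𝟭 _
  | p + 1 => tensFunctor X ⋙ iterTens X p

instance (X : GrFunctor) (p : ℕ) : (iterTens X p).Additive := by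
  induction p with
  | zero => exact inferInstanceAs (𝟭 GrFunctor).Additive
  | succ p ih => exact inferInstanceAs (tensFunctor X ⋙ iterTens X p).Additive

instance (X : GrFunctor) [IsFlat X] (p : ℕ) : PreservesFiniteLimits (iterTens X p) := by
  induction p with
  | zero => exact inferInstanceAs (PreservesFiniteLimits (𝟭 GrFunctor))
  | succ p ih => exact comp_preservesFiniteLimits (tensFunctor X) (iterTens X p)

instance (X : GrFunctor) [IsFlat X] (p : ℕ) : PreservesFiniteColimits (iterTens X p) := by
  induction p with
  | zero => exact inferInstanceAs (PreservesFiniteColimits (𝟭 GrFunctor))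
  | succ p ih => exact comp_preservesFiniteColimits (tensFunctor X) (iterTens X p)

end TensFunctor

/-! ### Orthogonality to polynomial functors -/

section Orth

universe w

variable [HasExt.{w} GrFunctor] {A B : GrFunctor} {e : ℕ}

/-- After `p` tensor products with the augmentation ideal, there are no extensions by polynomial
functors of degree less than `e + p`. -/
def Orth (e : ℕ) (A : GrFunctor) : Prop :=
  ∀ p d : ℕ, d < e + p → ∀ B : GrFunctor, IsPolynomial FreeGr d B →
    ExtVanish.{w} ((iterTens (Ipow 1) p).obj A) B

lemma Orth.of_iso (i : A ≅ B) (h : Orth.{w} e A) : Orth.{w} e B :=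
  fun p d hd F hF => (h p d hd F hF).of_iso ((iterTens (Ipow 1) p).mapIso i)

lemma Orth.of_isZero (h : IsZero A) : Orth.{w} e A :=
  fun p _ _ F _ => .of_isZero ((iterTens (Ipow 1) p).map_isZero h) F

lemma Orth.mono {e' : ℕ} (h : Orth.{w} e A) (he : e' ≤ e) : Orth.{w} e' A :=
  fun p d hd F hF => h p d (by omega) F hF

lemma Orth.ext {S : ShortComplex GrFunctor} (hS : S.ShortExact) (h₁ : Orth.{w} e S.X₁)
    (h₃ : Orth.{w} e S.X₃) : Orth.{w} e S.X₂ := fun p d hd F hF =>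
  ExtVanish.ext (hS.map_of_exact (iterTens (Ipow 1) p)) (h₁ p d hd F hF) (h₃ p d hd F hF)

lemma Orth.quot {S : ShortComplex GrFunctor} (hS : S.ShortExact) (h₁ : Orth.{w} e S.X₁)
    (h₂ : Orth.{w} e S.X₂) : Orth.{w} e S.X₃ := fun p d hd F hF =>
  ExtVanish.quot (hS.map_of_exact (iterTens (Ipow 1) p)) (h₁ p d hd F hF) (h₂ p d hd F hF)

/-- Immediate from the quantifier over `p` in `Orth`, which is there for this purpose: a further
factor `I` is absorbed into `p`. -/
lemma Orth.tens_Ipow_one (h : Orth.{w} e A) : Orth.{w} (e + 1) (tens (Ipow 1) A) :=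
  fun p d hd F hF => h (p + 1) d (by omega) F hF

lemma Orth.of_resolution (E : ℕ → GrFunctor) (d : ∀ q, E (q + 1) ⟶ E q)
    (hE : ∀ q, Orth.{w} e (E q)) (w : ∀ q, d (q + 1) ≫ d q = 0)
    (hex : ∀ q, (ShortComplex.mk (d (q + 1)) (d q) (w q)).Exact)
    {X : GrFunctor} (g : E 0 ⟶ X) (_ : Epi g) (w' : d 0 ≫ g = 0)
    (hg : (ShortComplex.mk (d 0) g w').Exact) : Orth.{w} e X := by
  intro p n hn F hF
  let T := iterTens (Ipow 1) p
  exact ExtVanish.of_resolution (fun q => T.obj (E q)) (fun q => T.map (d q))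
    (fun q => by rw [← T.map_comp, w, T.map_zero]) (fun q => hE q p n hn F hF)
    (fun q => (hex q).map T) (T.map g) (by rw [← T.map_comp, w', T.map_zero]) (hg.map T)

end Orth

/-! ### The bar complex -/

section Bar

variable {G : FreeGr} {E : GrFunctor}

/-- Multiplication in the augmentation ideal. -/
def imul (a b : (Ipow 1).obj G) : (Ipow 1).obj G :=
  Imk (Ival a * Ival b) (mul_mem_augPow_left _ b.2)

@[simp]
lemma Ival_imul (a b : (Ipow 1).obj G) : Ival (imul a b) = Ival a * Ival b := rfl

lemma imul_add (a b c : (Ipow 1).obj G) : imul a (b + c) = imul a b + imul a c :=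
  Ival_injective (by simp [mul_add])

lemma add_imul (a b c : (Ipow 1).obj G) : imul (a + b) c = imul a c + imul b c :=
  Ival_injective (by simp [add_mul])

lemma imul_assoc (a b c : (Ipow 1).obj G) : imul (imul a b) c = imul a (imul b c) :=
  Ival_injective (by simp [mul_assoc])

lemma imul_map {H : FreeGr} (f : G ⟶ H) (a b : (Ipow 1).obj G) :
    imul ((Ipow 1).map f a) ((Ipow 1).map f b) = (Ipow 1).map f (imul a b) :=
  Ival_injective (by simp)

/-- Left multiplication by an element of the augmentation ideal. -/
def lmul (E : GrFunctor) (a : (Ipow 1).obj G) :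
    (tens (Ipow 1) E).obj G →+ (tens (Ipow 1) E).obj G :=
  tensLiftAt (biHom (fun b z => tm (imul a b) z)
    (fun x y z => by rw [imul_add, add_tm]) (fun x y z => by rw [tm_add]))

@[simp]
lemma lmul_tm (a b : (Ipow 1).obj G) (z : E.obj G) : lmul E a (tm b z) = tm (imul a b) z := rfl

lemma lmul_lmul (a b : (Ipow 1).obj G) (z : (tens (Ipow 1) E).obj G) :
    lmul E a (lmul E b z) = lmul E (imul a b) z :=
  DFunLike.congr_fun (tens_addHom_ext (f := (lmul E a).comp (lmul E b)) (g := lmul E (imul a b))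
    fun x a => by simp [imul_assoc]) z

/-- Multiplication of the first two tensor factors. -/
def mulHom (E : GrFunctor) : tens (Ipow 1) (tens (Ipow 1) E) ⟶ tens (Ipow 1) E :=
  tensLift (fun G => biHom (fun a z => lmul E a z)
    (fun x y z => DFunLike.congr_fun (tens_addHom_ext (f := lmul E (x + y))
      (g := lmul E x + lmul E y) fun a b => by simp [add_imul, add_tm]) z)
    (fun x y z => map_add _ _ _))
    (fun {G H} f a z => DFunLike.congr_fun (tens_addHom_ext
      (f := (lmul E ((Ipow 1).map f a)).comp ((tens (Ipow 1) E).map f).hom)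
      (g := ((tens (Ipow 1) E).map f).hom.comp (lmul E a)) fun x y => by
        change tm (imul ((Ipow 1).map f a) ((Ipow 1).map f x)) _ = tm ((Ipow 1).map f (imul a x)) _
        rw [imul_map]) z)

/-- The next differential of the bar complex. -/
def stepD (d : tens (Ipow 1) E ⟶ E) : tens (Ipow 1) (tens (Ipow 1) E) ⟶ tens (Ipow 1) E :=
  mulHom E - tensMap (𝟙 _) d

@[simp]
lemma stepD_tm (d : tens (Ipow 1) E ⟶ E) (a : (Ipow 1).obj G) (z : (tens (Ipow 1) E).obj G) :
    (stepD d).app G (tm a z) = lmul E a z - tm a (d.app G z) := rfl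

/-- The next contraction of the bar complex. -/
def stepH (h : E.obj G →+ (tens (Ipow 1) E).obj G) :
    (tens (Ipow 1) E).obj G →+ (tens (Ipow 1) (tens (Ipow 1) E)).obj G :=
  - tensLiftAt (biHom (fun a z => tm a (h z)) (fun x y z => by rw [add_tm])
    (fun x y z => by rw [map_add, tm_add]))

@[simp]
lemma stepH_tm (h : E.obj G →+ (tens (Ipow 1) E).obj G) (a : (Ipow 1).obj G) (z : E.obj G) :
    stepH h (tm a z) = - tm a (h z) := rfl

lemma stepH_lmul (h : E.obj G →+ (tens (Ipow 1) E).obj G) (a : (Ipow 1).obj G)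
    (y : (tens (Ipow 1) E).obj G) :
    stepH h (lmul E a y) = lmul _ a (stepH h y) :=
  DFunLike.congr_fun (tens_addHom_ext (f := (stepH h).comp (lmul E a))
    (g := (lmul _ a).comp (stepH h)) fun x z => by simp) y

/-- With the sign in `stepH`, the two terms `a · stepH h z` cancel, and what remains is the previous
homotopy identity tensored with `a`. -/
lemma stepD_stepH_step (d : tens (Ipow 1) E ⟶ E) (h : E.obj G →+ (tens (Ipow 1) E).obj G)
    (H : ∀ y, (stepD d).app G (stepH h y) + h (d.app G y) = y)
    (y : (tens (Ipow 1) (tens (Ipow 1) E)).obj G) :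
    (stepD (stepD d)).app G (stepH (stepH h) y) + stepH h ((stepD d).app G y) = y := by
  induction y using tens_induction with
  | zero => simp
  | tm a z =>
    rw [stepH_tm, map_neg, stepD_tm, stepD_tm, map_sub, stepH_lmul, stepH_tm]
    conv_rhs => rw [← H z, tm_add]
    abel
  | add x y hx hy =>
    nth_rw 3 [← hx, ← hy]
    simp only [map_add]
    abel

lemma stepD_comp_step (d : tens (Ipow 1) E ⟶ E) (H : stepD d ≫ d = 0) :
    stepD (stepD d) ≫ stepD d = 0 := by
  refine tens_hom_ext fun G a z => ?_
  rw [comp_app_apply, stepD_tm, map_sub]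
  induction z using tens_induction with
  | zero => simp
  | tm b y =>
    have hy : d.app G (lmul E b y - tm b (d.app G y)) = 0 :=
      DFunLike.congr_fun (congrArg (fun g => (g.app G).hom) H) (tm b y)
    rw [lmul_tm, stepD_tm, stepD_tm, stepD_tm, hy, map_sub, lmul_lmul, lmul_tm]
    simp
  | add x y hx hy =>
    rw [map_add, map_add, map_add, tm_add, map_add, zero_app_apply] at *
    rw [add_sub_add_comm, hx, hy, add_zero]

/-- The bar complex. -/
def bar (E : GrFunctor) (d : tens (Ipow 1) E ⟶ E) : ℕ → Σ E : GrFunctor, tens (Ipow 1) E ⟶ E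
  | 0 => ⟨E, d⟩
  | q + 1 => ⟨tens (Ipow 1) (bar E d q).1, stepD (bar E d q).2⟩

lemma stepD_bar (d : tens (Ipow 1) E ⟶ E) (H : stepD d ≫ d = 0) (q : ℕ) :
    stepD (bar E d q).2 ≫ (bar E d q).2 = 0 := by
  induction q with
  | zero => exact H
  | succ q ih => exact stepD_comp_step _ ih

lemma exists_bar_contraction (d : tens (Ipow 1) E ⟶ E)
    (h : E.obj G →+ (tens (Ipow 1) E).obj G)
    (H : ∀ y, (stepD d).app G (stepH h y) + h (d.app G y) = y) (q : ℕ) :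
    ∃ h : (bar E d q).1.obj G →+ (tens (Ipow 1) (bar E d q).1).obj G,
      ∀ y, (stepD (bar E d q).2).app G (stepH h y) + h ((bar E d q).2.app G y) = y := by
  induction q with
  | zero => exact ⟨h, H⟩
  | succ q ih =>
    obtain ⟨h, H⟩ := ih
    exact ⟨stepH h, stepD_stepH_step _ _ H⟩

universe w

/-- Here `X` is the image of `d`, and the bar complex is a left resolution of it by functors `I ⊗
bar q`. Each of these has one factor `I` more than `bar q`, hence the gain of one. The contractions
need not be natural in `G`, because exactness is tested at each object. -/
lemma Orth.of_bar [HasExt.{w} GrFunctor] {e : ℕ} {E X : GrFunctor} (hE : Orth.{w} e E)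
    (d : tens (Ipow 1) E ⟶ E) (hd : stepD d ≫ d = 0)
    (h : ∀ G : FreeGr, ∃ h : E.obj G →+ (tens (Ipow 1) E).obj G,
      ∀ y, (stepD d).app G (stepH h y) + h (d.app G y) = y)
    (g : tens (Ipow 1) E ⟶ X) [Epi g] (i : X ⟶ E) [Mono i] (hgi : g ≫ i = d) :
    Orth.{w} (e + 1) X := by
  have hE' (q : ℕ) : Orth.{w} e (bar E d q).1 := by
    induction q with
    | zero => exact hE
    | succ q ih => exact ih.tens_Ipow_one.mono (Nat.le_succ e)
  have hex (q : ℕ) : (ShortComplex.mk (stepD (bar E d q).2) (bar E d q).2 (stepD_bar d hd q)).Exact := by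
    refine exact_of_elements _ _ _ fun G y hy => ?_
    obtain ⟨h₀, h₀'⟩ := h G
    obtain ⟨h', H⟩ := exists_bar_contraction d h₀ h₀' q
    refine ⟨stepH h' y, ?_⟩
    have := H y
    rwa [hy, map_zero, add_zero] at this
  have w' : stepD d ≫ g = 0 := by rw [← cancel_mono i, Category.assoc, hgi, hd, zero_comp]
  refine Orth.of_resolution (fun q => tens (Ipow 1) (bar E d q).1)
    (fun q => stepD (bar E d q).2) (fun q => (hE' q).tens_Ipow_one)
    (fun q => stepD_bar d hd (q + 1)) (fun q => hex (q + 1)) g ‹Epi g› w' ?_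
  -- Replacing `d` by its corestriction `g` to the image does not change the kernel, so exactness at
  -- the last spot is exactness of the bar complex there.
  let φ : ShortComplex.mk (stepD d) g w' ⟶ ShortComplex.mk (stepD d) d hd :=
    { τ₁ := 𝟙 _
      τ₂ := 𝟙 _
      τ₃ := i }
  have : Epi φ.τ₁ := by dsimp [φ]; infer_instance
  have : IsIso φ.τ₂ := by dsimp [φ]; infer_instance
  have : Mono φ.τ₃ := by dsimp [φ]; infer_instance
  exact (ShortComplex.exact_iff_of_epi_of_isIso_of_mono φ).2 (hex 0)

end Bar
end

noncomputable section

/-! ### The augmentation filtration and the tensor product -/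

section Kernels

variable {W X Y A B : GrFunctor}

/-- Natural transformations which are surjective with the same kernel have isomorphic targets. -/
lemma nonempty_iso_of_ker_eq (p : W ⟶ X) (q : W ⟶ Y) (hp : ∀ G, Function.Surjective (p.app G))
    (hq : ∀ G, Function.Surjective (q.app G))
    (h : ∀ G z, p.app G z = 0 ↔ q.app G z = 0) : Nonempty (X ≅ Y) := by
  let K : Subf W :=
    { carrier G := (p.app G).hom.ker
      map_mem := by
        intro G H f x hx
        exact (app_map_apply p f x).trans (by rw [show p.app G x = 0 from hx, map_zero]) }
  have h₁ : IsIso (K.desc p fun _ _ hx => hx) := by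
    refine isIso_of_bijective _ fun G => ⟨?_, fun y => ?_⟩
    · rw [injective_iff_map_eq_zero]
      intro z hz
      obtain ⟨z, rfl⟩ := K.π_surjective G z
      exact (K.π_eq_zero_iff z).2 hz
    · obtain ⟨z, rfl⟩ := hp G y
      exact ⟨K.π.app G z, rfl⟩
  have h₂ : IsIso (K.desc q fun G x hx => (h G x).1 hx) := by
    refine isIso_of_bijective _ fun G => ⟨?_, fun y => ?_⟩
    · rw [injective_iff_map_eq_zero]
      intro z hz
      obtain ⟨z, rfl⟩ := K.π_surjective G z
      exact (K.π_eq_zero_iff z).2 ((h G z).2 hz)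
    · obtain ⟨z, rfl⟩ := hq G y
      exact ⟨K.π.app G z, rfl⟩
  exact ⟨(asIso (K.desc p fun _ _ hx => hx)).symm ≪≫
    asIso (K.desc q fun G x hx => (h G x).1 hx)⟩

/-- The kernel of a tensor product of surjections. -/
lemma tensMap_eq_zero_iff {X' A' : GrFunctor} (f : X ⟶ Y) (g : A ⟶ B) (i : X' ⟶ X) (j : A' ⟶ A)
    (G : FreeGr) (hf : Function.Surjective (f.app G)) (hg : Function.Surjective (g.app G))
    (hi : ∀ y, f.app G y = 0 ↔ ∃ x, i.app G x = y) (hj : ∀ y, g.app G y = 0 ↔ ∃ x, j.app G x = y)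
    (z : (tens X A).obj G) : (tensMap f g).app G z = 0 ↔
      ∃ (u : (tens X' A).obj G) (v : (tens X A').obj G),
        (tensMap i (𝟙 A)).app G u + (tensMap (𝟙 X) j).app G v = z := by
  constructor
  · intro hz
    -- Right exactness is used twice, once for each factor of this composition; the lift `v`
    -- corrects the first factor up to an element coming from `X' ⊗ A`.
    have h₁ : tensMap f g = tensMap f (𝟙 A) ≫ tensMap (𝟙 Y) g := by
      rw [tensMap_comp, Category.comp_id, Category.id_comp]
    rw [h₁, comp_app_apply, tensMap_exact_right Y j g G hg hj] at hz
    obtain ⟨y, hy⟩ := hz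
    obtain ⟨v, rfl⟩ := tensMap_surjective f (𝟙 A') G hf (fun x => ⟨x, rfl⟩) y
    have h₂ : tensMap f (𝟙 A') ≫ tensMap (𝟙 Y) j = tensMap (𝟙 X) j ≫ tensMap f (𝟙 A) := by
      rw [tensMap_comp, tensMap_comp, Category.comp_id, Category.id_comp, Category.comp_id,
        Category.id_comp]
    rw [← comp_app_apply, h₂, comp_app_apply, ← sub_eq_zero, ← map_sub,
      tensMap_exact_left A i f G hf hi] at hy
    obtain ⟨u, hu⟩ := hy
    refine ⟨-u, v, ?_⟩
    rw [map_neg, hu]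
    abel
  · rintro ⟨u, v, rfl⟩
    have hi' (x) : f.app G (i.app G x) = 0 := (hi _).2 ⟨x, rfl⟩
    have hj' (x) : g.app G (j.app G x) = 0 := (hj _).2 ⟨x, rfl⟩
    rw [map_add]
    have hu : (tensMap f g).app G ((tensMap i (𝟙 A)).app G u) = 0 := by
      induction u using tens_induction with
      | zero => simp
      | tm x a => rw [tensMap_tm, tensMap_tm, hi', zero_tm]
      | add x y hx hy => rw [map_add, map_add, hx, hy, add_zero]
    have hv : (tensMap f g).app G ((tensMap (𝟙 X) j).app G v) = 0 := by
      induction v using tens_induction with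
      | zero => simp
      | tm x a => rw [tensMap_tm, tensMap_tm, hj', tm_zero]
      | add x y hx hy => rw [map_add, map_add, hx, hy, add_zero]
    rw [hu, hv, add_zero]

end Kernels

section GrTens

variable (A : GrFunctor)

/-- The augmentation of `gr 0`. -/
def augGr (G : FreeGr) : (gr 0).obj G →+ ℤ :=
  QuotientAddGroup.lift _ ((aug G).toAddMonoidHom.comp Ival) (by
    rintro _ ⟨y, rfl⟩
    exact aug_Ival y)

/-- The unit of `gr 0`. -/
def grOne (G : FreeGr) : (gr 0).obj G := (grπ 0).app G (Imk 1 (mem_augPow_zero 1))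

lemma gr_zero_eq {G : FreeGr} (x : (gr 0).obj G) : x = augGr G x • grOne G := by
  obtain ⟨x, rfl⟩ := grπ_surjective 0 G x
  rw [← sub_eq_zero, grOne, ← map_zsmul, ← map_sub, grπ_eq_zero_iff', mem_augPow_one, map_sub,
    map_zsmul, Ival_Imk, map_sub, map_zsmul, map_one, smul_eq_mul, mul_one]
  exact sub_self _

/-- `gr 0` is the unit of the tensor product. -/
def grZeroTens : tens (gr 0) A ≅ A where
  hom := tensLift (fun G => biHom (fun x a => augGr G x • a)
    (fun x y z => by rw [map_add, add_smul]) (fun x y z => by rw [smul_add])) (by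
      intro G H f x a
      obtain ⟨x, rfl⟩ := grπ_surjective 0 G x
      rw [biHom_apply, biHom_apply, map_zsmul]
      congr 1
      exact aug_ZGmap f (Ival x))
  inv := natHom (fun G => tmHom G (grOne G)) (by
      intro G H f a
      rw [tmHom_apply, tmHom_apply, tens_map_tm]
      congr 1
      rw [grOne, grOne, ← app_map_apply]
      congr 1
      exact Ival_injective (by simp))
  hom_inv_id := by
    refine tens_hom_ext fun G x a => ?_
    change tm (grOne G) (augGr G x • a) = tm x a
    conv_rhs => rw [gr_zero_eq x]
    exact (map_zsmul (tmHom G (grOne G)) _ a).trans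
      (DFunLike.congr_fun (map_zsmul (tmHom (X := gr 0) (A := A) G) _ (grOne G)) a).symm
  inv_hom_id := by
    refine nat_hom_ext fun G a => ?_
    change augGr G (grOne G) • a = a
    have : augGr G (grOne G) = 1 := map_one (aug G)
    rw [this, one_smul]

/-- Multiplication of powers of the augmentation ideal by elements of the augmentation ideal, on
the right. -/
def Jmul (s : ℕ) : tens (Ipow s) (Ipow 1) ⟶ Ipow (s + 1) :=
  tensLift (fun G => biHom
    (fun a b => Imk (Ival a * Ival b) (mul_mem_augPow_succ a.2 (aug_Ival b)))
    (fun x y z => Ival_injective (by simp [add_mul]))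
    (fun x y z => Ival_injective (by simp [mul_add])))
    (fun f x a => Ival_injective (by simp))

@[simp]
lemma Ival_Jmul_tm {s : ℕ} {G : FreeGr} (a : (Ipow s).obj G) (b : (Ipow 1).obj G) :
    Ival ((Jmul s).app G (tm a b)) = Ival a * Ival b := rfl

lemma Jmul_surjective (s : ℕ) (G : FreeGr) : Function.Surjective ((Jmul s).app G) := by
  suffices h : ∀ x ∈ augPow G (s + 1), ∃ y, Ival ((Jmul s).app G y) = x by
    intro x
    obtain ⟨y, hy⟩ := h x.1 x.2
    exact ⟨y, Ival_injective hy⟩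
  intro x hx
  refine augPow_succ_induction hx (fun a ha b hb => ?_) ?_
  · exact ⟨tm (Imk a ha) (Imk b (mem_augPow_one.2 hb)), rfl⟩
  · rintro _ _ ⟨x, rfl⟩ ⟨y, rfl⟩
    exact ⟨x + y, by rw [map_add, map_add]⟩

/-- The elements `xⱼ - 1` of the augmentation ideal. -/
def genI {G : FreeGr} (j : Fin G.rank) : (Ipow 1).obj G :=
  Imk (genSub j) (mem_augPow_one.2 (aug_genSub j))

/-- Modulo `I²` the Fox formula is linear: `b` is congruent to the combination of the `genSub j`
with the augmentations of its derivatives as coefficients. -/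
lemma exists_tens_genI {s : ℕ} {G : FreeGr} (z : (tens (Ipow s) (Ipow 1)).obj G) :
    ∃ (v : Fin G.rank → (Ipow s).obj G) (w : (tens (Ipow s) (Ipow 2)).obj G),
      z = ∑ j, tm (v j) (genI j) + (tensMap (𝟙 _) (Iincl 1)).app G w := by
  induction z using tens_induction with
  | zero => exact ⟨0, 0, by simp⟩
  | tm x b =>
    let c (j : Fin G.rank) : ℤ := aug G (foxD j (Ival b))
    have hb : Ival b - ∑ j, c j • genSub j ∈ augPow G 2 := by
      nth_rw 1 [← fox_formula_of_aug (aug_Ival b)]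
      rw [← Finset.sum_sub_distrib]
      refine Submodule.sum_mem _ fun j _ => ?_
      have : foxD j (Ival b) * genSub j - c j • genSub j =
          (foxD j (Ival b) - c j • 1) * genSub j := by
        rw [sub_mul, smul_mul_assoc, one_mul]
      rw [this]
      refine mul_mem_augPow_succ (mem_augPow_one.2 ?_) (aug_genSub j)
      rw [map_sub, map_zsmul, map_one, smul_eq_mul, mul_one, sub_self]
    refine ⟨fun j => c j • x, tm x (Imk _ hb), ?_⟩
    have h₁ (j : Fin G.rank) : tm (c j • x) (genI j) = tm x (c j • genI j) :=
      (DFunLike.congr_fun (map_zsmul (tmHom (X := Ipow s) (A := Ipow 1) G) _ x) (genI j)).trans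
        (map_zsmul (tmHom G x) _ (genI j)).symm
    simp only [h₁]
    have h₂ : ∑ j, tm x (c j • genI j) = tm x (∑ j, c j • genI j) :=
      (map_sum (tmHom (X := Ipow s) (A := Ipow 1) G x) _ _).symm
    rw [tensMap_tm, h₂]
    change tm x b = tm x _ + tm x _
    rw [← tm_add]
    congr 1
    refine Ival_injective ?_
    rw [map_add, Ival_Iincl, Ival_Imk, map_sum]
    simp only [map_zsmul]
    change Ival b = ∑ j, c j • genSub j + _
    abel
  | add x y hx hy =>
    obtain ⟨v, w, rfl⟩ := hx
    obtain ⟨v', w', rfl⟩ := hy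
    refine ⟨v + v', w + w', ?_⟩
    simp only [Pi.add_apply, add_tm, Finset.sum_add_distrib, map_add]
    abel

/-- The point is that `I` is a free left module on the `genSub j`. An element reduces to `∑ v j ⊗
genSub j` modulo `I^s ⊗ I²`, and the Fox derivatives of its product recover the `v j`; if the
product lies in `I^{s+2}`, each `v j` lies in `I^{s+1}`. Hence multiplication induces `gr s ⊗ gr 1 ≅
gr (s + 1)`. -/
lemma tensMap_grπ_eq_zero_iff (s : ℕ) (G : FreeGr) (z : (tens (Ipow s) (Ipow 1)).obj G) :
    (tensMap (grπ s) (grπ 1)).app G z = 0 ↔ (Jmul s ≫ grπ (s + 1)).app G z = 0 := by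
  have key (w : (tens (Ipow s) (Ipow 2)).obj G) :
      (Jmul s ≫ grπ (s + 1)).app G ((tensMap (𝟙 _) (Iincl 1)).app G w) = 0 := by
    induction w using tens_induction with
    | zero => simp
    | tm x b =>
      rw [tensMap_tm, comp_app_apply, grπ_eq_zero_iff', Ival_Jmul_tm]
      change Ival x * Ival b ∈ _
      have hb : Ival b ∈ augPow G 2 := b.2
      refine augPow_succ_induction hb (fun c hc d hd => ?_) fun y z hy hz => ?_
      · rw [← mul_assoc]
        exact mul_mem_augPow_succ (mul_mem_augPow_succ x.2 (mem_augPow_one.1 hc)) hd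
      · rw [mul_add]
        exact add_mem hy hz
    | add x y hx hy => rw [map_add, map_add, hx, hy, add_zero]
  rw [tensMap_eq_zero_iff (grπ s) (grπ 1) (Iincl s) (Iincl 1) G (grπ_surjective s G)
    (grπ_surjective 1 G) (fun _ => grπ_eq_zero_iff _) (fun _ => grπ_eq_zero_iff _)]
  constructor
  · rintro ⟨u, v, rfl⟩
    rw [map_add, key, add_zero]
    induction u using tens_induction with
    | zero => simp
    | tm x b =>
      rw [tensMap_tm, comp_app_apply, grπ_eq_zero_iff', Ival_Jmul_tm]
      exact mul_mem_augPow_succ x.2 (aug_Ival b)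
    | add x y hx hy => rw [map_add, map_add, hx, hy, add_zero]
  · intro hz
    obtain ⟨v, w, rfl⟩ := exists_tens_genI z
    rw [map_add, key, add_zero, comp_app_apply, grπ_eq_zero_iff', map_sum, map_sum] at hz
    have hv (j : Fin G.rank) : Ival (v j) ∈ augPow G (s + 1) := by
      have := foxD_mem j hz
      rw [map_sum] at this
      convert this
      have h₁ (i : Fin G.rank) : foxD j (Ival ((Jmul s).app G (tm (v i) (genI i)))) =
          if i = j then Ival (v j) else 0 := by
        rw [Ival_Jmul_tm]
        change foxD j (Ival (v i) * genSub i) = _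
        rw [foxD_mul, foxD_genSub, aug_genSub, zero_smul, add_zero]
        split_ifs with h
        · rw [h, mul_one]
        · rw [mul_zero]
      rw [Finset.sum_congr rfl fun i _ => h₁ i, Finset.sum_ite_eq' Finset.univ j fun _ => Ival (v j)]
      simp
    refine ⟨∑ j, tm (Imk (Ival (v j)) (hv j)) (genI j), w, ?_⟩
    congr 1
    rw [map_sum]
    rfl

lemma nonempty_gr_succ_iso (s : ℕ) : Nonempty (tens (gr s) (gr 1) ≅ gr (s + 1)) :=
  nonempty_iso_of_ker_eq (tensMap (grπ s) (grπ 1)) (Jmul s ≫ grπ (s + 1))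
    (fun G => tensMap_surjective _ _ G (grπ_surjective s G) (grπ_surjective 1 G))
    (fun G y => by
      obtain ⟨y, rfl⟩ := grπ_surjective _ _ y
      obtain ⟨y, rfl⟩ := Jmul_surjective _ _ y
      exact ⟨y, rfl⟩)
    (tensMap_grπ_eq_zero_iff s)

lemma nonempty_gr_succ_tens_iso (s : ℕ) :
    Nonempty (tens (gr s) (tens (gr 1) A) ≅ tens (gr (s + 1)) A) := by
  obtain ⟨e⟩ := nonempty_gr_succ_iso s
  exact ⟨(tensAssoc _ _ _).symm ≪≫ tensIso e (Iso.refl A)⟩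

end GrTens
end

noncomputable section

/-! ### Tensoring with powers of the augmentation ideal -/

section Contraction

variable {G : FreeGr} {E E' A : GrFunctor} {s : ℕ}

/-- Additive maps on the second tensor factor. -/
def tmMap (θ : E.obj G →+ E'.obj G) :
    (tens (Ipow 1) E).obj G →+ (tens (Ipow 1) E').obj G :=
  tensLiftAt (biHom (fun b z => tm b (θ z)) (fun x y z => add_tm _ _ _)
    (fun x y z => by rw [map_add, tm_add]))

@[simp]
lemma tmMap_tm (θ : E.obj G →+ E'.obj G) (b : (Ipow 1).obj G) (z : E.obj G) :
    tmMap θ (tm b z) = tm b (θ z) := rfl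

lemma tmMap_lmul (θ : E.obj G →+ E'.obj G) (a : (Ipow 1).obj G) (y : (tens (Ipow 1) E).obj G) :
    tmMap θ (lmul E a y) = lmul E' a (tmMap θ y) :=
  DFunLike.congr_fun (tens_addHom_ext (f := (tmMap θ).comp (lmul E a))
    (g := (lmul E' a).comp (tmMap θ)) fun x z => by simp) y

lemma app_tmMap (θ : E.obj G →+ E'.obj G) (d : tens (Ipow 1) E ⟶ E) (d' : tens (Ipow 1) E' ⟶ E')
    (h : ∀ b z, d'.app G (tm b (θ z)) = θ (d.app G (tm b z))) (y : (tens (Ipow 1) E).obj G) :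
    d'.app G (tmMap θ y) = θ (d.app G y) :=
  DFunLike.congr_fun (tens_addHom_ext (f := (d'.app G).hom.comp (tmMap θ))
    (g := θ.comp (d.app G).hom) fun x z => h x z) y

/-- A contraction of the bar complex. -/
def IsContraction (d : tens (Ipow 1) E ⟶ E) (h : E.obj G →+ (tens (Ipow 1) E).obj G) : Prop :=
  ∀ a z, h (d.app G (tm a z)) = lmul E a (h z) + tm a (z - d.app G (h z))

/-- `IsContraction` is the homotopy identity of the bar complex in lowest degree, evaluated at a
pure tensor and solved for `h (d (a ⊗ z))`. -/
lemma IsContraction.stepD_stepH {d : tens (Ipow 1) E ⟶ E}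
    {h : E.obj G →+ (tens (Ipow 1) E).obj G} (H : IsContraction d h)
    (y : (tens (Ipow 1) E).obj G) :
    (stepD d).app G (stepH h y) + h (d.app G y) = y := by
  induction y using tens_induction with
  | zero => simp
  | tm a z =>
    rw [stepH_tm, map_neg, stepD_tm, H, tm_sub]
    abel
  | add x y hx hy =>
    nth_rw 3 [← hx, ← hy]
    simp only [map_add]
    abel

/-- The action of the augmentation ideal on its powers. -/
def Iact (s : ℕ) : tens (Ipow 1) (Ipow s) ⟶ Ipow s := Imul s ≫ Iincl s

@[simp]
lemma Ival_Iact_tm (a : (Ipow 1).obj G) (b : (Ipow s).obj G) :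
    Ival ((Iact s).app G (tm a b)) = Ival a * Ival b := rfl

/-- The projection of the group ring onto the augmentation ideal. -/
def augSub (G : FreeGr) : (Ipow 0).obj G →+ (Ipow 1).obj G :=
  AddMonoidHom.mk' (fun w => Imk (Ival w - aug G (Ival w) • 1)
    (mem_augPow_one.2 (by rw [map_sub, map_zsmul, map_one, smul_eq_mul, mul_one, sub_self])))
    fun x y => by
      refine Ival_injective ?_
      simp only [Ival_Imk, map_add, add_smul]
      abel

@[simp]
lemma Ival_augSub (w : (Ipow 0).obj G) : Ival (augSub G w) = Ival w - aug G (Ival w) • 1 := rfl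

/-- The contraction for the group ring. -/
def contrZero (G : FreeGr) : (Ipow 0).obj G →+ (tens (Ipow 1) (Ipow 0)).obj G :=
  AddMonoidHom.mk' (fun w => tm (augSub G w) (Imk 1 (mem_augPow_zero 1))) fun x y => by
    rw [map_add, add_tm]

lemma isContraction_contrZero (G : FreeGr) : IsContraction (Iact 0) (contrZero G) := by
  intro a w
  change tm _ _ = lmul _ a (tm _ _) + tm a (w - (Iact 0).app G (tm _ _))
  have h₁ : w - (Iact 0).app G (tm (augSub G w) (Imk 1 (mem_augPow_zero 1))) =
      aug G (Ival w) • Imk 1 (mem_augPow_zero 1) := by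
    refine Ival_injective ?_
    rw [map_sub, Ival_Iact_tm, map_zsmul, Ival_augSub, Ival_Imk, mul_one]
    abel
  have h₂ (n : ℤ) (x : (Ipow 0).obj G) : tm a (n • x) = tm (n • a) x :=
    (map_zsmul (tmHom G a) n x).trans
      (DFunLike.congr_fun (map_zsmul (tmHom (X := Ipow 1) (A := Ipow 0) G) n a) x).symm
  rw [h₁, h₂, lmul_tm, ← add_tm]
  congr 1
  refine Ival_injective ?_
  rw [map_add, Ival_imul, Ival_augSub, Ival_augSub, Ival_Iact_tm, map_mul, aug_Ival, map_zsmul,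
    mul_sub, mul_smul_comm, mul_one, zero_mul, zero_smul]
  abel

/-- Fox derivatives on the powers of the augmentation ideal. -/
def foxI (s : ℕ) (j : Fin G.rank) : (Ipow (s + 1)).obj G →+ (Ipow s).obj G :=
  AddMonoidHom.mk' (fun x => Imk (foxD j (Ival x)) (foxD_mem j x.2))
    fun x y => Ival_injective (by simp)

/-- Right multiplication by `xⱼ - 1`. -/
def genMul (s : ℕ) (j : Fin G.rank) : (Ipow s).obj G →+ (Ipow (s + 1)).obj G :=
  AddMonoidHom.mk' (fun x => Imk (Ival x * genSub j) (mul_mem_augPow_succ x.2 (aug_genSub j)))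
    fun x y => Ival_injective (by simp [add_mul])

/-- Together with the compatibility of `foxI` and `genMul` with the left action, proved next, this
decomposes `I^{s+1}` as a left module into the pieces `I^s · genSub j`. -/
lemma sum_genMul_foxI (x : (Ipow (s + 1)).obj G) : ∑ j, genMul s j (foxI s j x) = x := by
  refine Ival_injective ?_
  rw [map_sum]
  exact fox_formula_of_aug (aug_Ival x)

lemma foxI_Iact (j : Fin G.rank) (a : (Ipow 1).obj G) (z : (Ipow (s + 1)).obj G) :
    foxI s j ((Iact (s + 1)).app G (tm a z)) = (Iact s).app G (tm a (foxI s j z)) := by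
  refine Ival_injective ?_
  change foxD j (Ival a * Ival z) = Ival a * foxD j (Ival z)
  rw [foxD_mul, aug_Ival, zero_smul, add_zero]

lemma Iact_genMul (j : Fin G.rank) (a : (Ipow 1).obj G) (z : (Ipow s).obj G) :
    (Iact (s + 1)).app G (tm a (genMul s j z)) = genMul s j ((Iact s).app G (tm a z)) :=
  Ival_injective (mul_assoc _ _ _).symm

/-- For the group ring take `w ↦ (w - aug w) ⊗ 1`. For `I^{s+1}` transport the contraction of `I^s`
to each piece `I^s · genSub j` and add up. The choice depends on a basis of the free group, so it is
not natural. -/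
lemma exists_isContraction_Iact (s : ℕ) (G : FreeGr) :
    ∃ h : (Ipow s).obj G →+ (tens (Ipow 1) (Ipow s)).obj G, IsContraction (Iact s) h := by
  induction s with
  | zero => exact ⟨_, isContraction_contrZero G⟩
  | succ s ih =>
    obtain ⟨h, H⟩ := ih
    refine ⟨∑ j, ((tmMap (genMul s j)).comp h).comp (foxI s j), fun a z => ?_⟩
    have hz (x : (Ipow (s + 1)).obj G) :
        (∑ j, ((tmMap (genMul s j)).comp h).comp (foxI s j)) x =
          ∑ j, tmMap (genMul s j) (h (foxI s j x)) := by
      rw [AddMonoidHom.finsetSum_apply]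
      rfl
    rw [hz, hz]
    have h₂ : z - (Iact (s + 1)).app G (∑ j, tmMap (genMul s j) (h (foxI s j z))) =
        ∑ j, (genMul s j (foxI s j z) -
          (Iact (s + 1)).app G (tmMap (genMul s j) (h (foxI s j z)))) := by
      rw [Finset.sum_sub_distrib, sum_genMul_foxI, map_sum]
    rw [h₂, map_sum]
    have h₁ : tm a (∑ j, (genMul s j (foxI s j z) -
        (Iact (s + 1)).app G (tmMap (genMul s j) (h (foxI s j z))))) =
        ∑ j, tm a (genMul s j (foxI s j z) -
        (Iact (s + 1)).app G (tmMap (genMul s j) (h (foxI s j z)))) :=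
      map_sum (tmHom G a) _ _
    rw [h₁, ← Finset.sum_add_distrib]
    refine Finset.sum_congr rfl fun j _ => ?_
    rw [foxI_Iact, H, map_add, tmMap_lmul, tmMap_tm, map_sub,
      app_tmMap _ (Iact s) _ (Iact_genMul j)]

/-- The action of the augmentation ideal on `I^s ⊗ A`. -/
def tensAct (d : tens (Ipow 1) E ⟶ E) (A : GrFunctor) : tens (Ipow 1) (tens E A) ⟶ tens E A :=
  tensAssocInv _ _ _ ≫ tensMap d (𝟙 A)

lemma exists_isContraction_tensAct {d : tens (Ipow 1) E ⟶ E}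
    {h : E.obj G →+ (tens (Ipow 1) E).obj G} (H : IsContraction d h) (A : GrFunctor) :
    ∃ h : (tens E A).obj G →+ (tens (Ipow 1) (tens E A)).obj G,
      IsContraction (tensAct d A) h := by
  let θ (x : A.obj G) : E.obj G →+ (tens E A).obj G :=
    AddMonoidHom.mk' (fun z => tm z x) fun y z => add_tm y z x
  let k : (tens E A).obj G →+ (tens (Ipow 1) (tens E A)).obj G :=
    tensLiftAt (biHom (fun z x => tmMap (θ x) (h z)) (fun x y z => by simp only [map_add])
      (fun x y z => DFunLike.congr_fun (tens_addHom_ext (f := tmMap (θ (y + z)))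
        (g := tmMap (θ y) + tmMap (θ z)) fun a b => by
          change tm a (tm b (y + z)) = tm a (tm b y) + tm a (tm b z)
          rw [tm_add, tm_add]) (h x)))
  refine ⟨k, fun a z => ?_⟩
  induction z using tens_induction with
  | zero => simp
  | tm z x =>
    change tmMap (θ x) (h (d.app G (tm a z))) = lmul _ a (tmMap (θ x) (h z)) +
      tm a (θ x z - (tensAct d A).app G (tmMap (θ x) (h z)))
    rw [H, map_add, tmMap_lmul, tmMap_tm, map_sub, app_tmMap _ d _ fun _ _ => rfl]
  | add x y hx hy =>
    rw [tm_add, map_add, map_add, hx, hy]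
    simp only [map_add, tm_sub, tm_add]
    abel

lemma stepD_Iact (s : ℕ) : stepD (Iact s) ≫ Iact s = 0 := by
  refine tens_hom_ext fun G a z => ?_
  rw [comp_app_apply, stepD_tm, map_sub, zero_app_apply, sub_eq_zero]
  induction z using tens_induction with
  | zero => simp
  | tm b z => exact Ival_injective (mul_assoc _ _ _)
  | add x y hx hy => rw [map_add, map_add, map_add, hx, hy, tm_add, map_add]

lemma stepD_tensAct {d : tens (Ipow 1) E ⟶ E} (hd : stepD d ≫ d = 0) (A : GrFunctor) :
    stepD (tensAct d A) ≫ tensAct d A = 0 := by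
  refine tens_hom_ext fun G a z => ?_
  rw [comp_app_apply, stepD_tm, map_sub, zero_app_apply, sub_eq_zero]
  induction z using tens_induction with
  | zero => simp
  | tm b z =>
    induction z using tens_induction with
    | zero => simp
    | tm z x =>
      have h : d.app G (tm (imul a b) z - tm a (d.app G (tm b z))) = 0 :=
        DFunLike.congr_fun (congrArg (fun g => (g.app G).hom) hd) (tm a (tm b z))
      rw [map_sub, sub_eq_zero] at h
      exact congrArg (tm · x) h
    | add x y hx hy => rw [tm_add, map_add, map_add, map_add, hx, hy, tm_add, map_add]
  | add x y hx hy => rw [map_add, map_add, map_add, hx, hy, tm_add, map_add]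

universe w

variable [HasExt.{w} GrFunctor]

/-- The image of the action of `I` on `I^s ⊗ A` is `I^{s+1} ⊗ A`, so the bar resolution applies;
flatness of `A` makes `I^{s+1} ⊗ A` a subfunctor of `I^s ⊗ A`. -/
lemma Orth.tens_Ipow_succ {e : ℕ} [IsFlat A] (h : Orth.{w} e (tens (Ipow s) A)) :
    Orth.{w} (e + 1) (tens (Ipow (s + 1)) A) := by
  let g : tens (Ipow 1) (tens (Ipow s) A) ⟶ tens (Ipow (s + 1)) A :=
    tensAssocInv _ _ _ ≫ tensMap (Imul s) (𝟙 A)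
  have : Epi g := by
    have : Epi (tensMap (Imul s) (𝟙 A)) := epi_of_surjective _ fun G =>
      tensMap_surjective _ _ G (Imul_surjective s G) fun x => ⟨x, rfl⟩
    have : IsIso (tensAssocInv (Ipow 1) (Ipow s) A) :=
      inferInstanceAs (IsIso (tensAssoc (Ipow 1) (Ipow s) A).inv)
    exact epi_comp _ _
  have : Mono (tensMap (Iincl s) (𝟙 A)) := mono_of_injective _ fun G =>
    tensMap_injective_left _ G (Iincl_injective s G)
  refine Orth.of_bar h (tensAct (Iact s) A) (stepD_tensAct (stepD_Iact s) A) (fun G => ?_) g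
    (tensMap (Iincl s) (𝟙 A)) ?_
  · obtain ⟨h, H⟩ := exists_isContraction_Iact s G
    obtain ⟨k, K⟩ := exists_isContraction_tensAct H A
    exact ⟨k, K.stepD_stepH⟩
  · rw [Category.assoc, tensMap_comp, Category.comp_id]
    rfl

/-- The induction starts at the group ring, which is not the tensor unit: `I^0 ⊗ A` is an extension
of `gr 0 ⊗ A ≅ A` by `I ⊗ A`. -/
lemma Orth.tens_Ipow {e : ℕ} [IsFlat A] (h : Orth.{w} e A) (s : ℕ) :
    Orth.{w} (e + s) (tens (Ipow s) A) := by
  induction s with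
  | zero =>
    exact Orth.ext (shortExact_gr_tens 0 A) (h.tens_Ipow_one.mono (Nat.le_succ e))
      (h.of_iso (grZeroTens A).symm)
  | succ s ih => exact ih.tens_Ipow_succ

end Contraction
end

noncomputable section

/-! ### Polynomial functors -/

section Polynomial

variable {F F' : GrFunctor} {n d : ℕ} (X : Fin n → FreeGr)

/-- The endomorphism of a free product which is trivial on the summands in a set. -/
def killSet (P : Fin n → Prop) [DecidablePred P] : (∐ X) ⟶ ∐ X :=
  Sigma.desc fun i => if P i then 0 else Sigma.ι X i

lemma ι_killSet (P : Fin n → Prop) [DecidablePred P] (i : Fin n) :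
    Sigma.ι X i ≫ killSet X P = if P i then 0 else Sigma.ι X i := by
  simp [killSet]

lemma killSummand_killSet (P : Fin n → Prop) [DecidablePred P] {i : Fin n} (hi : P i) :
    killSummand X i ≫ killSet X P = killSet X P := by
  refine Sigma.hom_ext _ _ fun j => ?_
  rw [ι_killSummand_assoc]
  split_ifs with h
  · rw [h, ι_killSet, if_pos hi, zero_comp]
  · rfl

/-- An element of a polynomial functor vanishes if it is killed by grouping the summands. -/
lemma IsPolynomial.eq_zero_of_killSet (hF : IsPolynomial FreeGr d F) (π : Fin n → Fin (d + 1))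
    (x : F.obj (∐ X)) (hx : ∀ j, F.map (killSet X fun i => π i = j) x = 0) : x = 0 := by
  -- Use `d + 1` copies of the whole free product: `φ` puts the summand `i` into the copy `π i` and
  -- the folding map `ψ` undoes it. Killing the copy `j` then amounts to killing the block of the
  -- `i` with `π i = j`.
  let Y : Fin (d + 1) → FreeGr := fun _ => ∐ X
  let φ : (∐ X) ⟶ ∐ Y := Sigma.desc fun i => Sigma.ι X i ≫ Sigma.ι Y (π i)
  let ψ : (∐ Y) ⟶ ∐ X := Sigma.desc fun _ => 𝟙 _
  have hφψ : φ ≫ ψ = 𝟙 _ := by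
    refine Sigma.hom_ext _ _ fun i => ?_
    simp only [φ, ψ, Sigma.ι_desc_assoc, Category.assoc, Sigma.ι_desc]
    rfl
  have hφ (j : Fin (d + 1)) : φ ≫ killSummand Y j = killSet X (fun i => π i = j) ≫ φ := by
    refine Sigma.hom_ext _ _ fun i => ?_
    rw [← Category.assoc, ← Category.assoc, ι_killSet]
    simp only [φ, Sigma.ι_desc, Category.assoc, ι_killSummand]
    split_ifs with h
    · rw [zero_comp, comp_zero]
    · rw [Sigma.ι_desc]
  have h₁ : F.map φ x ∈ crossEffect F Y := by
    rw [mem_crossEffect']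
    intro j
    rw [← map_comp_apply', hφ, map_comp_apply', hx, map_zero]
  rw [hF Y, AddSubgroup.mem_bot] at h₁
  rw [← map_id_apply' F x, ← hφψ, map_comp_apply', h₁, map_zero]

/-- The composition of the projections `1 - F(κᵢ)`. -/
def crProj (F : GrFunctor) : List (Fin n) → (F.obj (∐ X) →+ F.obj (∐ X))
  | [] => AddMonoidHom.id _
  | i :: L => crProj F L - (F.map (killSummand X i)).hom.comp (crProj F L)

lemma crProj_cons (i : Fin n) (L : List (Fin n)) (x : F.obj (∐ X)) :
    crProj X F (i :: L) x = crProj X F L x - F.map (killSummand X i) (crProj X F L x) := rfl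

lemma map_killSummand_crProj {L : List (Fin n)} {i : Fin n} (hi : i ∈ L) (x : F.obj (∐ X)) :
    F.map (killSummand X i) (crProj X F L x) = 0 := by
  induction L with
  | nil => simp at hi
  | cons j L ih =>
    rw [crProj_cons, map_sub]
    rcases List.mem_cons.1 hi with rfl | hi
    · rw [← map_comp_apply', killSummand_idem, sub_self]
    · rw [← map_comp_apply', killSummand_comm, map_comp_apply', ih hi, map_zero, sub_zero]

lemma crProj_eq_self {L : List (Fin n)} {x : F.obj (∐ X)}
    (h : ∀ i ∈ L, F.map (killSummand X i) x = 0) : crProj X F L x = x := by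
  induction L with
  | nil => rfl
  | cons j L ih =>
    rw [crProj_cons, ih fun i hi => h i (List.mem_cons_of_mem _ hi), h j List.mem_cons_self,
      sub_zero]

lemma crProj_eq_zero_of_mem {L : List (Fin n)} {x : F.obj (∐ X)} {i : Fin n} (hi : i ∈ L)
    (h : F.map (killSummand X i) x = x) : crProj X F L x = 0 := by
  have key : F.map (killSummand X i) (crProj X F L x) = crProj X F L x := by
    clear hi
    induction L with
    | nil => exact h
    | cons j L ih =>
      rw [crProj_cons, map_sub, ← map_comp_apply', ← killSummand_comm, map_comp_apply', ih]
  rw [← key, map_killSummand_crProj X hi]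

lemma app_crProj (f : F ⟶ F') (L : List (Fin n)) (x : F.obj (∐ X)) :
    f.app _ (crProj X F L x) = crProj X F' L (f.app _ x) := by
  induction L with
  | nil => rfl
  | cons j L ih => rw [crProj_cons, crProj_cons, map_sub, app_map_apply, ih]

lemma crProj_mem_crossEffect (x : F.obj (∐ X)) :
    crProj X F (List.finRange n) x ∈ crossEffect F X :=
  mem_crossEffect'.2 fun i => map_killSummand_crProj X (List.mem_finRange i) x

lemma crProj_of_mem_crossEffect {x : F.obj (∐ X)} (hx : x ∈ crossEffect F X)
    (L : List (Fin n)) : crProj X F L x = x :=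
  crProj_eq_self X fun i _ => mem_crossEffect'.1 hx i

/-- Partition the summands into `d + 1` blocks, each containing an entry of `L`. Killing a block
kills that entry, which annihilates the projection. -/
lemma IsPolynomial.crProj_eq_zero (hF : IsPolynomial FreeGr d F) {L : List (Fin n)}
    (hL : L.Nodup) (hd : d < L.length) (x : F.obj (∐ X)) : crProj X F L x = 0 := by
  refine hF.eq_zero_of_killSet X
    -- The first `d` entries of `L` get blocks of their own; all other summands, including those
    -- outside `L`, whose `idxOf` is the length of `L`, go into the block `d`.
    (fun i => ⟨min (L.idxOf i) d, Nat.lt_succ_of_le (min_le_right _ _)⟩) _ fun j => ?_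
  have hj : (j : ℕ) < L.length := by omega
  rw [← killSummand_killSet X _ (i := L[(j : ℕ)]), map_comp_apply',
    map_killSummand_crProj X (List.getElem_mem hj), map_zero]
  refine Fin.ext ?_
  change min (L.idxOf L[(j : ℕ)]) d = j
  rw [hL.idxOf_getElem]
  omega

lemma IsPolynomial.crossEffect_eq_zero (hF : IsPolynomial FreeGr d F) (hd : d < n)
    {x : F.obj (∐ X)} (hx : x ∈ crossEffect F X) : x = 0 := by
  rw [← crProj_of_mem_crossEffect X hx (List.finRange n)]
  exact hF.crProj_eq_zero X (List.nodup_finRange n) (by rwa [List.length_finRange]) x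

lemma IsPolynomial.mono (hF : IsPolynomial FreeGr d F) {d' : ℕ} (h : d ≤ d') :
    IsPolynomial FreeGr d' F := by
  intro X
  rw [eq_bot_iff]
  intro x hx
  exact hF.crossEffect_eq_zero X (by omega) hx

end Polynomial

/-! ### Polynomial functors are generated in low degree -/

section Generation

variable {F : GrFunctor} {d : ℕ}

/-- The subgroup generated by the images of the values of a functor at an object. -/
def spanFrom (F : GrFunctor) (K X : FreeGr) : AddSubgroup (F.obj X) :=
  ⨆ f : K ⟶ X, (F.map f).hom.range

lemma map_mem_spanFrom {K X : FreeGr} (f : K ⟶ X) (x : F.obj K) : F.map f x ∈ spanFrom F K X :=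
  (le_iSup (fun f : K ⟶ X => (F.map f).hom.range) f) ⟨x, rfl⟩

lemma spanFrom_map {K X Y : FreeGr} (f : X ⟶ Y) {x : F.obj X} (hx : x ∈ spanFrom F K X) :
    F.map f x ∈ spanFrom F K Y := by
  have : spanFrom F K X ≤ (spanFrom F K Y).comap (F.map f).hom := by
    refine iSup_le fun g => ?_
    rintro _ ⟨y, rfl⟩
    change F.map f (F.map g y) ∈ spanFrom F K Y
    rw [← map_comp_apply']
    exact map_mem_spanFrom _ _
  exact this hx

/-- The summands other than the `i`-th. -/
def faceHom (n : ℕ) (i : Fin (n + 1)) : (∐ ints n) ⟶ ∐ ints (n + 1) :=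
  Sigma.desc fun j => Sigma.ι (ints (n + 1)) (i.succAbove j)

/-- The projection to the summands other than the `i`-th. -/
def degHom (n : ℕ) (i : Fin (n + 1)) : (∐ ints (n + 1)) ⟶ ∐ ints n :=
  Sigma.desc (i.insertNth (α := fun _ => FreeGr.int ⟶ ∐ ints n) 0 fun j => Sigma.ι (ints n) j)

lemma degHom_faceHom (n : ℕ) (i : Fin (n + 1)) :
    degHom n i ≫ faceHom n i = killSummand (ints (n + 1)) i := by
  refine Sigma.hom_ext _ _ fun j => ?_
  rw [ι_killSummand]
  rcases Fin.eq_self_or_eq_succAbove i j with rfl | ⟨k, rfl⟩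
  · simp [degHom, faceHom]
  · simp [degHom, faceHom, Fin.succAbove_ne]

lemma faceHom_degHom (n : ℕ) (i : Fin (n + 1)) : faceHom n i ≫ degHom n i = 𝟙 _ := by
  refine Sigma.hom_ext _ _ fun j => ?_
  simp [degHom, faceHom]

/-- With more than `d` copies of `ℤ` the projection to the cross effect is zero, while an element
and its projection differ by elements coming from one copy less. With at most `d` copies the object
is a retract of `∐ ints d`. -/
lemma IsPolynomial.mem_spanFrom_ints (hF : IsPolynomial FreeGr d F) (n : ℕ)
    (x : F.obj (∐ ints n)) : x ∈ spanFrom F (∐ ints d) (∐ ints n) := by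
  have key (n : ℕ) (h : n ≤ d) (x : F.obj (∐ ints n)) :
      x ∈ spanFrom F (∐ ints d) (∐ ints n) := by
    obtain ⟨k, rfl⟩ := Nat.exists_eq_add_of_le h
    clear hF h
    have : ∃ (i : (∐ ints n) ⟶ ∐ ints (n + k)) (r : (∐ ints (n + k)) ⟶ ∐ ints n),
        i ≫ r = 𝟙 _ := by
      induction k with
      | zero => exact ⟨𝟙 _, 𝟙 _, Category.comp_id _⟩
      | succ k ih =>
        obtain ⟨i, r, h⟩ := ih
        exact ⟨i ≫ faceHom (n + k) 0, degHom (n + k) 0 ≫ r, by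
          rw [Category.assoc, ← Category.assoc (faceHom _ _), faceHom_degHom, Category.id_comp, h]⟩
    obtain ⟨i, r, h⟩ := this
    rw [← map_id_apply' F x, ← h, map_comp_apply']
    exact map_mem_spanFrom _ _
  induction n with
  | zero => exact key 0 (Nat.zero_le d) x
  | succ n ih =>
    rcases le_or_gt (n + 1) d with h | h
    · exact key _ h x
    · have h₁ (L : List (Fin (n + 1))) :
          x - crProj _ F L x ∈ spanFrom F (∐ ints d) (∐ ints (n + 1)) := by
        induction L with
        | nil => exact (sub_self x).symm ▸ zero_mem _
        | cons i L ih' =>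
          rw [crProj_cons, ← sub_add]
          refine add_mem ih' ?_
          rw [← degHom_faceHom, map_comp_apply']
          exact spanFrom_map _ (ih _)
      have h₂ := h₁ (List.finRange (n + 1))
      rwa [hF.crProj_eq_zero _ (List.nodup_finRange _) (by rwa [List.length_finRange]),
        sub_zero] at h₂

/-- The homomorphism from `ℤ` with a given value at the generator. -/
def elHom {X : FreeGr} (g : X.group) : FreeGr.int ⟶ X := ⟨FreeGroup.lift fun _ => g⟩

/-- The generator of `ℤ`. -/
def intGen : FreeGr.int.group := FreeGroup.of (0 : Fin 1)

@[simp]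
lemma elHom_intGen {X : FreeGr} (g : X.group) : (elHom g).toMonoidHom intGen = g :=
  FreeGroup.lift_apply_of

lemma int_hom_ext {X : FreeGr} {f g : FreeGr.int ⟶ X}
    (h : f.toMonoidHom intGen = g.toMonoidHom intGen) : f = g :=
  FreeGr.hom_ext fun i => by
    have hi : i = (0 : Fin 1) := Subsingleton.elim (α := Fin 1) _ _
    subst hi
    exact h

/-- The homomorphism from `ℤ ∗ ⋯ ∗ ℤ` with given values at the generators. -/
def elsHom {n : ℕ} {X : FreeGr} (g : Fin n → X.group) : (∐ ints n) ⟶ X :=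
  Sigma.desc fun i => elHom (g i)

/-- The generators of `ℤ ∗ ⋯ ∗ ℤ`. -/
def intsGen (n : ℕ) (i : Fin n) : (∐ ints n : FreeGr).group :=
  (Sigma.ι (ints n) i).toMonoidHom intGen

@[simp]
lemma elsHom_intsGen {n : ℕ} {X : FreeGr} (g : Fin n → X.group) (i : Fin n) :
    (elsHom g).toMonoidHom (intsGen n i) = g i := by
  have : Sigma.ι (ints n) i ≫ elsHom g = elHom (g i) := Sigma.ι_desc _ _
  have h := congrArg (fun f => f.toMonoidHom intGen) this
  exact h.trans (elHom_intGen _)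

lemma ints_hom_ext {n : ℕ} {X : FreeGr} {f g : (∐ ints n) ⟶ X}
    (h : ∀ i, f.toMonoidHom (intsGen n i) = g.toMonoidHom (intsGen n i)) : f = g :=
  Sigma.hom_ext _ _ fun i => int_hom_ext (h i)

lemma IsPolynomial.mem_spanFrom (hF : IsPolynomial FreeGr d F) {X : FreeGr} (x : F.obj X) :
    x ∈ spanFrom F (∐ ints d) X := by
  let φ : X ⟶ ∐ ints X.rank := ⟨FreeGroup.lift fun i => intsGen X.rank i⟩
  let ψ : (∐ ints X.rank) ⟶ X := elsHom fun i => FreeGroup.of i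
  have h : φ ≫ ψ = 𝟙 X := FreeGr.hom_ext fun i => by
    change ψ.toMonoidHom (FreeGroup.lift (fun i => intsGen X.rank i) (FreeGroup.of i)) = _
    rw [FreeGroup.lift_apply_of, elsHom_intsGen]
    rfl
  rw [← map_id_apply' F x, ← h, map_comp_apply']
  exact spanFrom_map _ (hF.mem_spanFrom_ints _ _)

end Generation

/-! ### The first graded piece is additive -/

section Additive

lemma coprod_monoidHom_ext {n : ℕ} (X : Fin n → FreeGr) {M : Type*} [Monoid M]
    {f g : (∐ X : FreeGr).group →* M}
    (h : ∀ i x, f ((Sigma.ι X i).toMonoidHom x) = g ((Sigma.ι X i).toMonoidHom x)) : f = g := by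
  let e : (FreeGr.cofan X).pt ≅ ∐ X :=
    (FreeGr.cofanIsColimit X).coconePointUniqueUpToIso (colimit.isColimit (Discrete.functor X))
  have he (i : Fin n) : (FreeGr.cofan X).inj i ≫ e.hom = Sigma.ι X i :=
    (FreeGr.cofanIsColimit X).comp_coconePointUniqueUpToIso_hom
      (colimit.isColimit (Discrete.functor X)) ⟨i⟩
  have key : f.comp e.hom.toMonoidHom = g.comp e.hom.toMonoidHom := by
    refine FreeGroup.ext_hom _ _ fun k => ?_
    obtain ⟨⟨i, j⟩, rfl⟩ := finSigmaFinEquiv.surjective k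
    have h₁ : FreeGroup.of (finSigmaFinEquiv ⟨i, j⟩) =
        ((FreeGr.cofan X).inj i).toMonoidHom (FreeGroup.of j) := (FreeGroup.map.of).symm
    have h₂ : e.hom.toMonoidHom (FreeGroup.of (finSigmaFinEquiv ⟨i, j⟩)) =
        (Sigma.ι X i).toMonoidHom (FreeGroup.of j) := by
      rw [← he]
      exact congrArg e.hom.toMonoidHom h₁
    change f (e.hom.toMonoidHom _) = g (e.hom.toMonoidHom _)
    rw [h₂, h]
  have hs : Function.Surjective e.hom.toMonoidHom := fun x =>
    ⟨e.inv.toMonoidHom x, by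
      change (e.inv ≫ e.hom).toMonoidHom x = x
      rw [e.inv_hom_id]
      rfl⟩
  exact (MonoidHom.cancel_right hs).1 key

/-- The element `g - 1` of the augmentation ideal. -/
def elI {G : FreeGr} (g : G.group) : (Ipow 1).obj G :=
  Imk (el g - 1) (mem_augPow_one.2 (by rw [map_sub, aug_el, map_one, sub_self]))

@[simp]
lemma Ival_elI {G : FreeGr} (g : G.group) : Ival (elI g) = el g - 1 := rfl

@[simp]
lemma map_elI {G H : FreeGr} (f : G ⟶ H) (g : G.group) :
    (Ipow 1).map f (elI g) = elI (f.toMonoidHom g) :=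
  Ival_injective (by simp)

lemma elI_one (G : FreeGr) : elI (1 : G.group) = 0 := Ival_injective (by simp)

lemma Ipow_one_addHom_ext {G : FreeGr} {M : Type*} [AddCommGroup M] {f g : (Ipow 1).obj G →+ M}
    (h : ∀ x, f (elI x) = g (elI x)) : f = g := by
  let k : ZG G →+ (Ipow 1).obj G := (augSub G).comp
    (AddMonoidHom.mk' (fun x => Imk x (mem_augPow_zero x)) fun _ _ => rfl)
  have hk (x : G.group) : k (el x) = elI x := Ival_injective (by
    change el x - aug G (el x) • 1 = el x - 1
    rw [aug_el, one_smul])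
  have key : f.comp k = g.comp k := zg_hom_ext fun x => by
    change f (k (el x)) = g (k (el x))
    rw [hk, h]
  ext x
  have hx : k (Ival x) = x := Ival_injective (by
    change Ival x - aug G (Ival x) • 1 = Ival x
    rw [aug_Ival, zero_smul, sub_zero])
  rw [← hx]
  exact DFunLike.congr_fun key (Ival x)

/-- The class of `g - 1` in the first graded piece. -/
def gc {G : FreeGr} (g : G.group) : (gr 1).obj G := (grπ 1).app G (elI g)

/-- From `gh - 1 = (g - 1) + (h - 1) + (g - 1)(h - 1)`. Thus `gr 1` behaves as the abelianization.
-/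
lemma gc_mul {G : FreeGr} (g h : G.group) : gc (g * h) = gc g + gc h := by
  rw [gc, gc, gc, ← map_add, ← sub_eq_zero, ← map_sub, grπ_eq_zero_iff']
  have : Ival (elI (g * h) - (elI g + elI h)) = (el g - 1) * (el h - 1) := by
    rw [map_sub, map_add, Ival_elI, Ival_elI, Ival_elI, map_mul]
    noncomm_ring
  rw [this]
  exact mul_mem_augPow_succ (elI g).2 (aug_Ival (elI h))

lemma gc_one (G : FreeGr) : gc (1 : G.group) = 0 := by rw [gc, elI_one, map_zero]

/-- The class of `g - 1` in the first graded piece, as a homomorphism. -/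
def gcHom (G : FreeGr) : G.group →* Multiplicative ((gr 1).obj G) where
  toFun g := .ofAdd (gc g)
  map_one' := congrArg Multiplicative.ofAdd (gc_one G)
  map_mul' g h := congrArg Multiplicative.ofAdd (gc_mul g h)

@[simp]
lemma map_gc {G H : FreeGr} (f : G ⟶ H) (g : G.group) :
    (gr 1).map f (gc g) = gc (f.toMonoidHom g) := by
  rw [gc, gc, ← app_map_apply, map_elI]

lemma gr_one_addHom_ext {G : FreeGr} {M : Type*} [AddCommGroup M] {f g : (gr 1).obj G →+ M}
    (h : ∀ x, f (gc x) = g (gc x)) : f = g := by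
  have key : f.comp ((grπ 1).app G).hom = g.comp ((grπ 1).app G).hom := Ipow_one_addHom_ext h
  ext x
  obtain ⟨x, rfl⟩ := grπ_surjective 1 G x
  exact DFunLike.congr_fun key x

/-- Additivity of the abelianization. Both sides come from homomorphisms on a free product, so it is
enough to compare them on each summand, where a single term survives. -/
lemma sum_map_gr_one {n : ℕ} (X : Fin n → FreeGr) :
    ∑ i, ((gr 1).map (killSet X (· ≠ i))).hom = AddMonoidHom.id ((gr 1).obj (∐ X)) := by
  refine gr_one_addHom_ext fun x => ?_
  rw [AddMonoidHom.finsetSum_apply]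
  change ∑ i, (gr 1).map (killSet X (· ≠ i)) (gc x) = gc x
  simp only [map_gc]
  have key : (∏ i, (gcHom _).comp (killSet X (· ≠ i)).toMonoidHom) = gcHom (∐ X) := by
    refine coprod_monoidHom_ext X fun j y => ?_
    rw [MonoidHom.finsetProd_apply, Finset.prod_eq_single j]
    · have := congrArg (fun f => gcHom _ (f.toMonoidHom y)) (ι_killSet X (· ≠ j) j)
      simpa using this
    · intro i _ hi
      have := congrArg (fun f => gcHom _ (f.toMonoidHom y)) (ι_killSet X (· ≠ i) j)
      simp only [ne_eq, hi.symm, not_false_eq_true, if_true] at this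
      exact this.trans (map_one _)
    · exact fun h => absurd (Finset.mem_univ j) h
  have := DFunLike.congr_fun key x
  rw [MonoidHom.finsetProd_apply] at this
  exact congrArg Multiplicative.toAdd this

end Additive

/-! ### Tensoring with the first graded piece raises the degree by one -/

section TensGr

variable {X Y Z A B D : GrFunctor}

/-- The tensor product of additive maps between values of functors. -/
def tmBi {G H : FreeGr} (θ : X.obj G →+ Y.obj H) (η : A.obj G →+ B.obj H) :
    (tens X A).obj G →+ (tens Y B).obj H :=
  tensLiftAt (biHom (fun x a => tm (θ x) (η a)) (fun x y z => by rw [map_add, add_tm])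
    (fun x y z => by rw [map_add, tm_add]))

lemma tmBi_tmBi {G H K : FreeGr} (θ : X.obj G →+ Y.obj H) (η : A.obj G →+ B.obj H)
    (θ' : Y.obj H →+ Z.obj K) (η' : B.obj H →+ D.obj K) (z : (tens X A).obj G) :
    tmBi θ' η' (tmBi θ η z) = tmBi (X := X) (Y := Z) (A := A) (B := D) (θ'.comp θ) (η'.comp η) z :=
  DFunLike.congr_fun (tens_addHom_ext (f := (tmBi θ' η').comp (tmBi θ η))
    (g := tmBi (X := X) (Y := Z) (A := A) (B := D) (θ'.comp θ) (η'.comp η)) fun _ _ => rfl) z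

lemma tens_map_eq_tmBi {G H : FreeGr} (f : G ⟶ H) (z : (tens X A).obj G) :
    (tens X A).map f z = tmBi (X.map f).hom (A.map f).hom z := by
  exact DFunLike.congr_fun (tens_addHom_ext (f := ((tens X A).map f).hom)
    (g := tmBi (X.map f).hom (A.map f).hom) fun _ _ => rfl) z

lemma tmBi_id {G : FreeGr} (z : (tens X A).obj G) :
    tmBi (X := X) (Y := X) (A := A) (B := A) (AddMonoidHom.id _) (AddMonoidHom.id _) z = z :=
  DFunLike.congr_fun (tens_addHom_ext
    (f := tmBi (X := X) (Y := X) (A := A) (B := A) (AddMonoidHom.id _) (AddMonoidHom.id _))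
    (g := AddMonoidHom.id _) fun _ _ => rfl) z

lemma tmBi_crProj {n : ℕ} (X : Fin n → FreeGr) (L : List (Fin n)) (z : (tens Y A).obj (∐ X))
    (h : ∀ i ∈ L, tmBi (X := Y) (Y := Y) (B := A) (AddMonoidHom.id _)
      (A.map (killSummand X i)).hom z = 0) :
    tmBi (X := Y) (Y := Y) (B := A) (AddMonoidHom.id _) (crProj X A L) z = z := by
  induction L with
  | nil => exact tmBi_id z
  | cons i L ih =>
    have h₁ : tmBi (X := Y) (Y := Y) (B := A) (AddMonoidHom.id _) (crProj X A (i :: L)) =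
        tmBi (X := Y) (Y := Y) (B := A) (AddMonoidHom.id _) (crProj X A L) -
        (tmBi (X := Y) (Y := Y) (B := A) (AddMonoidHom.id _) (A.map (killSummand X i)).hom).comp
          (tmBi (X := Y) (Y := Y) (B := A) (AddMonoidHom.id _) (crProj X A L)) :=
      tens_addHom_ext fun x a => tm_sub x _ _
    rw [h₁, AddMonoidHom.sub_apply, AddMonoidHom.comp_apply,
      ih fun i hi => h i (List.mem_cons_of_mem _ hi), h i List.mem_cons_self, sub_zero]

/-- By additivity of `gr 1`, `z` is the sum of its parts `p i` whose first factor is projected to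
the `i`-th summand. For `j ≠ i`, killing the summand `j` does not affect that factor, so `p i` is
annihilated by killing `j` in the factor `A` alone. As there are `d + 1` such `j` and `A` has degree
at most `d`, `p i` is zero. -/
lemma IsPolynomial.tens_gr_one {d : ℕ} (hA : IsPolynomial FreeGr d A) :
    IsPolynomial FreeGr (d + 1) (tens (gr 1) A) := by
  intro X
  rw [eq_bot_iff]
  intro z hz
  rw [mem_crossEffect'] at hz
  let p (i : Fin (d + 2)) : (tens (gr 1) A).obj (∐ X) :=
    tmBi ((gr 1).map (killSet X (· ≠ i))).hom (AddMonoidHom.id _) z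
  have hp (i : Fin (d + 2)) : p i = 0 := by
    have h₁ : ∀ j ∈ (List.finRange (d + 2)).erase i,
        tmBi (X := gr 1) (Y := gr 1) (B := A) (AddMonoidHom.id _)
          (A.map (killSummand X j)).hom (p i) = 0 := by
      intro j hj
      have hj' : j ≠ i := ((List.nodup_finRange _).mem_erase_iff.1 hj).1
      have h₂ : ((gr 1).map (killSet X (· ≠ i))).hom.comp ((gr 1).map (killSummand X j)).hom =
          ((gr 1).map (killSet X (· ≠ i))).hom := by
        rw [← AddCommGrpCat.hom_comp, ← Functor.map_comp, killSummand_killSet X (· ≠ i) hj']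
      have h₃ := congrArg (tmBi ((gr 1).map (killSet X (· ≠ i))).hom
        (AddMonoidHom.id (A.obj (∐ X)))) (hz j)
      rw [map_zero, tens_map_eq_tmBi, tmBi_tmBi, h₂] at h₃
      rw [tmBi_tmBi]
      exact h₃
    rw [← tmBi_crProj X _ _ h₁]
    have h₂ : crProj X A ((List.finRange (d + 2)).erase i) = 0 := by
      ext x
      refine hA.crProj_eq_zero X ((List.nodup_finRange _).erase i) ?_ x
      rw [List.length_erase_of_mem (List.mem_finRange i), List.length_finRange]
      omega
    have h₃ : tmBi (X := gr 1) (Y := gr 1) (A := A) (B := A) (AddMonoidHom.id _)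
        (0 : A.obj (∐ X) →+ A.obj (∐ X)) = 0 := tens_addHom_ext fun x a => tm_zero x
    rw [h₂, h₃]
    rfl
  have h : ∑ i, p i = z := by
    have h₁ : ∑ i, tmBi (X := gr 1) (Y := gr 1) (A := A) (B := A)
        ((gr 1).map (killSet X (· ≠ i))).hom (AddMonoidHom.id _) = AddMonoidHom.id _ := by
      refine tens_addHom_ext fun x a => ?_
      rw [AddMonoidHom.finsetSum_apply]
      have h₂ : (∑ i, (gr 1).map (killSet X (· ≠ i)) x) = x := by
        have := DFunLike.congr_fun (sum_map_gr_one X) x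
        rwa [AddMonoidHom.finsetSum_apply] at this
      conv_rhs => rw [← h₂]
      exact (map_sum ((tmHom (X := gr 1) (A := A) (∐ X)).flip a)
        (fun i => (gr 1).map (killSet X (· ≠ i)) x) Finset.univ).symm
    have := DFunLike.congr_fun h₁ z
    rwa [AddMonoidHom.finsetSum_apply] at this
  rw [AddSubgroup.mem_bot, ← h]
  exact Finset.sum_eq_zero fun i _ => hp i

end TensGr
end

noncomputable section

/-! ### Exactness of cross effects -/

section CrossEffectExact

variable (d : ℕ)

/-- The functor `F ↦ cr_d(F)(ℤ, …, ℤ)` on all functors. -/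
def crAll : GrFunctor ⥤ Rep.{0} ℤ (Equiv.Perm (Fin d)) where
  obj F := Rep.of (crossEffectRep F d)
  map f := Rep.ofHom (crossEffectMap f d)

instance : (crAll d).Additive where
  map_add := rfl

lemma Rep.shortExact_of_elements {k G : Type} [CommRing k] [Monoid G]
    (S : ShortComplex (Rep.{0} k G)) (hf : Function.Injective S.f.hom)
    (hg : Function.Surjective S.g.hom) (h : ∀ y, S.g.hom y = 0 → ∃ x, S.f.hom x = y) :
    S.ShortExact :=
  have := (Rep.mono_iff_injective S.f).2 hf
  have := (Rep.epi_iff_surjective S.g).2 hg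
  { exact := (S.exact_map_iff_of_faithful (forget₂ (Rep.{0} k G) (ModuleCat.{0} k))).1
      ((ShortComplex.moduleCat_exact_iff _).2 h) }

lemma shortExact_crAll {S : ShortComplex GrFunctor} (hS : S.ShortExact) :
    (S.map (crAll d)).ShortExact := by
  have := hS.mono_f
  have := hS.epi_g
  refine Rep.shortExact_of_elements _ (fun x y h => ?_) (fun y => ?_) (fun y hy => ?_)
  · exact Subtype.ext (app_injective_of_mono S.f _ (congrArg Subtype.val h))
  · obtain ⟨x, hx, h⟩ := exists_mem_crossEffect_of_epi S.g y.2
    exact ⟨⟨x, hx⟩, Subtype.ext h⟩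
  · obtain ⟨x, hx⟩ := exists_of_shortExact hS _ y.1 (congrArg Subtype.val hy)
    refine ⟨⟨x, ?_⟩, Subtype.ext hx⟩
    rw [mem_crossEffect]
    intro i
    apply app_injective_of_mono S.f
    rw [app_map_apply, hx, mem_crossEffect.1 y.2, map_zero]

lemma projective_of_shortExact {C : Type*} [Category* C] [Abelian C] {S : ShortComplex C}
    (hS : S.ShortExact) (h₁ : Projective S.X₁) (h₃ : Projective S.X₃) : Projective S.X₂ :=
  Projective.of_iso (hS.splittingOfProjective).isoBinaryBiproduct.symm inferInstance

end CrossEffectExact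

/-! ### Polynomial functors with projective cross effects -/

section CrProj

variable {A B : GrFunctor} {e : ℕ}

/-- After `p` tensor products with the first graded piece, the functor is polynomial of degree at
most `e + p` with projective cross effects. -/
def HasProjCr (e : ℕ) (A : GrFunctor) : Prop :=
  ∀ p, IsPolynomial FreeGr (e + p) ((iterTens (gr 1) p).obj A) ∧
    Projective ((crAll (e + p)).obj ((iterTens (gr 1) p).obj A))

lemma HasProjCr.of_iso (i : A ≅ B) (h : HasProjCr e A) : HasProjCr e B := fun p =>
  ⟨(IsPolynomial FreeGr (e + p)).prop_of_iso ((iterTens (gr 1) p).mapIso i) (h p).1,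
    Projective.of_iso ((crAll (e + p)).mapIso ((iterTens (gr 1) p).mapIso i)) (h p).2⟩

lemma HasProjCr.ext {S : ShortComplex GrFunctor} (hS : S.ShortExact) (h₁ : HasProjCr e S.X₁)
    (h₃ : HasProjCr e S.X₃) : HasProjCr e S.X₂ := fun p => by
  have hS' := hS.map_of_exact (iterTens (gr 1) p)
  exact ⟨(IsPolynomial FreeGr (e + p)).prop_X₂_of_shortExact hS' (h₁ p).1 (h₃ p).1,
    projective_of_shortExact (shortExact_crAll (e + p) hS') (h₁ p).2 (h₃ p).2⟩

/-- Cross effects beyond the degree vanish, and the zero module is projective. -/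
lemma HasProjCr.mono {e' : ℕ} (h : HasProjCr e A) (he : e ≤ e') : HasProjCr e' A := by
  rcases he.eq_or_lt with rfl | he
  · exact h
  · refine fun p => ⟨(h p).1.mono (by omega), ?_⟩
    have : IsZero ((crAll (e' + p)).obj ((iterTens (gr 1) p).obj A)) := by
      rw [Rep.isZero_iff]
      refine ⟨fun x y => Subtype.ext ?_⟩
      rw [(h p).1.crossEffect_eq_zero _ (by omega) x.2, (h p).1.crossEffect_eq_zero _ (by omega) y.2]
    exact this.projective

lemma IsPolynomial.of_isZero (h : IsZero A) : IsPolynomial FreeGr e A := fun X => by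
  have := AddCommGrpCat.subsingleton_of_isZero (h.obj (∐ X))
  exact Subsingleton.elim _ _

lemma HasProjCr.of_isZero (h : IsZero A) : HasProjCr e A := fun p =>
  ⟨.of_isZero ((iterTens (gr 1) p).map_isZero h),
    ((crAll _).map_isZero ((iterTens (gr 1) p).map_isZero h)).projective⟩

lemma HasProjCr.tens_gr_one (h : HasProjCr e A) : HasProjCr (e + 1) (tens (gr 1) A) := fun p => by
  have := h (p + 1)
  rw [show e + (p + 1) = e + 1 + p by omega] at this
  exact this

lemma HasProjCr.tens_gr (h : HasProjCr e A) (s : ℕ) : HasProjCr (e + s) (tens (gr s) A) := by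
  induction s generalizing e A with
  | zero => exact h.of_iso (grZeroTens A).symm
  | succ s ih =>
    obtain ⟨i⟩ := nonempty_gr_succ_tens_iso A s
    rw [show e + (s + 1) = e + 1 + s by omega]
    exact (ih h.tens_gr_one).of_iso i

end CrProj
end

noncomputable section

/-! ### Free functors -/

section Free

variable {n : ℕ} {S : Type} {F : GrFunctor} {G H : FreeGr}

/-- The functor `X ↦ ℤ[gr(ℤ ∗ ⋯ ∗ ℤ, X) × S]`. -/
def freeF (n : ℕ) (S : Type) : GrFunctor where
  obj X := AddCommGrpCat.of ((Fin n → X.group) × S →₀ ℤ)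
  map f := AddCommGrpCat.ofHom
    (Finsupp.mapDomain.addMonoidHom fun x => (fun i => f.toMonoidHom (x.1 i), x.2))
  map_id _ := AddCommGrpCat.hom_ext (AddMonoidHom.ext fun _ => Finsupp.mapDomain_id)
  map_comp f g := AddCommGrpCat.hom_ext (AddMonoidHom.ext fun x =>
    (Finsupp.mapDomain_comp (v := x)
      (f := fun x : (Fin n → _) × S => (fun i => f.toMonoidHom (x.1 i), x.2))
      (g := fun x : (Fin n → _) × S => (fun i => g.toMonoidHom (x.1 i), x.2)) :))

/-- The basis elements of a free functor. -/
def fe (g : Fin n → G.group) (s : S) : (freeF n S).obj G := Finsupp.single (g, s) 1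

@[simp]
lemma map_fe (f : G ⟶ H) (g : Fin n → G.group) (s : S) :
    (freeF n S).map f (fe g s) = fe (fun i => f.toMonoidHom (g i)) s :=
  Finsupp.mapDomain_single

lemma free_addHom_ext {M : Type*} [AddCommGroup M] {f g : (freeF n S).obj G →+ M}
    (h : ∀ x s, f (fe x s) = g (fe x s)) : f = g :=
  Finsupp.addHom_ext' fun x => AddMonoidHom.ext_int (h x.1 x.2)

/-- Additive maps on the values of a free functor. -/
def freeLiftAt {M : Type*} [AddCommGroup M] (φ : (Fin n → G.group) → S → M) :
    (freeF n S).obj G →+ M :=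
  Finsupp.liftAddHom fun x => zmultiplesHom M (φ x.1 x.2)

@[simp]
lemma freeLiftAt_fe {M : Type*} [AddCommGroup M] (φ : (Fin n → G.group) → S → M)
    (x : Fin n → G.group) (s : S) : freeLiftAt φ (fe x s) = φ x s := by
  refine (Finsupp.liftAddHom_apply_single _ _ _).trans ?_
  simp

/-- The universal property of free functors. -/
def freeDesc (φ : S → F.obj (∐ ints n)) : freeF n S ⟶ F :=
  natHom (fun _ => freeLiftAt fun g s => F.map (elsHom g) (φ s)) fun {G H} f x => by
    refine DFunLike.congr_fun (free_addHom_ext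
      (f := (freeLiftAt fun g s => F.map (elsHom g) (φ s)).comp ((freeF n S).map f).hom)
      (g := (F.map f).hom.comp (freeLiftAt fun g s => F.map (elsHom g) (φ s)))
      fun g s => ?_) x
    change freeLiftAt (fun g s => F.map (elsHom g) (φ s)) ((freeF n S).map f (fe g s)) =
      F.map f (freeLiftAt (fun g s => F.map (elsHom g) (φ s)) (fe g s))
    rw [map_fe, freeLiftAt_fe, freeLiftAt_fe, ← map_comp_apply']
    congr 2
    refine congrArg F.map (ints_hom_ext fun i => ?_)
    change _ = f.toMonoidHom ((elsHom g).toMonoidHom _)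
    rw [elsHom_intsGen, elsHom_intsGen]

@[simp]
lemma freeDesc_fe (φ : S → F.obj (∐ ints n)) (g : Fin n → G.group) (s : S) :
    (freeDesc φ).app G (fe g s) = F.map (elsHom g) (φ s) := freeLiftAt_fe _ _ _

lemma freeDesc_fe_intsGen (φ : S → F.obj (∐ ints n)) (s : S) :
    (freeDesc φ).app _ (fe (intsGen n) s) = φ s := by
  rw [freeDesc_fe, show elsHom (intsGen n) = 𝟙 _ from ints_hom_ext fun i => elsHom_intsGen _ _,
    map_id_apply']

lemma free_hom_ext {f g : freeF n S ⟶ F}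
    (h : ∀ s, f.app _ (fe (intsGen n) s) = g.app _ (fe (intsGen n) s)) : f = g := by
  refine nat_hom_ext fun G x => DFunLike.congr_fun (free_addHom_ext (f := (f.app G).hom)
    (g := (g.app G).hom) fun y s => ?_) x
  have hy : fe y s = (freeF n S).map (elsHom y) (fe (intsGen n) s) := by
    rw [map_fe]
    simp only [elsHom_intsGen]
  change f.app G (fe y s) = g.app G (fe y s)
  rw [hy, app_map_apply, app_map_apply, h]

instance (n : ℕ) (S : Type) : Projective (freeF n S) where
  factors {E X} f e _ := by
    choose φ hφ using fun s => app_surjective_of_epi e _ (f.app _ (fe (intsGen n) s))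
    refine ⟨freeDesc φ, free_hom_ext fun s => ?_⟩
    rw [comp_app_apply, freeDesc_fe_intsGen, hφ]

/-- Additive maps on group rings. -/
def zgLift {M : Type*} [AddCommGroup M] (φ : G.group → M) : ZG G →+ M :=
  (Finsupp.liftAddHom fun x => zmultiplesHom M (φ x)).comp
    (MonoidAlgebra.coeffAddEquiv (R := ℤ) (M := G.group)).toAddMonoidHom

@[simp]
lemma zgLift_el {M : Type*} [AddCommGroup M] (φ : G.group → M) (g : G.group) :
    zgLift φ (el g) = φ g := by
  have : MonoidAlgebra.coeffAddEquiv (el g) = Finsupp.single g (1 : ℤ) := rfl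
  change (Finsupp.liftAddHom fun x => zmultiplesHom M (φ x)) (MonoidAlgebra.coeffAddEquiv (el g)) = _
  rw [this]
  simp

/-- A group element, viewed in the group ring functor. -/
def elR (g : G.group) : (Ipow 0).obj G := Imk (el g) (mem_augPow_zero _)

@[simp]
lemma map_elR (f : G ⟶ H) (g : G.group) : (Ipow 0).map f (elR g) = elR (f.toMonoidHom g) :=
  Ival_injective (ZGmap_el f g)

lemma Ipow_zero_addHom_ext {M : Type*} [AddCommGroup M] {f g : (Ipow 0).obj G →+ M}
    (h : ∀ x, f (elR x) = g (elR x)) : f = g := by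
  let k : ZG G →+ (Ipow 0).obj G := AddMonoidHom.mk' (fun x => Imk x (mem_augPow_zero x))
    fun _ _ => rfl
  have key : f.comp k = g.comp k := zg_hom_ext h
  ext x
  exact DFunLike.congr_fun key (Ival x)

lemma tens_free_addHom_ext {M : Type*} [AddCommGroup M]
    {f g : (tens (Ipow 0) (freeF n S)).obj G →+ M}
    (h : ∀ x y s, f (tm (elR x) (fe y s)) = g (tm (elR x) (fe y s))) : f = g := by
  refine tens_addHom_ext fun x z => ?_
  refine DFunLike.congr_fun (free_addHom_ext (f := f.comp (tmHom G x)) (g := g.comp (tmHom G x))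
    fun y s => ?_) z
  exact DFunLike.congr_fun (Ipow_zero_addHom_ext (f := f.comp ((tmHom G).flip (fe y s)))
    (g := g.comp ((tmHom G).flip (fe y s))) fun x => h x y s) x

lemma tens_free_hom_ext {f g : tens (Ipow 0) (freeF n S) ⟶ F}
    (h : ∀ G x y s, f.app G (tm (elR x) (fe y s)) = g.app G (tm (elR x) (fe y s))) : f = g :=
  nat_hom_ext fun G => DFunLike.congr_fun (tens_free_addHom_ext (f := (f.app G).hom)
    (g := (g.app G).hom) (h G))

/-- The comparison between the tensor product of the group ring and a free functor, and the next
free functor, at one object. -/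
def tensFreeFun (n : ℕ) (S : Type) (G : FreeGr) :
    (tens (Ipow 0) (freeF n S)).obj G →+ (freeF (n + 1) S).obj G :=
  tensLiftAt ((zgLift fun g => freeLiftAt (n := n) (S := S) (M := (freeF (n + 1) S).obj G)
    fun h s => fe (Fin.cons (α := fun _ => G.group) g h) s).comp Ival)

@[simp]
lemma tensFreeFun_tm (g : G.group) (h : Fin n → G.group) (s : S) :
    tensFreeFun n S G (tm (elR g) (fe h s)) = fe (Fin.cons (α := fun _ => G.group) g h) s := by
  change zgLift (fun g => freeLiftAt (n := n) (S := S) (M := (freeF (n + 1) S).obj G)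
    fun h s => fe (Fin.cons (α := fun _ => G.group) g h) s) (el g) (fe h s) = _
  rw [zgLift_el, freeLiftAt_fe]

/-- Tensoring a free functor with the group ring gives a free functor. -/
def tensFreeIso (n : ℕ) (S : Type) : tens (Ipow 0) (freeF n S) ≅ freeF (n + 1) S where
  hom := natHom (tensFreeFun n S) fun {G H} f x => by
    refine DFunLike.congr_fun (tens_free_addHom_ext (f := (tensFreeFun n S H).comp
        ((tens (Ipow 0) (freeF n S)).map f).hom)
      (g := ((freeF (n + 1) S).map f).hom.comp (tensFreeFun n S G)) fun g h s => ?_) x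
    change tensFreeFun n S H (tm ((Ipow 0).map f (elR g)) ((freeF n S).map f (fe h s))) =
      (freeF (n + 1) S).map f (tensFreeFun n S G (tm (elR g) (fe h s)))
    rw [map_elR, map_fe, tensFreeFun_tm, tensFreeFun_tm, map_fe]
    congr 1
    funext i
    refine Fin.cases ?_ (fun i => ?_) i
    · rfl
    · rfl
  inv := freeDesc fun s => tm (elR (intsGen (n + 1) 0)) (fe (fun i => intsGen (n + 1) i.succ) s)
  hom_inv_id := tens_free_hom_ext fun G x y s => by
    rw [comp_app_apply, natHom_app, tensFreeFun_tm, freeDesc_fe, tens_map_tm, map_elR, map_fe]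
    simp only [elsHom_intsGen]
    rfl
  inv_hom_id := free_hom_ext fun s => by
    rw [comp_app_apply, freeDesc_fe_intsGen, natHom_app, tensFreeFun_tm]
    congr 1
    funext i
    refine Fin.cases ?_ (fun i => ?_) i
    · rfl
    · rfl

lemma nonempty_iterTens_free_iso (p n : ℕ) (S : Type) :
    Nonempty ((iterTens (Ipow 0) p).obj (freeF n S) ≅ freeF (n + p) S) := by
  induction p generalizing n with
  | zero => exact ⟨Iso.refl _⟩
  | succ p ih =>
    obtain ⟨i⟩ := ih (n + 1)
    rw [show n + (p + 1) = n + 1 + p by omega]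
    exact ⟨(iterTens (Ipow 0) p).mapIso (tensFreeIso n S) ≪≫ i⟩

end Free

/-! ### Free functors and the augmentation ideal -/

section FreeOrth

variable {A : GrFunctor}

/-- The augmentation ideal is a retract of the group ring. -/
def retractIpow : Retract (Ipow 1) (Ipow 0) where
  i := Iincl 0
  r := natHom (fun G => augSub G) fun f x => Ival_injective (by simp)
  retract := nat_hom_ext fun G x => Ival_injective (by
    change Ival x - aug G (Ival x) • 1 = Ival x
    rw [aug_Ival, zero_smul, sub_zero])

/-- Tensor products of retracts. -/
def retractTens (A : GrFunctor) : Retract (tens (Ipow 1) A) (tens (Ipow 0) A) where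
  i := tensMap retractIpow.i (𝟙 A)
  r := tensMap retractIpow.r (𝟙 A)
  retract := by rw [tensMap_comp, retractIpow.retract, Category.comp_id, tensMap_id]

/-- Factors `I` are split off from factors `R` one at a time, so mixed tensor products have to be
allowed. -/
lemma projective_iterTens_Ipow_one (h : ∀ q, Projective ((iterTens (Ipow 0) q).obj A)) (p q : ℕ) :
    Projective ((iterTens (Ipow 0) q).obj ((iterTens (Ipow 1) p).obj A)) := by
  induction p generalizing A q with
  | zero => exact h q
  | succ p ih =>
    refine ih (A := tens (Ipow 1) A) (fun q => ?_) q
    have := h (q + 1)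
    exact ((retractTens A).map (iterTens (Ipow 0) q)).projective (p := this)

lemma projective_iterTens_free (p : ℕ) (S : Type) :
    Projective ((iterTens (Ipow 1) p).obj (freeF 0 S)) := by
  refine projective_iterTens_Ipow_one (fun q => ?_) p 0
  obtain ⟨i⟩ := nonempty_iterTens_free_iso q 0 S
  exact Projective.of_iso i.symm inferInstance

variable {X : GrFunctor} {G H : FreeGr}

/-- Iterated pure tensors. -/
def iterTm : ∀ {p : ℕ} {A : GrFunctor} {G : FreeGr} (_ : Fin p → X.obj G) (_ : A.obj G),
    ((iterTens X p).obj A).obj G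
  | 0, _, _, _, z => z
  | _ + 1, A, _, a, z => iterTm (A := tens X A) (fun i => a i.succ) (tm (a 0) z)

lemma map_iterTm {p : ℕ} (f : G ⟶ H) (a : Fin p → X.obj G) (z : A.obj G) :
    ((iterTens X p).obj A).map f (iterTm a z) = iterTm (fun i => X.map f (a i)) (A.map f z) := by
  induction p generalizing A with
  | zero => rfl
  | succ p ih => exact ih (A := tens X A) _ _

lemma iterTm_zero {p : ℕ} (a : Fin p → X.obj G) : iterTm a (0 : A.obj G) = 0 := by
  induction p generalizing A with
  | zero => rfl
  | succ p ih =>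
    rw [iterTm, tm_zero]
    exact ih (A := tens X A) _

lemma iterTm_eq_zero {p : ℕ} {a : Fin p → X.obj G} {i : Fin p} (h : a i = 0) (z : A.obj G) :
    iterTm a z = 0 := by
  induction p generalizing A with
  | zero => exact i.elim0
  | succ p ih =>
    rw [iterTm]
    induction i using Fin.cases with
    | zero =>
      rw [h, zero_tm]
      exact iterTm_zero (A := tens X A) _
    | succ i => exact ih (A := tens X A) h _

lemma closure_eq_top_of_ext {M : Type*} [AddCommGroup M] (T : Set M)
    (h : ∀ f : M →+ M ⧸ AddSubgroup.closure T, (∀ t ∈ T, f t = 0) → f = 0) :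
    AddSubgroup.closure T = ⊤ := by
  have := h (QuotientAddGroup.mk' _) fun t ht =>
    (QuotientAddGroup.eq_zero_iff t).2 (AddSubgroup.subset_closure ht)
  rw [eq_top_iff]
  intro x _
  exact (QuotientAddGroup.eq_zero_iff x).1 (DFunLike.congr_fun this x)

lemma closure_tm (T : Set (X.obj G)) (hT : AddSubgroup.closure T = ⊤) (U : Set (A.obj G))
    (hU : AddSubgroup.closure U = ⊤) :
    AddSubgroup.closure (Set.image2 (fun x a => (tm x a : (tens X A).obj G)) T U) = ⊤ := by
  refine closure_eq_top_of_ext _ fun f hf => ?_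
  refine tens_addHom_ext fun x a => ?_
  have h₁ (x : X.obj G) (hx : x ∈ T) : f.comp (tmHom G x) = 0 :=
    AddMonoidHom.eq_of_eqOn_dense hU fun a ha => hf _ ⟨x, hx, a, ha, rfl⟩
  have h₂ : f.comp ((tmHom G).flip a) = 0 :=
    AddMonoidHom.eq_of_eqOn_dense hT fun x hx => DFunLike.congr_fun (h₁ x hx) a
  exact DFunLike.congr_fun h₂ x

lemma iterTens_addHom_ext {p : ℕ} (T : Set (X.obj G)) (hT : AddSubgroup.closure T = ⊤)
    (U : Set (A.obj G)) (hU : AddSubgroup.closure U = ⊤) {M : Type*} [AddCommGroup M]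
    {f g : ((iterTens X p).obj A).obj G →+ M}
    (h : ∀ a z, (∀ i, a i ∈ T) → z ∈ U → f (iterTm a z) = g (iterTm a z)) : f = g := by
  induction p generalizing A with
  | zero => exact AddMonoidHom.eq_of_eqOn_dense hU fun z hz => h Fin.elim0 z (fun i => i.elim0) hz
  | succ p ih =>
    refine ih (A := tens X A) _ (closure_tm T hT U hU) ?_
    rintro a _ ha ⟨x, hx, z, hz, rfl⟩
    exact h (Fin.cons (α := fun _ => X.obj G) x a) z
      (fun i => by
        induction i using Fin.cases with
        | zero => exact hx
        | succ i => exact ha i) hz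

lemma closure_elI (G : FreeGr) : AddSubgroup.closure (Set.range (elI (G := G))) = ⊤ :=
  closure_eq_top_of_ext _ fun _ hf => Ipow_one_addHom_ext fun x => hf _ ⟨x, rfl⟩

lemma closure_fe (n : ℕ) (S : Type) (G : FreeGr) : AddSubgroup.closure
    (Set.range fun x : (Fin n → G.group) × S => (fe x.1 x.2 : (freeF n S).obj G)) = ⊤ :=
  closure_eq_top_of_ext _ fun _ hf => free_addHom_ext fun x s => hf _ ⟨(x, s), rfl⟩

/-- For each `s` the tensor of the elements `x_i - 1`, for the generators `x_i` of `ℤ ∗ ⋯ ∗ ℤ`, lies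
in the `p`-th cross effect, because killing `x_i` makes one factor zero. A functor of degree less
than `p` has no nonzero such element, and these tensors generate the source. -/
lemma hom_eq_zero_of_isPolynomial {p d : ℕ} (hd : d < p) {S : Type} {B : GrFunctor}
    (hB : IsPolynomial FreeGr d B) (f : (iterTens (Ipow 1) p).obj (freeF 0 S) ⟶ B) : f = 0 := by
  have hu (s : S) : f.app _ (iterTm (fun i => elI (intsGen p i))
      (fe Fin.elim0 s : (freeF 0 S).obj (∐ ints p))) = 0 := by
    refine hB.crossEffect_eq_zero (ints p) hd (app_mem_crossEffect f ?_)
    rw [mem_crossEffect']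
    intro i
    rw [map_iterTm]
    refine iterTm_eq_zero (i := i) ?_ _
    rw [map_elI]
    have h : (killSummand (ints p) i).toMonoidHom (intsGen p i) = 1 := by
      have := congrArg (fun f => f.toMonoidHom intGen) (ι_killSummand (ints p) i i)
      rw [if_pos rfl] at this
      exact this
    rw [h, elI_one]
  refine nat_hom_ext fun G x => ?_
  refine DFunLike.congr_fun (iterTens_addHom_ext _ (closure_elI G) _ (closure_fe 0 S G)
    (f := (f.app G).hom) (g := 0) ?_) x
  rintro a _ ha ⟨⟨y, s⟩, rfl⟩
  choose g hg using ha
  have h : iterTm a (fe y s : (freeF 0 S).obj G) = ((iterTens (Ipow 1) p).obj (freeF 0 S)).map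
      (elsHom g) (iterTm (fun i => elI (intsGen p i))
      (fe Fin.elim0 s : (freeF 0 S).obj (∐ ints p))) := by
    rw [map_iterTm, map_fe]
    congr 1
    · funext i
      rw [map_elI, elsHom_intsGen, hg]
    · congr 1
      exact Subsingleton.elim _ _
  change f.app G (iterTm a (fe y s)) = 0
  rw [h, app_map_apply, hu, map_zero]

universe w

lemma Orth.free [HasExt.{w} GrFunctor] (S : Type) : Orth.{w} 0 (freeF 0 S) := by
  intro p d hd B hB
  have := projective_iterTens_free p S
  exact ExtVanish.of_projective fun f => hom_eq_zero_of_isPolynomial (by omega) hB f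

end FreeOrth
end

noncomputable section

/-! ### Integral representations -/

section IntRep

variable {R Γ : Type} [CommRing R] [Monoid Γ] {A N : Rep.{0} R Γ}

/-- The additive map underlying a morphism of representations. -/
def repAddHom (f : A ⟶ N) : A →+ N := f.hom.toLinearMap.toAddMonoidHom

lemma rep_hom_ext {f g : A ⟶ N} (h : ∀ x : A, f.hom x = g.hom x) : f = g :=
  Rep.hom_injective (Representation.IntertwiningMap.ext (LinearMap.ext h))

/-- A morphism of representations from an equivariant linear map. -/
def repOfLinear (k : A →+ N) (hs : ∀ (c : R) (x : A), k (c • x) = c • k x)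
    (h : ∀ (σ : Γ) (x : A), k (A.ρ σ x) = N.ρ σ (k x)) : A ⟶ N :=
  Rep.ofHom ⟨{ k with map_smul' := hs }, fun σ => LinearMap.ext (h σ)⟩

lemma rep_hom_ρ (f : A ⟶ N) (σ : Γ) (x : A) : f.hom (A.ρ σ x) = N.ρ σ (f.hom x) :=
  Rep.hom_comm_apply f σ x

lemma rep_ρ_add (σ : Γ) (x y : N) : N.ρ σ (x + y) = N.ρ σ x + N.ρ σ y := map_add _ _ _

/-- The additive endomorphisms given by a representation. -/
def repAct (N : Rep.{0} R Γ) (σ : Γ) : N →+ N := AddMonoidHom.mk' (N.ρ σ) (rep_ρ_add σ)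

lemma repAct_apply (σ : Γ) (x : N) : repAct N σ x = N.ρ σ x := rfl

lemma repAct_mul (σ τ : Γ) (x : N) : repAct N (σ * τ) x = repAct N σ (repAct N τ x) := by
  rw [repAct_apply, map_mul]
  rfl

lemma repAct_one (x : N) : repAct N 1 x = x := by
  rw [repAct_apply, map_one]
  rfl

lemma repAddHom_repAct (f : A ⟶ N) (σ : Γ) (x : A) :
    repAddHom f (repAct A σ x) = repAct N σ (repAddHom f x) := rep_hom_ρ f σ x

lemma rep_hom_ext' {f g : A ⟶ N} (h : ∀ x : A, repAddHom f x = repAddHom g x) : f = g :=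
  rep_hom_ext h

/-- A morphism of integral representations from an equivariant additive map. -/
def repOfAddHom {A N : Rep.{0} ℤ Γ} (k : A →+ N)
    (h : ∀ (σ : Γ) (x : A), k (repAct A σ x) = repAct N σ (k x)) : A ⟶ N :=
  repOfLinear k (fun c x => by
      have := map_zsmul k c x
      rw [← int_smul_eq_zsmul A.hV2 c x, ← int_smul_eq_zsmul N.hV2 c (k x)] at this
      exact this) h

end IntRep

/-! ### Cross effects of tensor powers of the first graded piece -/

section Coordinates

variable {n : ℕ}

/-- The projection of a free product of copies of `ℤ` to one of them. -/
def coordHom (n : ℕ) (j : Fin n) : (∐ ints n) ⟶ FreeGr.int :=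
  Sigma.desc fun i => if i = j then 𝟙 _ else 0

lemma coordHom_intsGen (i j : Fin n) :
    (coordHom n j).toMonoidHom (intsGen n i) = if i = j then intGen else 1 := by
  have : Sigma.ι (ints n) i ≫ coordHom n j = if i = j then 𝟙 _ else 0 := Sigma.ι_desc _ _
  have h := congrArg (fun f => f.toMonoidHom intGen) this
  refine h.trans ?_
  split_ifs <;> rfl

lemma permMap_intsGen (σ : Equiv.Perm (Fin n)) (i : Fin n) :
    (permMap σ).toMonoidHom (intsGen n i) = intsGen n (σ i) :=
  congrArg (fun f => f.toMonoidHom intGen) (ι_permMap σ i)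

lemma killSummand_intsGen (i j : Fin n) :
    (killSummand (ints n) i).toMonoidHom (intsGen n j) = if j = i then 1 else intsGen n j := by
  have h := congrArg (fun f => f.toMonoidHom intGen) (ι_killSummand (ints n) i j)
  refine h.trans ?_
  split_ifs <;> rfl

/-- The index of the generator of `ℤ`. -/
def intIdx : Fin FreeGr.int.rank := (0 : Fin 1)

/-- The coordinate on the first graded piece at `ℤ`. -/
def augOne : (gr 1).obj FreeGr.int →+ ℤ :=
  QuotientAddGroup.lift _ (((aug _).toAddMonoidHom.comp (foxD intIdx)).comp
    Ival) (by
    rintro _ ⟨y, rfl⟩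
    exact aug_eq_zero_of_mem (s := 0) (foxD_mem (s := 1) _ y.2))

lemma augOne_gc : augOne (gc intGen) = 1 := by
  change aug _ (foxD intIdx (genSub intIdx)) = 1
  rw [foxD_genSub, if_pos rfl, map_one]

/-- The coordinates on the first graded piece. -/
def coord (n : ℕ) (j : Fin n) : (gr 1).obj (∐ ints n) →+ ℤ :=
  augOne.comp ((gr 1).map (coordHom n j)).hom

lemma coord_gc (i j : Fin n) : coord n j (gc (intsGen n i)) = if i = j then 1 else 0 := by
  change augOne ((gr 1).map (coordHom n j) (gc (intsGen n i))) = _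
  rw [map_gc, coordHom_intsGen]
  split_ifs
  · exact augOne_gc
  · rw [gc_one, map_zero]

lemma coord_permMap (σ : Equiv.Perm (Fin n)) (j : Fin n) (x : (gr 1).obj (∐ ints n)) :
    coord n (σ j) ((gr 1).map (permMap σ) x) = coord n j x := by
  have h : permMap σ ≫ coordHom n (σ j) = coordHom n j := ints_hom_ext fun i => by
    change (coordHom n (σ j)).toMonoidHom ((permMap σ).toMonoidHom _) = _
    rw [permMap_intsGen, coordHom_intsGen, coordHom_intsGen]
    simp only [EmbeddingLike.apply_eq_iff_eq]
  change augOne ((gr 1).map (coordHom n (σ j)) _) = augOne _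
  rw [← map_comp_apply', h]

lemma closure_gc (n : ℕ) :
    AddSubgroup.closure (Set.range fun i => (gc (intsGen n i) : (gr 1).obj (∐ ints n))) = ⊤ := by
  refine closure_eq_top_of_ext _ fun f hf => gr_one_addHom_ext fun x => ?_
  let k : (∐ ints n : FreeGr).group →* Multiplicative ((gr 1).obj (∐ ints n) ⧸ _) :=
    (AddMonoidHom.toMultiplicative f).comp (gcHom (∐ ints n))
  have hk : k = 1 := by
    refine coprod_monoidHom_ext (ints n) fun i y => ?_
    refine DFunLike.congr_fun (f := k.comp (Sigma.ι (ints n) i).toMonoidHom) (g := 1)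
      (FreeGroup.ext_hom _ _ fun j => ?_) y
    have hj : j = (0 : Fin 1) := Subsingleton.elim (α := Fin 1) _ _
    subst hj
    exact congrArg Multiplicative.ofAdd (hf _ ⟨i, rfl⟩)
  exact congrArg Multiplicative.toAdd (DFunLike.congr_fun hk x)

end Coordinates

/-! ### Coefficients of iterated tensors with respect to linear forms. -/

section Evaluation

variable {X A : GrFunctor} {G H : FreeGr}

/-- The contraction of the first tensor factor by a linear form. -/
def contr (δ : X.obj G →+ ℤ) : (tens X A).obj G →+ A.obj G :=
  tensLiftAt (biHom (fun x a => δ x • a) (fun x y z => by rw [map_add, add_smul])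
    (fun x y z => by rw [smul_add]))

/-- The contraction of all tensor factors by linear forms. -/
def iterEv : ∀ {p : ℕ} {A : GrFunctor} {G : FreeGr} (_ : Fin p → X.obj G →+ ℤ),
    ((iterTens X p).obj A).obj G →+ A.obj G
  | 0, _, _, _ => AddMonoidHom.id _
  | _ + 1, A, _, δ => (contr (δ 0)).comp (iterEv (A := tens X A) fun i => δ i.succ)

lemma iterEv_iterTm {p : ℕ} (δ : Fin p → X.obj G →+ ℤ) (a : Fin p → X.obj G) (z : A.obj G) :
    iterEv δ (iterTm a z) = (∏ i, δ i (a i)) • z := by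
  induction p generalizing A with
  | zero =>
    rw [Fin.prod_univ_zero, one_smul]
    rfl
  | succ p ih =>
    have h : iterEv δ (iterTm a z) =
        contr (δ 0) (iterEv (A := tens X A) (fun i => δ i.succ)
          (iterTm (A := tens X A) (fun i => a i.succ) (tm (a 0) z))) := rfl
    rw [h, ih (A := tens X A), map_zsmul, Fin.prod_univ_succ, mul_comm, mul_smul]
    rfl

lemma iterEv_map {p : ℕ} (f : G ⟶ H) (δ : Fin p → X.obj G →+ ℤ) (δ' : Fin p → X.obj H →+ ℤ)
    (h : ∀ i x, δ' i (X.map f x) = δ i x) (y : ((iterTens X p).obj A).obj G) :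
    iterEv δ' (((iterTens X p).obj A).map f y) = A.map f (iterEv δ y) := by
  refine DFunLike.congr_fun (iterTens_addHom_ext (X := X) (A := A) (p := p) Set.univ
    AddSubgroup.closure_univ Set.univ AddSubgroup.closure_univ
    (f := (iterEv δ').comp (((iterTens X p).obj A).map f).hom)
    (g := (A.map f).hom.comp (iterEv δ)) fun a z _ _ => ?_) y
  change iterEv δ' (((iterTens X p).obj A).map f (iterTm a z)) = A.map f (iterEv δ (iterTm a z))
  rw [map_iterTm, iterEv_iterTm, iterEv_iterTm, map_zsmul]
  simp only [h]

end Evaluation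

/-! ### The cross effect of a tensor power of `gr 1` is a free module. -/

section CrFree

variable (p : ℕ) (S : Type)

/-- The tensor product of `p` copies of the first graded piece and the free group on a set. -/
abbrev grPow : GrFunctor := (iterTens (gr 1) p).obj (freeF 0 S)

variable {p S}

lemma freeF_zero_map {G : FreeGr} (f : G ⟶ G) (z : (freeF 0 S).obj G) :
    (freeF 0 S).map f z = z :=
  DFunLike.congr_fun (free_addHom_ext (f := ((freeF 0 S).map f).hom) (g := AddMonoidHom.id _)
    fun g s => by
      refine (map_fe f g s).trans ?_
      exact congrArg (fe · s) (Subsingleton.elim _ _)) z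

lemma iterTm_add {X A : GrFunctor} {G : FreeGr} (a : Fin p → X.obj G) (x y : A.obj G) :
    iterTm a (x + y) = iterTm a x + iterTm a y := by
  induction p generalizing A with
  | zero => rfl
  | succ p ih =>
    rw [iterTm, iterTm, iterTm, tm_add]
    exact ih (A := tens X A) _ _ _

/-- The tensor of the generators in a given order. -/
def genTm (c : Fin p → Fin p) : (freeF 0 S).obj (∐ ints p) →+ (grPow p S).obj (∐ ints p) :=
  AddMonoidHom.mk' (iterTm fun i => gc (intsGen p (c i))) (iterTm_add _)

lemma genTm_apply (c : Fin p → Fin p) (z : (freeF 0 S).obj (∐ ints p)) :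
    genTm c z = iterTm (fun i => gc (intsGen p (c i))) z := rfl

lemma map_permMap_genTm (σ : Equiv.Perm (Fin p)) (c : Fin p → Fin p)
    (z : (freeF 0 S).obj (∐ ints p)) :
    (grPow p S).map (permMap σ) (genTm c z) = genTm (fun i => σ (c i)) z := by
  rw [genTm_apply, map_iterTm, freeF_zero_map, genTm_apply]
  simp only [map_gc, permMap_intsGen]

/-- The coefficient of a permutation of the tensor of the generators. -/
def permEv (σ : Equiv.Perm (Fin p)) :
    (grPow p S).obj (∐ ints p) →+ (freeF 0 S).obj (∐ ints p) :=
  iterEv fun i => coord p (σ i)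

lemma permEv_genTm (σ : Equiv.Perm (Fin p)) (c : Fin p → Fin p)
    (z : (freeF 0 S).obj (∐ ints p)) : permEv σ (genTm c z) = if c = σ then z else 0 := by
  rw [genTm_apply, permEv, iterEv_iterTm]
  simp only [coord_gc]
  split_ifs with h
  · subst h
    simp
  · obtain ⟨i, hi⟩ := Function.ne_iff.1 h
    rw [Finset.prod_eq_zero (Finset.mem_univ i) (if_neg hi), zero_smul]

lemma permEv_map (σ τ : Equiv.Perm (Fin p)) (y : (grPow p S).obj (∐ ints p)) :
    permEv (τ * σ) ((grPow p S).map (permMap τ) y) = permEv σ y := by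
  exact (iterEv_map (permMap τ) (fun i => coord p (σ i)) (fun i => coord p ((τ * σ) i))
    (fun i x => coord_permMap τ (σ i) x) y).trans (freeF_zero_map _ _)

lemma map_killSummand_genTm {c : Fin p → Fin p} {i : Fin p} (h : ∃ j, c j = i)
    (z : (freeF 0 S).obj (∐ ints p)) :
    (grPow p S).map (killSummand (ints p) i) (genTm c z) = 0 := by
  obtain ⟨j, hj⟩ := h
  rw [genTm_apply, map_iterTm]
  refine iterTm_eq_zero (i := j) ?_ _
  rw [map_gc, killSummand_intsGen, if_pos hj, gc_one]

lemma map_killSummand_genTm_self {c : Fin p → Fin p} {i : Fin p} (h : ∀ j, c j ≠ i)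
    (z : (freeF 0 S).obj (∐ ints p)) :
    (grPow p S).map (killSummand (ints p) i) (genTm c z) = genTm c z := by
  rw [genTm_apply, map_iterTm, freeF_zero_map]
  simp only [map_gc, killSummand_intsGen, if_neg (h _)]

lemma genTm_mem_crossEffect (z : (freeF 0 S).obj (∐ ints p)) :
    genTm id z ∈ crossEffect (grPow p S) (ints p) :=
  mem_crossEffect'.2 fun i => map_killSummand_genTm (c := id) ⟨i, rfl⟩ z

/-- On a tensor of generators indexed by `c`, the projection is the identity if every generator
occurs, and zero if some generator is missing. With as many factors as generators, the first case
means that `c` is a permutation. -/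
lemma crProj_grPow (y : (grPow p S).obj (∐ ints p)) :
    crProj (ints p) (grPow p S) (List.finRange p) y = ∑ σ : Equiv.Perm (Fin p),
      genTm σ (permEv σ y) := by
  have key : crProj (ints p) (grPow p S) (List.finRange p) =
      ∑ σ : Equiv.Perm (Fin p), (genTm σ).comp (permEv σ) := by
    refine iterTens_addHom_ext _ (closure_gc p) Set.univ AddSubgroup.closure_univ
      fun a z ha _ => ?_
    choose c hc using ha
    have h : iterTm a z = genTm c z := by
      rw [genTm_apply]
      congr 1
      exact funext fun i => (hc i).symm
    rw [h, AddMonoidHom.finsetSum_apply]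
    simp only [AddMonoidHom.comp_apply, permEv_genTm]
    by_cases hb : Function.Bijective c
    · rw [Finset.sum_eq_single (Equiv.ofBijective c hb)]
      · rw [if_pos (by rfl)]
        exact crProj_eq_self _ fun i _ => map_killSummand_genTm (hb.2 i) z
      · intro σ _ hσ
        rw [if_neg fun h : c = σ => hσ (Equiv.ext fun i => (congrFun h i).symm), map_zero]
      · exact fun h => absurd (Finset.mem_univ _) h
    · have hs : ¬ Function.Surjective c := fun h => hb ⟨Finite.injective_iff_surjective.2 h, h⟩
      obtain ⟨i, hi⟩ := not_forall.1 hs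
      rw [crProj_eq_zero_of_mem _ (List.mem_finRange i)
        (map_killSummand_genTm_self (fun j h => hi ⟨j, h⟩) z)]
      refine (Finset.sum_eq_zero fun σ _ => ?_).symm
      rw [if_neg fun h : c = σ => hs (h ▸ σ.surjective), map_zero]
  exact (DFunLike.congr_fun key y).trans (AddMonoidHom.finsetSum_apply _ _ _)

/-- The element of the functor underlying an element of the cross effect. -/
def crVal {F : GrFunctor} {d : ℕ} : (crAll d).obj F →+ F.obj (∐ ints d) :=
  (crossEffect F (ints d)).subtype

/-- The basis elements of the cross effect. -/
def crGen (s : S) : crossEffect (grPow p S) (ints p) :=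
  ⟨genTm id (fe Fin.elim0 s), genTm_mem_crossEffect _⟩

variable {N : Rep.{0} ℤ (Equiv.Perm (Fin p))}

/-- By `crProj_grPow` an element of the cross effect is the sum over `σ` of the `σ`-translates of
tensors in standard order, so the `crGen s` generate it as a representation. -/
lemma crAll_grPow_hom_ext {f g : (crAll p).obj (grPow p S) ⟶ N}
    (h : ∀ s : S, repAddHom f (crGen s) = repAddHom g (crGen s)) : f = g := by
  have h₁ (z : (freeF 0 S).obj (∐ ints p)) : repAddHom f ⟨_, genTm_mem_crossEffect z⟩ =
      repAddHom g ⟨_, genTm_mem_crossEffect z⟩ := by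
    let i : (freeF 0 S).obj (∐ ints p) →+ crossEffect (grPow p S) (ints p) :=
      (genTm id).codRestrict _ genTm_mem_crossEffect
    refine DFunLike.congr_fun (free_addHom_ext (f := (repAddHom f).comp i)
      (g := (repAddHom g).comp i) fun x s => ?_) z
    have hx : x = Fin.elim0 := Subsingleton.elim _ _
    subst hx
    exact h s
  refine rep_hom_ext' fun (x : crossEffect (grPow p S) (ints p)) => ?_
  have hx : x = ∑ σ : Equiv.Perm (Fin p), repAct ((crAll p).obj (grPow p S)) σ
      ⟨_, genTm_mem_crossEffect (permEv σ x.1)⟩ := by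
    refine Subtype.ext ?_
    refine .trans ?_ (map_sum (crVal (F := grPow p S) (d := p)) _ _).symm
    refine ((crProj_of_mem_crossEffect _ x.2 (List.finRange p)).symm.trans
      (crProj_grPow x.1)).trans (Finset.sum_congr rfl fun σ _ => ?_)
    exact (map_permMap_genTm σ id _).symm
  rw [hx]
  refine (map_sum (repAddHom f) _ _).trans (.trans (Finset.sum_congr rfl fun σ _ => ?_)
    (map_sum (repAddHom g) _ _).symm)
  exact (repAddHom_repAct f σ _).trans
    ((congrArg (repAct N σ) (h₁ _)).trans (repAddHom_repAct g σ _).symm)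

/-- Homomorphisms from the cross effect with given values at the basis elements. -/
lemma exists_crAll_grPow_hom (m : S → N) :
    ∃ f : (crAll p).obj (grPow p S) ⟶ N, ∀ s : S, repAddHom f (crGen s) = m s := by
  let L : (freeF 0 S).obj (∐ ints p) →+ N := freeLiftAt fun _ s => m s
  -- The coefficient of an element at `σ` is `permEv σ`; equivariance forces this formula.
  let k : crossEffect (grPow p S) (ints p) →+ N :=
    ∑ σ : Equiv.Perm (Fin p), (repAct N σ).comp
      (L.comp ((permEv σ).comp (crossEffect (grPow p S) (ints p)).subtype))
  have hk (x) : k x = ∑ σ : Equiv.Perm (Fin p), repAct N σ (L (permEv σ x.1)) :=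
    AddMonoidHom.finsetSum_apply _ _ _
  refine ⟨repOfAddHom k fun τ (x : crossEffect (grPow p S) (ints p)) => ?_, fun s => ?_⟩
  · change k (crossEffectRep (grPow p S) p τ x) = repAct N τ (k x)
    rw [hk, hk, map_sum]
    refine Fintype.sum_equiv (Equiv.mulLeft τ⁻¹) _ _ fun σ => ?_
    have h₁ : permEv σ (crossEffectRep (grPow p S) p τ x).1 = permEv (τ⁻¹ * σ) x.1 := by
      have := permEv_map (τ⁻¹ * σ) τ x.1
      rw [mul_inv_cancel_left] at this
      exact this
    rw [h₁, Equiv.coe_mulLeft, ← repAct_mul, mul_inv_cancel_left]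
  · change k (crGen s) = m s
    rw [hk, Finset.sum_eq_single 1]
    · rw [repAct_one]
      have : permEv (1 : Equiv.Perm (Fin p)) (crGen s).1 = fe Fin.elim0 s :=
        (permEv_genTm 1 id _).trans (if_pos rfl)
      rw [this]
      exact freeLiftAt_fe _ _ _
    · intro σ _ hσ
      have : permEv σ (crGen s).1 = 0 :=
        (permEv_genTm σ id _).trans (if_neg fun h => hσ (Equiv.ext fun i => (congrFun h i).symm))
      rw [this, map_zero, map_zero]
    · exact fun h => absurd (Finset.mem_univ _) h

instance (p : ℕ) (S : Type) : Projective ((crAll p).obj (grPow p S)) where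
  factors {E X} f e _ := by
    have he := (Rep.epi_iff_surjective e).1 ‹_›
    choose m hm using fun s : S => he (repAddHom f (crGen s))
    obtain ⟨k, hk⟩ := exists_crAll_grPow_hom m
    refine ⟨k, crAll_grPow_hom_ext fun s => ?_⟩
    rw [← hm]
    exact congrArg (repAddHom e) (hk s)

lemma isPolynomial_iterTens_gr_one {A : GrFunctor} {d : ℕ} (hA : IsPolynomial FreeGr d A) (p : ℕ) :
    IsPolynomial FreeGr (d + p) ((iterTens (gr 1) p).obj A) := by
  induction p generalizing A d with
  | zero => exact hA
  | succ p ih =>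
    rw [show d + (p + 1) = d + 1 + p by omega]
    exact ih hA.tens_gr_one

lemma isPolynomial_freeF_zero (S : Type) : IsPolynomial FreeGr 0 (freeF 0 S) := by
  intro X
  rw [eq_bot_iff]
  intro x hx
  rw [mem_crossEffect'] at hx
  exact (freeF_zero_map _ x).symm.trans (hx 0)

lemma HasProjCr.free (S : Type) : HasProjCr 0 (freeF 0 S) := fun p => by
  rw [zero_add]
  refine ⟨?_, inferInstance⟩
  have := isPolynomial_iterTens_gr_one (isPolynomial_freeF_zero S) p
  rwa [zero_add] at this

end CrFree
end

noncomputable section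

/-! ### Filtered functors -/

section Filtered

variable {A : GrFunctor}

instance (n : ℕ) (S : Type) : IsFlat (freeF n S) where
  flat G := by
    have h : Module.Flat ℤ ((Fin n → G.group) × S →₀ ℤ) := inferInstance
    exact h

/-- The inclusion `I^{s+1} ⊗ A ⟶ I^s ⊗ A`. -/
def tensIncl (s : ℕ) (A : GrFunctor) : tens (Ipow (s + 1)) A ⟶ tens (Ipow s) A :=
  tensMap (Iincl s) (𝟙 A)

lemma tensIncl_injective [IsFlat A] (s : ℕ) (G : FreeGr) :
    Function.Injective ((tensIncl s A).app G) :=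
  tensMap_injective_left _ _ (Iincl_injective s G)

/-- The subfunctor `X ⊗ U` of `X ⊗ A`. -/
def tensSub (X : GrFunctor) (U : Subf A) : Subf (tens X A) := Subf.range (tensMap (𝟙 X) U.ι)

lemma tensSub_mono (X : GrFunctor) {U V : Subf A} (h : U ≤ V) : tensSub X U ≤ tensSub X V := by
  rintro G _ ⟨y, rfl⟩
  refine ⟨(tensMap (𝟙 X) (Subf.homOfLE h)).app G y, ?_⟩
  change (tensMap (𝟙 X) (Subf.homOfLE h) ≫ tensMap (𝟙 X) V.ι).app G y = _
  rw [tensMap_comp, Subf.homOfLE_ι, Category.comp_id]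

lemma tensIncl_grπ (s : ℕ) (A : GrFunctor) : tensIncl s A ≫ tensMap (grπ s) (𝟙 A) = 0 := by
  rw [tensIncl, tensMap_comp, Iincl_grπ, tensMap_zero_left]

lemma exists_of_tensMap_grπ_eq_zero {s : ℕ} {G : FreeGr} {y : (tens (Ipow s) A).obj G}
    (hy : (tensMap (grπ s) (𝟙 A)).app G y = 0) : ∃ u, (tensIncl s A).app G u = y :=
  (tensMap_exact_left A (Iincl s) (grπ s) G (grπ_surjective s G)
    (fun _ => grπ_eq_zero_iff _) y).1 hy

lemma tensMap_grπ_comm {B : GrFunctor} (s : ℕ) (f : A ⟶ B) :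
    tensMap (𝟙 (Ipow s)) f ≫ tensMap (grπ s) (𝟙 B) = tensMap (grπ s) (𝟙 A) ≫ tensMap (𝟙 _) f := by
  rw [tensMap_comp, tensMap_comp, Category.id_comp, Category.comp_id, Category.id_comp,
    Category.comp_id]

/-- Since `gr s` is flat, `gr s ⊗ U` embeds into `gr s ⊗ A`. Therefore an element of `I^s ⊗ U` which
vanishes in `gr s ⊗ A` already comes from `I^{s+1} ⊗ U`. -/
lemma mem_tensSub_of_tensMap_grπ {s : ℕ} {U : Subf A} {G : FreeGr} {t : (tens (Ipow s) A).obj G}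
    (ht : t ∈ (tensSub (Ipow s) U).carrier G) (h : (tensMap (grπ s) (𝟙 A)).app G t = 0) :
    ∃ u ∈ (tensSub (Ipow (s + 1)) U).carrier G, (tensIncl s A).app G u = t := by
  obtain ⟨y, rfl⟩ := ht
  have h₁ : (tensMap (grπ s) (𝟙 U.fn)).app G y = 0 := by
    refine tensMap_injective_right (X := gr s) U.ι G (U.ι_injective G) ?_
    rw [map_zero, ← comp_app_apply, ← tensMap_grπ_comm]
    exact h
  obtain ⟨u, rfl⟩ := exists_of_tensMap_grπ_eq_zero h₁
  refine ⟨(tensMap (𝟙 _) U.ι).app G u, ⟨u, rfl⟩, ?_⟩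
  change (tensMap (𝟙 _) U.ι ≫ tensMap (Iincl s) (𝟙 A)).app G u =
    (tensMap (Iincl s) (𝟙 U.fn) ≫ tensMap (𝟙 _) U.ι).app G u
  rw [tensMap_comp, tensMap_comp, Category.id_comp, Category.comp_id, Category.id_comp,
    Category.comp_id]

lemma mem_tensSub_of_tensIncl [IsFlat A] {s : ℕ} {U : Subf A} {G : FreeGr}
    {u : (tens (Ipow (s + 1)) A).obj G}
    (hu : (tensIncl s A).app G u ∈ (tensSub (Ipow s) U).carrier G) :
    u ∈ (tensSub (Ipow (s + 1)) U).carrier G := by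
  obtain ⟨v, hv, h⟩ := mem_tensSub_of_tensMap_grπ hu (by
    rw [← comp_app_apply, tensIncl_grπ, zero_app_apply])
  rwa [← tensIncl_injective s G h]

/-- The image of a monomorphism is isomorphic to its source. -/
def Subf.rangeIso {X Y : GrFunctor} (f : X ⟶ Y) (hf : ∀ G, Function.Injective (f.app G)) :
    X ≅ (Subf.range f).fn :=
  have : IsIso ((Subf.range f).lift f fun _ x => ⟨x, rfl⟩) :=
    isIso_of_bijective _ fun G => ⟨fun _ _ h => hf G (congrArg Subtype.val h), by
      rintro ⟨_, y, rfl⟩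
      exact ⟨y, rfl⟩⟩
  asIso ((Subf.range f).lift f fun _ x => ⟨x, rfl⟩)

universe w

variable [HasExt.{w} GrFunctor]

variable (A) in
/-- A filtration whose pieces are orthogonal to polynomial functors and with polynomial quotients
with projective cross effects. -/
structure Fil where
  fil : ℕ → Subf A
  fil_zero : fil 0 = ⊤
  anti : ∀ m, fil (m + 1) ≤ fil m
  orth : ∀ m, Orth.{w} m (fil m).fn
  cr : ∀ m, HasProjCr m (fil (m + 1)).quo

/-- The trivial filtration of a constant free functor. -/
def Fil.free (S : Type) : Fil.{w} (freeF 0 S) where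
  fil m := if m = 0 then ⊤ else ⊥
  fil_zero := if_pos rfl
  anti m G x hx := by
    split_ifs
    · exact Subf.mem_top x
    · exact hx
  orth m := by
    split_ifs with h
    · subst h
      exact (Orth.free S).of_iso (Subf.topIso _).symm
    · exact Orth.of_isZero (Subf.isZero_bot _)
  cr m := by
    rw [if_neg (Nat.succ_ne_zero m)]
    have := Subf.isIso_π_bot (freeF 0 S)
    exact ((HasProjCr.free S).of_iso (asIso (⊥ : Subf (freeF 0 S)).π)).mono (Nat.zero_le m)

variable (Ψ : Fil.{w} A)

/-- The filtration of `I^s ⊗ A`. -/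
def Fil.step : ∀ s : ℕ, ℕ → Subf (tens (Ipow s) A)
  | _, 0 => ⊤
  -- Unfolded, `step s j` is the sum over `a + b = j` of the images of `I^{s+a} ⊗ fil b`. The
  -- recursion raises `s`, which is why all `s` are treated together although only `s = 0` is used
  -- in the end.
  | s, j + 1 => tensSub (Ipow s) (Ψ.fil (j + 1)) ⊔ Subf.map (tensIncl s A) (Fil.step (s + 1) j)

lemma Fil.tensSub_le_step (s j : ℕ) : tensSub (Ipow s) (Ψ.fil j) ≤ Ψ.step s j := by
  intro G x hx
  cases j with
  | zero => exact Subf.mem_top x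
  | succ j => exact Subf.mem_sup.2 ⟨x, hx, 0, zero_mem _, add_zero x⟩

lemma Fil.step_anti (s j : ℕ) : Ψ.step s (j + 1) ≤ Ψ.step s j := by
  induction j generalizing s with
  | zero => exact fun G x _ => Subf.mem_top x
  | succ j ih =>
    intro G x hx
    obtain ⟨y, hy, _, ⟨z, hz, rfl⟩, rfl⟩ := Subf.mem_sup.1 hx
    exact Subf.mem_sup.2 ⟨y, tensSub_mono _ (Ψ.anti _) G hy, _, ⟨z, ih _ G hz, rfl⟩, rfl⟩

lemma Fil.tensSub_succ_le_step (s j : ℕ) : tensSub (Ipow s) (Ψ.fil (j + 1)) ≤ Ψ.step s j :=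
  fun G _ hx => Ψ.tensSub_le_step s j G (tensSub_mono _ (Ψ.anti j) G hx)

lemma Fil.mem_step_succ {s j : ℕ} {G : FreeGr} {x : (tens (Ipow s) A).obj G} :
    x ∈ (Ψ.step s (j + 1)).carrier G ↔ ∃ y ∈ (tensSub (Ipow s) (Ψ.fil (j + 1))).carrier G,
      ∃ z ∈ (Ψ.step (s + 1) j).carrier G, y + (tensIncl s A).app G z = x := by
  refine Subf.mem_sup.trans ⟨?_, ?_⟩
  · rintro ⟨y, hy, _, ⟨z, hz, rfl⟩, h⟩
    exact ⟨y, hy, z, hz, h⟩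
  · rintro ⟨y, hy, z, hz, h⟩
    exact ⟨y, hy, _, ⟨z, hz, rfl⟩, h⟩

lemma Fil.tensIncl_mem_step {s j : ℕ} {G : FreeGr} {u : (tens (Ipow (s + 1)) A).obj G}
    (hu : u ∈ (Ψ.step (s + 1) j).carrier G) :
    (tensIncl s A).app G u ∈ (Ψ.step s (j + 1)).carrier G :=
  Ψ.mem_step_succ.2 ⟨0, zero_mem _, u, hu, zero_add _⟩

/-- The part in `I^s ⊗ fil (j + 1)` then lies in `I^{s+1} ⊗ fil (j + 1)`, and this is contained in
`step (s + 1) j` because `fil (j + 1) ≤ fil j`. -/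
lemma Fil.mem_step_of_tensIncl [IsFlat A] {s j : ℕ} {G : FreeGr}
    {u : (tens (Ipow (s + 1)) A).obj G}
    (hu : (tensIncl s A).app G u ∈ (Ψ.step s (j + 1)).carrier G) :
    u ∈ (Ψ.step (s + 1) j).carrier G := by
  obtain ⟨y, hy, z, hz, h⟩ := Ψ.mem_step_succ.1 hu
  have h₁ : (tensIncl s A).app G (u - z) = y := by rw [map_sub, ← h, add_sub_cancel_right]
  rw [← h₁] at hy
  have := add_mem (Ψ.tensSub_succ_le_step _ _ G (mem_tensSub_of_tensIncl hy)) hz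
  rwa [sub_add_cancel] at this

/-- Only one of the two improvements survives in the quotient: `I^{s+1} ⊗ B` is better than needed,
and `I^s ⊗ B` gives the bound. -/
lemma Orth.tens_gr {e : ℕ} {B : GrFunctor} [IsFlat B] (h : Orth.{w} e B) (s : ℕ) :
    Orth.{w} (e + s) (tens (gr s) B) :=
  Orth.quot (shortExact_gr_tens s B) ((h.tens_Ipow (s + 1)).mono (by omega)) (h.tens_Ipow s)

/-- Reducing the first factor modulo `I^{s+1}` gives a short exact sequence `0 → step (s + 1) j →
step s (j + 1) → gr s ⊗ fil (j + 1) → 0` whose ends are both orthogonal up to the same bound `s + j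
+ 1`. -/
lemma Fil.orth_step [IsFlat A] (s j : ℕ) : Orth.{w} (s + j) (Ψ.step s j).fn := by
  induction j generalizing s with
  | zero =>
    have h := Ψ.orth 0
    rw [Ψ.fil_zero] at h
    have h' := (h.of_iso (Subf.topIso A)).tens_Ipow s
    rw [zero_add] at h'
    exact h'.of_iso (Subf.topIso _).symm
  | succ j ih =>
    have : IsFlat (Ψ.fil (j + 1)).fn := Subf.isFlat_fn _
    let R := tensSub (gr s) (Ψ.fil (j + 1))
    have hR : Orth.{w} (s + (j + 1)) R.fn := by
      have := ((Ψ.orth (j + 1)).tens_gr s).of_iso (Subf.rangeIso (tensMap (𝟙 (gr s))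
        (Ψ.fil (j + 1)).ι) fun G => tensMap_injective_right _ _ (Subf.ι_injective _ G))
      exact this.mono (by omega)
    let f : (Ψ.step (s + 1) j).fn ⟶ (Ψ.step s (j + 1)).fn :=
      Subf.lift _ ((Ψ.step (s + 1) j).ι ≫ tensIncl s A) fun G x =>
        Ψ.tensIncl_mem_step (Subf.ι_mem _ x)
    let g : (Ψ.step s (j + 1)).fn ⟶ R.fn :=
      R.lift ((Ψ.step s (j + 1)).ι ≫ tensMap (grπ s) (𝟙 A)) fun G x => by
        obtain ⟨_, ⟨y, rfl⟩, z, hz, h⟩ := Ψ.mem_step_succ.1 (Subf.ι_mem _ x)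
        rw [comp_app_apply, ← h, map_add, ← comp_app_apply (tensIncl s A), tensIncl_grπ,
          zero_app_apply, add_zero]
        refine ⟨(tensMap (grπ s) (𝟙 _)).app G y, ?_⟩
        exact DFunLike.congr_fun (congrArg (fun k => (k.app G).hom)
          (tensMap_grπ_comm s (Ψ.fil (j + 1)).ι).symm) y
    have hf : ∀ G x, (Ψ.step s (j + 1)).ι.app G (f.app G x) =
        (tensIncl s A).app G ((Ψ.step (s + 1) j).ι.app G x) := fun _ _ => rfl
    have hg : ∀ G x, R.ι.app G (g.app G x) =
        (tensMap (grπ s) (𝟙 A)).app G ((Ψ.step s (j + 1)).ι.app G x) := fun _ _ => rfl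
    have w' : f ≫ g = 0 := nat_hom_ext fun G x => R.ι_injective G (by
      rw [comp_app_apply, hg, hf, ← comp_app_apply (tensIncl s A), tensIncl_grπ, zero_app_apply,
        zero_app_apply, map_zero])
    have hS : (ShortComplex.mk f g w').ShortExact := by
      refine shortExact_of_elements _ _ _ (fun G x y h => ?_) (fun G x => ?_) (fun G y hy => ?_)
      · exact Subf.ι_injective _ G (tensIncl_injective s G (by rw [← hf, ← hf, h]))
      · obtain ⟨y, hy⟩ := R.ι_mem x
        obtain ⟨y, rfl⟩ := tensMap_surjective (grπ s) (𝟙 (Ψ.fil (j + 1)).fn) G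
          (grπ_surjective s G) (fun x => ⟨x, rfl⟩) y
        obtain ⟨z, hz⟩ := Subf.exists_ι _ (Ψ.tensSub_le_step s (j + 1) G
          (x := (tensMap (𝟙 _) (Ψ.fil (j + 1)).ι).app G y) ⟨y, rfl⟩)
        refine ⟨z, R.ι_injective G ?_⟩
        rw [hg, hz, ← comp_app_apply, tensMap_grπ_comm]
        exact hy
      · obtain ⟨t, ht, z, hz, h⟩ := Ψ.mem_step_succ.1 (Subf.ι_mem _ y)
        have h₁ : (tensMap (grπ s) (𝟙 A)).app G t = 0 := by
          have h₂ := hg G y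
          rw [hy, map_zero, ← h, map_add, ← comp_app_apply (tensIncl s A), tensIncl_grπ,
            zero_app_apply, add_zero] at h₂
          exact h₂.symm
        obtain ⟨u, hu, rfl⟩ := mem_tensSub_of_tensMap_grπ ht h₁
        obtain ⟨x, hx⟩ := Subf.exists_ι _ (add_mem (Ψ.tensSub_succ_le_step _ _ G hu) hz)
        refine ⟨x, Subf.ι_injective _ G ?_⟩
        rw [hf, hx, map_add, h]
    refine Orth.ext hS ?_ hR
    have := ih (s + 1)
    rwa [show s + 1 + j = s + (j + 1) by omega] at this

/-- The sequence for the quotients is `0 → (I^{s+1} ⊗ A)/step (s + 1) j → (I^s ⊗ A)/step s (j + 1) →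
gr s ⊗ A/fil (j + 1) → 0`. Its left end is zero for `j = 0` and is covered by the induction
otherwise. -/
lemma Fil.cr_step [IsFlat A] (s j : ℕ) : HasProjCr (s + j) (Ψ.step s (j + 1)).quo := by
  induction j using Nat.strong_induction_on generalizing s with
  | _ j ih =>
    have h₁ : HasProjCr (s + j) (Ψ.step (s + 1) j).quo := by
      cases j with
      | zero => exact .of_isZero (Subf.isZero_quo_top _)
      | succ j =>
        have := ih j (Nat.lt_succ_self j) (s + 1)
        rwa [show s + 1 + j = s + (j + 1) by omega] at this
    have h₃ : HasProjCr (s + j) (tens (gr s) (Ψ.fil (j + 1)).quo) := by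
      rw [add_comm]
      exact (Ψ.cr j).tens_gr s
    let f : (Ψ.step (s + 1) j).quo ⟶ (Ψ.step s (j + 1)).quo :=
      Subf.desc _ (tensIncl s A ≫ (Ψ.step s (j + 1)).π) fun G x hx =>
        (Subf.π_eq_zero_iff _ _).2 (Ψ.tensIncl_mem_step hx)
    have hker (G : FreeGr) (x : (tens (Ipow s) A).obj G) :=
      tensMap_eq_zero_iff (grπ s) (Ψ.fil (j + 1)).π (Iincl s) (Ψ.fil (j + 1)).ι G
        (grπ_surjective s G) (Subf.π_surjective _ G) (fun _ => grπ_eq_zero_iff _)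
        (fun y => (Subf.π_eq_zero_iff _ y).trans
          ⟨Subf.exists_ι _, by rintro ⟨x, rfl⟩; exact Subf.ι_mem _ x⟩) x
    let g : (Ψ.step s (j + 1)).quo ⟶ tens (gr s) (Ψ.fil (j + 1)).quo :=
      Subf.desc _ (tensMap (grπ s) (Ψ.fil (j + 1)).π) fun G x hx => by
        obtain ⟨_, ⟨v, rfl⟩, z, hz, h⟩ := Ψ.mem_step_succ.1 hx
        exact (hker G x).2 ⟨z, v, (add_comm _ _).trans h⟩
    have hf (G x) : f.app G ((Ψ.step (s + 1) j).π.app G x) =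
      (Ψ.step s (j + 1)).π.app G ((tensIncl s A).app G x) := rfl
    have hg (G x) : g.app G ((Ψ.step s (j + 1)).π.app G x) =
      (tensMap (grπ s) (Ψ.fil (j + 1)).π).app G x := rfl
    have w' : f ≫ g = 0 := nat_hom_ext fun G x => by
      obtain ⟨x, rfl⟩ := Subf.π_surjective _ G x
      rw [comp_app_apply, hf, hg, zero_app_apply]
      exact (hker G _).2 ⟨x, 0, by rw [map_zero, add_zero]; rfl⟩
    have hS : (ShortComplex.mk f g w').ShortExact := by
      refine shortExact_of_elements _ _ _ (fun G => ?_) (fun G x => ?_) (fun G y hy => ?_)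
      · rw [injective_iff_map_eq_zero]
        intro x hx
        obtain ⟨x, rfl⟩ := Subf.π_surjective _ G x
        rw [hf, Subf.π_eq_zero_iff] at hx
        exact (Subf.π_eq_zero_iff _ _).2 (Ψ.mem_step_of_tensIncl hx)
      · obtain ⟨y, rfl⟩ := tensMap_surjective _ _ G (grπ_surjective s G)
          (Subf.π_surjective (Ψ.fil (j + 1)) G) x
        exact ⟨_, hg G y⟩
      · obtain ⟨y, rfl⟩ := Subf.π_surjective _ G y
        rw [hg] at hy
        obtain ⟨u, v, rfl⟩ := (hker G y).1 hy
        refine ⟨(Ψ.step (s + 1) j).π.app G u, ?_⟩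
        rw [hf, map_add]
        refine (add_eq_left.2 ?_).symm
        exact (Subf.π_eq_zero_iff _ _).2 (Ψ.tensSub_le_step s (j + 1) G ⟨v, rfl⟩)
    exact HasProjCr.ext hS h₁ h₃

/-- The filtration of the tensor product with the group ring. -/
def Fil.tens [IsFlat A] : Fil.{w} (tens (Ipow 0) A) where
  fil m := Ψ.step 0 m
  fil_zero := rfl
  anti m := Ψ.step_anti 0 m
  orth m := by
    have := Ψ.orth_step 0 m
    rwa [zero_add] at this
  cr m := by
    have := Ψ.cr_step 0 m
    rwa [zero_add] at this

/-- The filtration of iterated tensor products with the group ring. -/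
def Fil.iterTens : ∀ (p : ℕ) {A : GrFunctor} [IsFlat A] (_ : Fil.{w} A),
    Fil.{w} ((iterTens (Ipow 0) p).obj A)
  | 0, _, _, Ψ => Ψ
  | p + 1, A, _, Ψ => Fil.iterTens p (A := _root_.tens (Ipow 0) A) Ψ.tens

end Filtered
end

noncomputable section

/-! ### Morphisms from iterated tensor products -/

section IterMap

variable {X Y A B F : GrFunctor} {G : FreeGr}

lemma iterTens_map_iterTm {p : ℕ} (f : A ⟶ B) (a : Fin p → X.obj G) (z : A.obj G) :
    ((iterTens X p).map f).app G (iterTm a z) = iterTm a (f.app G z) := by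
  induction p generalizing A B with
  | zero => rfl
  | succ p ih => exact ih (tensMap (𝟙 X) f) _ _

/-- Functoriality of iterated tensor products in the repeated factor. -/
def iterMap (α : X ⟶ Y) : ∀ (p : ℕ) (A : GrFunctor), (iterTens X p).obj A ⟶ (iterTens Y p).obj A
  | 0, _ => 𝟙 _
  | p + 1, A => (iterTens X p).map (tensMap α (𝟙 A)) ≫ iterMap α p (tens Y A)

lemma iterMap_iterTm (α : X ⟶ Y) {p : ℕ} (a : Fin p → X.obj G) (z : A.obj G) :
    (iterMap α p A).app G (iterTm a z) = iterTm (fun i => α.app G (a i)) z := by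
  induction p generalizing A with
  | zero => rfl
  | succ p ih =>
    have h : (iterMap α (p + 1) A).app G (iterTm a z) = (iterMap α p (tens Y A)).app G
        (((iterTens X p).map (tensMap α (𝟙 A))).app G
          (iterTm (A := tens X A) (fun i => a i.succ) (tm (a 0) z))) := rfl
    rw [h, iterTens_map_iterTm, ih]
    rfl

lemma iterTm_sub {p : ℕ} (a : Fin p → X.obj G) (x y : A.obj G) :
    iterTm a (x - y) = iterTm a x - iterTm a y :=
  eq_sub_of_add_eq (by rw [← iterTm_add, sub_add_cancel])

lemma iterTm_update_sub {p : ℕ} (a : Fin p → X.obj G) (i : Fin p) (b c : X.obj G) (z : A.obj G) :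
    iterTm (Function.update a i (b - c)) z =
      iterTm (Function.update a i b) z - iterTm (Function.update a i c) z := by
  induction p generalizing A with
  | zero => exact i.elim0
  | succ p ih =>
    induction i using Fin.cases with
    | zero =>
      have h (d : X.obj G) : iterTm (Function.update a 0 d) z =
          iterTm (A := tens X A) (fun i => a i.succ) (tm d z) := rfl
      rw [h, h, h, sub_tm]
      exact iterTm_sub (A := tens X A) _ _ _
    | succ i =>
      have h (d : X.obj G) : iterTm (Function.update a i.succ d) z = iterTm (A := tens X A)
          (Function.update (fun i => a i.succ) i d) (tm (a 0) z) := by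
        rw [iterTm]
        congr 1
        funext j
        simp only [Function.update_apply, Fin.succ_inj]
      rw [h, h, h, ih]
      rfl

variable {n : ℕ} {S : Type}

/-- The nesting of `iterTens` permutes the factors. Instead of following the permutation, only a
relabelling `c` is recorded; its surjectivity is what is needed to prescribe the value at a tensor
of free generators. -/
lemma exists_iterTens_hom_free (p n : ℕ) (S : Type) :
    ∃ (m : ℕ) (i : (iterTens (Ipow 0) p).obj (freeF n S) ⟶ freeF m S)
      (c : Fin m → Fin p ⊕ Fin n), Function.Surjective c ∧
        ∀ (G : FreeGr) (g : Fin p → G.group) (h : Fin n → G.group) (s : S),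
          i.app G (iterTm (fun i => elR (g i)) (fe h s)) = fe (fun j => Sum.elim g h (c j)) s := by
  induction p generalizing n with
  | zero => exact ⟨n, 𝟙 _, Sum.inr, fun x => ⟨x.elim (fun i => i.elim0) id, by
      rcases x with x | x
      · exact x.elim0
      · rfl⟩, fun _ _ _ _ => rfl⟩
  | succ p ih =>
    obtain ⟨m, i, c, hc, h⟩ := ih (n + 1)
    let e : Fin p ⊕ Fin (n + 1) → Fin (p + 1) ⊕ Fin n :=
      Sum.elim (fun i => Sum.inl i.succ)
        (Fin.cons (α := fun _ => Fin (p + 1) ⊕ Fin n) (Sum.inl 0) Sum.inr)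
    have he : Function.Surjective e := by
      rintro (j | j)
      · induction j using Fin.cases with
        | zero => exact ⟨Sum.inr 0, rfl⟩
        | succ j => exact ⟨Sum.inl j, rfl⟩
      · exact ⟨Sum.inr j.succ, rfl⟩
    refine ⟨m, (iterTens (Ipow 0) p).map (tensFreeIso n S).hom ≫ i, e ∘ c, he.comp hc,
      fun G g k s => ?_⟩
    have h₁ : ((iterTens (Ipow 0) p).map (tensFreeIso n S).hom).app G
        (iterTm (A := tens (Ipow 0) (freeF n S)) (fun i => elR (g i.succ))
          (tm (elR (g 0)) (fe k s))) =
        iterTm (fun i => elR (g i.succ)) (fe (Fin.cons (α := fun _ => G.group) (g 0) k) s) := by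
      rw [iterTens_map_iterTm]
      congr 1
      exact tensFreeFun_tm _ _ _
    refine (congrArg (i.app G) h₁).trans ((h G _ _ s).trans ?_)
    congr 1
    funext j
    change _ = Sum.elim g k (e (c j))
    rcases c j with x | x
    · rfl
    · induction x using Fin.cases with
      | zero => rfl
      | succ x => rfl

/-- The tensor of the generators in the tensor power of the group ring. -/
def genW (p : ℕ) (s : S) : ((iterTens (Ipow 0) p).obj (freeF 0 S)).obj (∐ ints p) :=
  iterTm (fun i => elR (intsGen p i)) (fe Fin.elim0 s)

/-- The Yoneda lemma for `R^{⊗p} ⊗ ℤ[S]`, whose universal elements are the `genW p s`. A section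
`c'` of the relabelling compensates for the order of the factors. -/
lemma exists_hom_genW {p : ℕ} (φ : S → F.obj (∐ ints p)) :
    ∃ f : (iterTens (Ipow 0) p).obj (freeF 0 S) ⟶ F, ∀ s, f.app _ (genW p s) = φ s := by
  obtain ⟨m, i, c, hc, h⟩ := exists_iterTens_hom_free p 0 S
  choose c' hc' using fun j : Fin p => hc (Sum.inl j)
  refine ⟨i ≫ freeDesc fun s => F.map (elsHom fun j => intsGen m (c' j)) (φ s), fun s => ?_⟩
  rw [comp_app_apply, genW, h, freeDesc_fe, ← map_comp_apply']
  have : (elsHom fun j => intsGen m (c' j)) ≫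
      elsHom (fun j => Sum.elim (intsGen p) Fin.elim0 (c j)) = 𝟙 (∐ ints p) :=
    ints_hom_ext fun j => by
      change (elsHom _).toMonoidHom ((elsHom _).toMonoidHom _) = _
      rw [elsHom_intsGen, elsHom_intsGen, hc']
      rfl
  rw [this, map_id_apply']

/-- Subtracting the effect of killing the `i`-th generator turns the factor `x_i` into `x_i - 1` and
leaves the others alone. -/
lemma crProj_genW {p : ℕ} (s : S) (L : List (Fin p)) (hL : L.Nodup) :
    crProj (ints p) _ L (genW p s) =
      iterTm (fun i => if i ∈ L then elR (intsGen p i) - elR 1 else elR (intsGen p i))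
        (fe Fin.elim0 s : (freeF 0 S).obj (∐ ints p)) := by
  induction L with
  | nil => simp [crProj, genW]
  | cons i L ih =>
    have hi : i ∉ L := (List.nodup_cons.1 hL).1
    let a : Fin p → (Ipow 0).obj (∐ ints p) :=
      fun j => if j ∈ L then elR (intsGen p j) - elR 1 else elR (intsGen p j)
    have h₁ : (fun j => if j ∈ i :: L then elR (intsGen p j) - elR 1 else elR (intsGen p j)) =
        Function.update a i (elR (intsGen p i) - elR 1) := by
      funext j
      by_cases hj : j = i
      · subst hj
        simp
      · simp [hj, a]
    have h₂ : Function.update a i (elR (intsGen p i)) = a := by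
      funext j
      by_cases hj : j = i
      · subst hj
        simp [a, hi]
      · simp [hj]
    have h₃ : (fun j => (Ipow 0).map (killSummand (ints p) i) (a j)) =
        Function.update a i (elR 1) := by
      funext j
      by_cases hj : j = i
      · subst hj
        simp [a, hi, killSummand_intsGen]
      · simp only [a, Function.update_of_ne hj]
        split_ifs <;> simp [killSummand_intsGen, hj]
    rw [crProj_cons, ih (List.nodup_cons.1 hL).2, h₁, iterTm_update_sub, h₂]
    congr 1
    rw [map_iterTm, freeF_zero_map]
    exact congrArg (iterTm · _) h₃

lemma iterMap_Iincl_elI {p : ℕ} (s : S) :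
    (iterMap (Iincl 0) p (freeF 0 S)).app _
      (iterTm (fun i => elI (intsGen p i)) (fe Fin.elim0 s)) =
      crProj (ints p) _ (List.finRange p) (genW p s) := by
  rw [crProj_genW s _ (List.nodup_finRange p), iterMap_iterTm]
  congr 1
  funext i
  rw [if_pos (List.mem_finRange i)]
  exact Ival_injective (by simp [elR])

end IterMap

/-! ### Projective generators of polynomial functors -/

section Generators

universe w

variable [HasExt.{w} GrFunctor] {d : ℕ}

/-- The filtered tensor power of the group ring. -/
def filFree (d : ℕ) (S : Type) : Fil.{w} ((iterTens (Ipow 0) d).obj (freeF 0 S)) :=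
  (Fil.free.{w} S).iterTens d

/-- The greatest polynomial quotient of a free functor. -/
def polyFree (d : ℕ) (S : Type) : PolyGrFunctor d :=
  ⟨((filFree.{w} d S).fil (d + 1)).quo, ((filFree.{w} d S).cr d 0).1⟩

/-- The projection from the free functor. -/
def polyFreeπ (d : ℕ) (S : Type) :
    (iterTens (Ipow 0) d).obj (freeF 0 S) ⟶ (polyFree.{w} d S).obj :=
  ((filFree.{w} d S).fil (d + 1)).π

instance projective_iterTens_Ipow_zero (p : ℕ) (S : Type) :
    Projective ((iterTens (Ipow 0) p).obj (freeF 0 S)) := by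
  obtain ⟨i⟩ := nonempty_iterTens_free_iso p 0 S
  exact Projective.of_iso i.symm inferInstance

lemma extVanish_fil (S : Type) {B : GrFunctor} (hB : IsPolynomial FreeGr d B) :
    ExtVanish.{w} ((filFree.{w} d S).fil (d + 1)).fn B :=
  (filFree.{w} d S).orth (d + 1) 0 d (by omega) B hB

/-- In the long exact sequence these groups lie between `Ext` of the projective `R^{⊗d} ⊗ ℤ[S]` in
the same positive degree and `Ext` of the filtration step `d + 1` in the degree below; both vanish.
-/
lemma subsingleton_ext_polyFree (S : Type) {B : GrFunctor} (hB : IsPolynomial FreeGr d B) (n : ℕ) :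
    Subsingleton (Ext.{w} (polyFree.{w} d S).obj B (n + 1)) := by
  refine subsingleton_of_forall_eq 0 fun x => ?_
  obtain ⟨y, rfl⟩ := Ext.contravariant_sequence_exact₃
    ((filFree.{w} d S).fil (d + 1)).shortExact B x (Ext.eq_zero_of_projective _) (add_comm 1 n)
  rw [extVanish_fil S hB _ y, Ext.comp_zero]
  rfl

/-- Morphisms from the free functor to a polynomial functor factor through the polynomial
quotient. -/
lemma exists_polyFree_desc {S : Type} {B : PolyGrFunctor d}
    (f : (iterTens (Ipow 0) d).obj (freeF 0 S) ⟶ B.obj) :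
    ∃ g : polyFree.{w} d S ⟶ B, polyFreeπ.{w} d S ≫ g.hom = f := by
  have h : ((filFree.{w} d S).fil (d + 1)).ι ≫ f = 0 :=
    (extVanish_fil S B.property).hom_eq_zero _
  exact ⟨⟨Subf.desc _ f fun G x hx => DFunLike.congr_fun (congrArg (fun k => (k.app G).hom) h)
    (⟨x, hx⟩ : ((filFree.{w} d S).fil (d + 1)).carrier G)⟩, rfl⟩

instance (S : Type) : Epi (polyFreeπ.{w} d S) := inferInstanceAs (Epi (Subf.π _))

instance (S : Type) : Projective (polyFree.{w} d S) where
  factors {E X} f e _ := by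
    have : Epi e.hom := inferInstanceAs (Epi ((polyInclusion d).map e))
    -- Lift from the free functor, which is projective among all functors; since the target is
    -- polynomial, the lift factors through the quotient.
    obtain ⟨g, hg⟩ := exists_polyFree_desc.{w}
      (Projective.factorThru (polyFreeπ.{w} d S ≫ f.hom) e.hom)
    refine ⟨g, ?_⟩
    ext1
    rw [← cancel_epi (polyFreeπ.{w} d S)]
    change polyFreeπ.{w} d S ≫ g.hom ≫ e.hom = _
    rw [← Category.assoc, hg, Projective.factorThru_comp]

instance (S : Type) : Projective ((crRep d).obj (polyFree.{w} d S)) :=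
  ((filFree.{w} d S).cr d 0).2

/-- Take for `S` all elements of `F` at `d` copies of `ℤ`; a functor of degree at most `d` is
generated by these. -/
lemma exists_epi_polyFree (F : PolyGrFunctor d) :
    ∃ (S : Type) (p : polyFree.{w} d S ⟶ F), Epi p := by
  obtain ⟨f, hf⟩ := exists_hom_genW (S := F.obj.obj (∐ ints d)) (F := F.obj) id
  obtain ⟨g, hg⟩ := exists_polyFree_desc.{w} f
  refine ⟨_, g, ?_⟩
  have h₁ : Epi f := epi_of_surjective f fun G x => by
    have : spanFrom F.obj (∐ ints d) G ≤ (f.app G).hom.range := by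
      refine iSup_le fun k => ?_
      rintro _ ⟨y, rfl⟩
      refine ⟨((iterTens (Ipow 0) d).obj (freeF 0 _)).map k (genW d y), ?_⟩
      exact (app_map_apply f k _).trans (congrArg (F.obj.map k) (hf y))
    exact this (F.property.mem_spanFrom x)
  rw [← hg] at h₁
  have h₂ : Epi ((polyInclusion d).map g) := epi_of_epi (polyFreeπ.{w} d _) g.hom
  exact (polyInclusion d).epi_of_epi_map h₂

end Generators
end

noncomputable section

/-! ### A functor representing cross effects -/

section Represent

universe w

variable [HasExt.{w} GrFunctor] {d : ℕ}

/-- The factors `I` are replaced by `gr 1` one at a time. The obstruction is a morphism to `F` from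
a tensor product containing `I² ⊗ A`, and `I²` raises the bound on `e` by two while using up a
single factor, so this morphism is zero. The remaining `gr 1 ⊗ A` is orthogonal with bound `e + 1`.
-/
lemma Orth.exists_iterMap_comp {F : GrFunctor} (hF : IsPolynomial FreeGr d F) {p e : ℕ}
    {A : GrFunctor} [IsFlat A] (h : Orth.{w} e A) (hd : d ≤ e + p)
    (f : (iterTens (Ipow 1) p).obj A ⟶ F) :
    ∃ f' : (iterTens (gr 1) p).obj A ⟶ F, iterMap (grπ 1) p A ≫ f' = f := by
  induction p generalizing A e with
  | zero => exact ⟨f, Category.id_comp _⟩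
  | succ p ih =>
    have hS := (shortExact_gr_tens 1 A).map_of_exact (iterTens (Ipow 1) p)
    have h₀ : (iterTens (Ipow 1) p).map (tensMap (Iincl 1) (𝟙 A)) ≫ f = 0 :=
      ((h.tens_Ipow 2) p d (by omega) F hF).hom_eq_zero _
    have := hS.epi_g
    obtain ⟨g, hg⟩ : ∃ g, (iterTens (Ipow 1) p).map (tensMap (grπ 1) (𝟙 A)) ≫ g = f :=
      ⟨hS.exact.desc f h₀, hS.exact.g_desc f h₀⟩
    obtain ⟨f', hf'⟩ := ih (h.tens_gr 1) (by omega) g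
    exact ⟨f', (Category.assoc _ _ _).trans ((congrArg _ hf').trans hg)⟩

variable (d) in
/-- The `d`-th tensor power of the abelianization, as a polynomial functor. -/
def polyPow : PolyGrFunctor d :=
  ⟨grPow d Unit, by
    have := isPolynomial_iterTens_gr_one (isPolynomial_freeF_zero Unit) d
    rwa [zero_add] at this⟩

/-- By Yoneda `x` gives a morphism on `R^{⊗d}`. Its restriction to `I^{⊗d}` factors through `(gr
1)^{⊗d}`, and it sends the tensor of the `x_i - 1`, which is the projection of the universal element
to the cross effect, to the projection of `x`, that is to `x`. -/
lemma exists_polyPow_hom {F : PolyGrFunctor d} (x : crossEffect F.obj (ints d)) :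
    ∃ f : polyPow d ⟶ F, repAddHom ((crRep d).map f) (crGen ()) = x := by
  obtain ⟨f₁, hf₁⟩ := exists_hom_genW (S := Unit) (F := F.obj) (p := d) fun _ => x.1
  obtain ⟨f, hf⟩ := Orth.exists_iterMap_comp F.property (Orth.free.{w} Unit) (zero_add d).ge
    (iterMap (Iincl 0) d (freeF 0 Unit) ≫ f₁)
  refine ⟨⟨f⟩, Subtype.ext ?_⟩
  have h₁ : (genTm id (fe Fin.elim0 ()) : (grPow d Unit).obj (∐ ints d)) =
      (iterMap (grπ 1) d (freeF 0 Unit)).app _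
        (iterTm (fun i => elI (intsGen d i)) (fe Fin.elim0 ())) := by
    rw [iterMap_iterTm]
    rfl
  change f.app _ (genTm id (fe Fin.elim0 ())) = x.1
  rw [h₁, ← comp_app_apply, hf, comp_app_apply, iterMap_Iincl_elI, app_crProj, hf₁,
    crProj_of_mem_crossEffect _ x.2]

end Represent

/-! ### Right adjoints of the cross effect functor -/

section RightAdjoint

universe w

variable {d : ℕ}

instance : (crRep d).Additive := inferInstanceAs (polyInclusion d ⋙ crAll d).Additive

instance : (cr d).Additive where
  map_add := rfl

/-- By adjunction, morphisms from `polyPow d` to `β N` are morphisms from the free module `cr_d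
(polyPow d)` to `N`, hence elements of `N`. Every element of `cr_d (β N)` is the value of such a
morphism at the generator, and the counit sends it to the corresponding element of `N`. -/
lemma isIso_crRep_counit [HasExt.{w} GrFunctor] {β : Rep.{0} ℤ (Equiv.Perm (Fin d)) ⥤ PolyGrFunctor d}
    (adj : crRep d ⊣ β) (N : Rep.{0} ℤ (Equiv.Perm (Fin d))) : IsIso (adj.counit.app N) := by
  have hc (f : polyPow d ⟶ β.obj N) : repAddHom (adj.counit.app N)
      (repAddHom ((crRep d).map f) (crGen ())) =
        repAddHom ((adj.homEquiv _ _).symm f) (crGen ()) := by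
    rw [Adjunction.homEquiv_counit]
    rfl
  have h₁ : Mono (adj.counit.app N) := by
    refine (Rep.mono_iff_injective _).2 ((injective_iff_map_eq_zero
      (repAddHom (adj.counit.app N))).2 fun x hx => ?_)
    obtain ⟨f, hf⟩ := exists_polyPow_hom.{w} (F := β.obj N) x
    have h₀ : (adj.homEquiv _ _).symm f = 0 := crAll_grPow_hom_ext fun _ => by
      refine (hc f).symm.trans ?_
      rw [hf]
      exact hx
    have : f = 0 := by
      rw [← Equiv.apply_symm_apply (adj.homEquiv _ _) f, h₀, Adjunction.homEquiv_unit]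
      have := adj.right_adjoint_additive
      simp
    rw [← hf, this]
    rfl
  have h₂ : Epi (adj.counit.app N) := by
    refine (Rep.epi_iff_surjective _).2 fun y => ?_
    obtain ⟨g, hg⟩ := exists_crAll_grPow_hom (p := d) (S := Unit) fun _ => y
    refine ⟨repAddHom ((crRep d).map (adj.homEquiv (polyPow d) N g)) (crGen ()), ?_⟩
    refine (hc _).trans (.trans ?_ (hg ()))
    exact congrArg (fun k : (crRep d).obj (polyPow d) ⟶ N => repAddHom k (crGen (S := Unit) ())) (Equiv.symm_apply_apply _ _)
  exact isIso_of_mono_of_epi _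

end RightAdjoint

/-! ### Exactness of right adjoints from projective covers. -/

section Abstract

variable {C D : Type*} [Category* C] [Category* D] {L : C ⥤ D} {R : D ⥤ C}

/-- Cover `R N` by `q : P ⟶ R N` with `L P` projective. The adjunct `L P ⟶ N` lifts along `g`, and
the adjunct of the lift shows that `q` factors through `R g`. -/
lemma preservesEpimorphisms_of_projective (adj : L ⊣ R)
    (h : ∀ Y : C, ∃ (P : C) (q : P ⟶ Y), Epi q ∧ Projective (L.obj P)) :
    R.PreservesEpimorphisms where
  preserves {M N} g _ := by
    obtain ⟨P, q, hq, _⟩ := h (R.obj N)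
    have h₁ : adj.homEquiv _ _ (Projective.factorThru ((adj.homEquiv _ _).symm q) g) ≫ R.map g =
        q := by
      rw [← Adjunction.homEquiv_naturality_right, Projective.factorThru_comp,
        Equiv.apply_symm_apply]
    exact epi_of_epi_fac h₁

lemma preservesFiniteColimits_of_preservesEpimorphisms [Abelian C] [Abelian D] (adj : L ⊣ R)
    [R.PreservesEpimorphisms] [R.Additive] : PreservesFiniteColimits R := by
  have := adj.rightAdjoint_preservesLimits
  refine ((R.exact_tfae.out 0 3 rfl rfl).1 fun S hS => ?_).2
  have := hS.mono_f
  have := hS.epi_g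
  exact
    { exact := ((R.preservesFiniteLimits_tfae.out 3 0 rfl rfl).1 inferInstance S hS).1
      mono_f := R.map_mono S.f
      epi_g := R.map_epi S.g }

end Abstract
end

noncomputable section

/-! ### The right adjoint of the cross effect functor -/

section Coinduction

variable {d : ℕ} {F : GrFunctor} {N : Rep.{0} ℤ (Equiv.Perm (Fin d))}

/-- The projection to the cross effect is equivariant. -/
lemma crProj_permMap (σ : Equiv.Perm (Fin d)) (y : F.obj (∐ ints d)) :
    crProj (ints d) F (List.finRange d) (F.map (permMap σ) y) =
      F.map (permMap σ) (crProj (ints d) F (List.finRange d) y) := by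
  -- The difference `y - crProj y` is a sum of elements in the images of the `killSummand i`. A
  -- permutation moves these to images of `killSummand (σ i)`, which the projection annihilates,
  -- whatever the order of the list.
  have key (L : List (Fin d)) : crProj (ints d) F (List.finRange d)
      (F.map (permMap σ) (y - crProj (ints d) F L y)) = 0 := by
    induction L with
    | nil => simp [crProj]
    | cons i L ih =>
      have h (z : F.obj (∐ ints d)) : crProj (ints d) F (List.finRange d)
          (F.map (permMap σ) (F.map (killSummand (ints d) i) z)) = 0 := by
        have h₁ := permMap_comp_killSummand σ (σ i)
        rw [show σ⁻¹ (σ i) = i from σ.symm_apply_apply i] at h₁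
        rw [← map_comp_apply', ← h₁, map_comp_apply']
        refine crProj_eq_zero_of_mem _ (List.mem_finRange (σ i)) ?_
        rw [← map_comp_apply', killSummand_idem]
      rw [crProj_cons, ← sub_add, map_add, map_add, ih, h, add_zero]
  have h := key (List.finRange d)
  rw [map_sub, map_sub, crProj_of_mem_crossEffect _
    (map_permMap_mem_crossEffect F σ (crProj_mem_crossEffect _ y)), sub_eq_zero] at h
  exact h

variable (N) in
/-- The functor of all functions on the morphisms to a free product of copies of `ℤ`. -/
def funFunctor : GrFunctor where
  obj X := AddCommGrpCat.of ((X ⟶ ∐ ints d) → N)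
  map f := AddCommGrpCat.ofHom
    { toFun := fun u φ => u (f ≫ φ)
      map_zero' := rfl
      map_add' := fun _ _ => rfl }
  map_id X := AddCommGrpCat.hom_ext (AddMonoidHom.ext fun (u : (X ⟶ _) → N) =>
    funext fun φ => congrArg u (Category.id_comp φ))
  map_comp {X _ _} f g := AddCommGrpCat.hom_ext (AddMonoidHom.ext fun (u : (X ⟶ _) → N) =>
    funext fun φ => congrArg u (Category.assoc f g φ))

/-- The value of a function at a morphism. -/
def funEv {X : FreeGr} (φ : X ⟶ ∐ ints d) : (funFunctor N).obj X →+ N :=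
  Pi.evalAddMonoidHom (fun _ : X ⟶ ∐ ints d => (N : Type)) φ

lemma funEv_map {X Y : FreeGr} (f : X ⟶ Y) (φ : Y ⟶ ∐ ints d) (u : (funFunctor N).obj X) :
    funEv φ ((funFunctor N).map f u) = funEv (f ≫ φ) u := rfl

lemma fun_ext {X : FreeGr} {u v : (funFunctor N).obj X}
    (h : ∀ φ : X ⟶ ∐ ints d, funEv φ u = funEv φ v) : u = v := funext h

variable (N) in
/-- The equivariant functions which vanish on the morphisms killing a summand, and which
generate a polynomial functor. -/
def coindSub : Subf (funFunctor N) where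
  carrier X :=
    { carrier := {u | (∀ (φ : X ⟶ ∐ ints d) (σ : Equiv.Perm (Fin d)),
          funEv (φ ≫ permMap σ) u = repAct N σ (funEv φ u)) ∧
        (∀ (φ : X ⟶ ∐ ints d) (i : Fin d), funEv (φ ≫ killSummand (ints d) i) u = 0) ∧
        -- Letting `ψ` vary makes the condition functorial in `X`. With `ψ` the identity it
        -- annihilates the cross effects of order `d + 1`.
        ∀ (Y : Fin (d + 1) → FreeGr) (ψ : X ⟶ ∐ Y),
          crProj Y (funFunctor N) (List.finRange (d + 1)) ((funFunctor N).map ψ u) = 0}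
      zero_mem' := ⟨fun φ σ => by rw [map_zero, map_zero, map_zero],
        fun φ i => map_zero _, fun Y ψ => by rw [map_zero, map_zero]⟩
      add_mem' := fun {u v} hu hv =>
        ⟨fun φ σ => by rw [map_add, map_add, map_add, hu.1, hv.1],
        fun φ i => by rw [map_add, hu.2.1, hv.2.1, add_zero],
        fun Y ψ => by rw [map_add, map_add, hu.2.2, hv.2.2, add_zero]⟩
      neg_mem' := fun {u} hu =>
        ⟨fun φ σ => by rw [map_neg, map_neg, map_neg, hu.1],
        fun φ i => by rw [map_neg, hu.2.1, neg_zero],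
        fun Y ψ => by rw [map_neg, map_neg, hu.2.2, neg_zero]⟩ }
  map_mem {X Y} f u hu :=
    ⟨fun φ σ => by
      rw [funEv_map, funEv_map, ← Category.assoc]
      exact hu.1 _ σ,
    fun φ i => by
      rw [funEv_map, ← Category.assoc]
      exact hu.2.1 _ i,
    fun Z ψ => by
      rw [← map_comp_apply']
      exact hu.2.2 Z _⟩

variable (N) in
/-- The value of the right adjoint of the cross effect functor. -/
def coind : PolyGrFunctor d :=
  ⟨(coindSub N).fn, fun Y => by
    rw [eq_bot_iff]
    intro x hx
    rw [AddSubgroup.mem_bot]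
    refine (coindSub N).ι_injective _ ?_
    rw [map_zero]
    have h := (((coindSub N).ι_mem x).2.2 Y (𝟙 _))
    rwa [map_id_apply', crProj_of_mem_crossEffect _ (app_mem_crossEffect (coindSub N).ι hx)] at h⟩

/-- The value of an element of the right adjoint at a morphism. -/
def coindEv {X : FreeGr} (φ : X ⟶ ∐ ints d) : (coind N).obj.obj X →+ N :=
  (funEv φ).comp ((coindSub N).ι.app X).hom

lemma coindEv_map {X Y : FreeGr} (f : X ⟶ Y) (φ : Y ⟶ ∐ ints d) (u : (coind N).obj.obj X) :
    coindEv φ ((coind N).obj.map f u) = coindEv (f ≫ φ) u := rfl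

lemma coind_ext {X : FreeGr} {u v : (coind N).obj.obj X}
    (h : ∀ φ : X ⟶ ∐ ints d, coindEv φ u = coindEv φ v) : u = v :=
  (coindSub N).ι_injective _ (fun_ext h)

lemma coindEv_permMap {X : FreeGr} (φ : X ⟶ ∐ ints d) (σ : Equiv.Perm (Fin d))
    (u : (coind N).obj.obj X) : coindEv (φ ≫ permMap σ) u = repAct N σ (coindEv φ u) :=
  ((coindSub N).ι_mem u).1 φ σ

/-- The correction terms are values at morphisms killing a summand, where the functions vanish.
Evaluation at the identity therefore only sees the part of `u` in the cross effect, which makes the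
correspondence bijective. -/
lemma coindEv_crProj (L : List (Fin d)) (u : (coind N).obj.obj (∐ ints d)) :
    coindEv (𝟙 _) (crProj (ints d) (coind N).obj L u) = coindEv (𝟙 _) u := by
  induction L with
  | nil => rfl
  | cons i L ih =>
    have h (v : (coind N).obj.obj (∐ ints d)) :
        coindEv (𝟙 _) ((coind N).obj.map (killSummand (ints d) i) v) = 0 := by
      rw [coindEv_map, Category.comp_id, ← Category.id_comp (killSummand (ints d) i)]
      exact ((coindSub N).ι_mem v).2.1 _ i
    rw [crProj_cons, map_sub, h, sub_zero, ih]

/-- The projection to the cross effect. -/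
def crProjHom (F : GrFunctor) (d : ℕ) : F.obj (∐ ints d) →+ (crAll d).obj F :=
  (crProj (ints d) F (List.finRange d)).codRestrict (crossEffect F (ints d))
    (crProj_mem_crossEffect _)

lemma crVal_crProjHom (x : F.obj (∐ ints d)) :
    crVal (crProjHom F d x) = crProj (ints d) F (List.finRange d) x := rfl

lemma crVal_injective : Function.Injective (crVal (F := F) (d := d)) := Subtype.val_injective

lemma crVal_repAct (σ : Equiv.Perm (Fin d)) (x : (crAll d).obj F) :
    crVal (repAct ((crAll d).obj F) σ x) = F.map (permMap σ) (crVal x) := rfl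

lemma crVal_map {F' : GrFunctor} (f : F ⟶ F') (x : (crAll d).obj F) :
    crVal (repAddHom ((crAll d).map f) x) = f.app _ (crVal x) := rfl

lemma crProjHom_crVal (x : (crAll d).obj F) : crProjHom F d (crVal x) = x :=
  crVal_injective (crProj_of_mem_crossEffect _ (Subtype.prop (p := (· ∈ crossEffect F (ints d))) x) _)

/-- The morphism to the functor of functions corresponding to a morphism from the cross
effect. -/
def toFunFunctor (u : (crAll d).obj F ⟶ N) : F ⟶ funFunctor N :=
  natHom (fun X => AddMonoidHom.mk'
      (fun x (φ : X ⟶ ∐ ints d) => repAddHom u (crProjHom F d (F.map φ x)))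
      fun x y => funext fun φ => by
        rw [map_add, map_add, map_add]
        rfl)
    fun f x => fun_ext fun φ => congrArg (fun y => repAddHom u (crProjHom F d y))
      (map_comp_apply' F f φ x).symm

lemma funEv_toFunFunctor (u : (crAll d).obj F ⟶ N) {X : FreeGr} (φ : X ⟶ ∐ ints d) (x : F.obj X) :
    funEv φ ((toFunFunctor u).app X x) = repAddHom u (crProjHom F d (F.map φ x)) := rfl

lemma toFunFunctor_mem (hF : IsPolynomial FreeGr d F) (u : (crAll d).obj F ⟶ N) {X : FreeGr}
    (x : F.obj X) : (toFunFunctor u).app X x ∈ (coindSub N).carrier X := by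
  refine ⟨fun φ σ => ?_, fun φ i => ?_, fun Y ψ => ?_⟩
  · rw [funEv_toFunFunctor, funEv_toFunFunctor, ← repAddHom_repAct]
    congr 1
    refine crVal_injective ?_
    rw [crVal_repAct, crVal_crProjHom, crVal_crProjHom, map_comp_apply', crProj_permMap]
  · rw [funEv_toFunFunctor]
    have : crProjHom F d (F.map (φ ≫ killSummand (ints d) i) x) = 0 := by
      refine crVal_injective ?_
      rw [crVal_crProjHom, map_zero]
      refine crProj_eq_zero_of_mem _ (List.mem_finRange i) ?_
      rw [← map_comp_apply', Category.assoc, killSummand_idem]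
    rw [this, map_zero]
  · rw [← app_map_apply, ← app_crProj, hF.crProj_eq_zero _ (List.nodup_finRange _)
      (by rw [List.length_finRange]; exact d.lt_succ_self), map_zero]

/-- The universal property of the right adjoint of the cross effect functor. -/
def coindEquiv (F : PolyGrFunctor d) (N : Rep.{0} ℤ (Equiv.Perm (Fin d))) :
    ((crRep d).obj F ⟶ N) ≃ (F ⟶ coind N) where
  toFun u := ⟨(coindSub N).lift (toFunFunctor (F := F.obj) u) fun _ x => toFunFunctor_mem F.property u x⟩
  invFun g := repOfAddHom (A := (crAll d).obj F.obj)
    ((coindEv (𝟙 _)).comp ((g.hom.app _).hom.comp crVal)) fun σ x => by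
      change coindEv (𝟙 _) (g.hom.app _ (F.obj.map (permMap σ) (crVal x))) =
        repAct N σ (coindEv (𝟙 _) (g.hom.app _ (crVal x)))
      rw [app_map_apply, coindEv_map, ← coindEv_permMap, Category.comp_id, Category.id_comp]
  left_inv u := rep_hom_ext' fun x => by
    change repAddHom u (crProjHom F.obj d (F.obj.map (𝟙 _) (crVal x))) = repAddHom u x
    rw [map_id_apply', crProjHom_crVal]
  right_inv g := by
    ext1
    refine nat_hom_ext fun X x => coind_ext fun φ => ?_
    change coindEv (𝟙 _) (g.hom.app _ (crProj (ints d) F.obj (List.finRange d) (F.obj.map φ x))) =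
      coindEv φ (g.hom.app X x)
    rw [app_crProj, coindEv_crProj, app_map_apply, coindEv_map, Category.comp_id]

instance : (crRep d).IsLeftAdjoint :=
  (Adjunction.adjunctionOfEquivRight (fun F N => coindEquiv F N) fun F' F N f g => by
    ext1
    refine nat_hom_ext fun X x => coind_ext fun φ => ?_
    change repAddHom g (repAddHom ((crAll d).map f.hom) (crProjHom F'.obj d (F'.obj.map φ x))) =
      repAddHom g (crProjHom F.obj d (F.obj.map φ (f.hom.app X x)))
    congr 1
    refine crVal_injective ?_
    rw [crVal_map, crVal_crProjHom, crVal_crProjHom, app_crProj, app_map_apply]).isLeftAdjoint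

end Coinduction
end

noncomputable section

/-! ### Transfer to modules over the group ring -/

section Modules

universe w

variable {d : ℕ} {β : ModuleCat.{0} (MonoidAlgebra ℤ (Equiv.Perm (Fin d))) ⥤ PolyGrFunctor d}

instance : (crRep d).PreservesMonomorphisms where
  preserves f _ := by
    have : Mono f.hom := inferInstanceAs (Mono ((polyInclusion d).map f))
    exact (Rep.mono_iff_injective _).2 fun x y h =>
      Subtype.ext (app_injective_of_mono f.hom _ (congrArg Subtype.val h))

instance : (cr d).PreservesMonomorphisms :=
  inferInstanceAs (crRep d ⋙ Rep.toModuleMonoidAlgebra).PreservesMonomorphisms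

instance : (cr d).IsLeftAdjoint :=
  inferInstanceAs (crRep d ⋙ Rep.toModuleMonoidAlgebra).IsLeftAdjoint

/-- The adjunction is moved to representations, where the counit is known to be invertible, and the
conclusion is brought back along the equivalence with modules. -/
lemma full_and_faithful_of_adjunction [HasExt.{w} GrFunctor] (adj : cr d ⊣ β) :
    β.Full ∧ β.Faithful := by
  let E := Rep.equivalenceModuleMonoidAlgebra (k := ℤ) (G := Equiv.Perm (Fin d))
  let adj' : crRep d ⊣ E.functor ⋙ β := (adj.comp E.symm.toAdjunction).ofNatIsoLeft
    (Functor.isoWhiskerLeft (crRep d) E.unitIso.symm ≪≫ (crRep d).rightUnitor)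
  have h (N) : IsIso (adj'.counit.app N) := isIso_crRep_counit.{w} adj' N
  have h₁ : (E.functor ⋙ β).Full := adj'.full_R_of_isSplitMono_counit_app
  have h₂ : (E.functor ⋙ β).Faithful := adj'.faithful_R_of_epi_counit_app
  let i : E.inverse ⋙ E.functor ⋙ β ≅ β :=
    Functor.isoWhiskerRight E.counitIso β ≪≫ β.leftUnitor
  exact ⟨Functor.Full.of_iso i, Functor.Faithful.of_iso i⟩

lemma preservesEpimorphisms_of_adjunction [HasExt.{w} GrFunctor] (adj : cr d ⊣ β) :
    β.PreservesEpimorphisms :=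
  preservesEpimorphisms_of_projective adj fun F => by
    obtain ⟨S, p, hp⟩ := exists_epi_polyFree.{w} F
    exact ⟨_, p, hp, (Rep.equivalenceModuleMonoidAlgebra.map_projective_iff
      ((crRep d).obj (polyFree.{w} d S))).2 inferInstance⟩

end Modules

end

/-! ### Assembly of the theorem. -/

theorem mainTheorem5 (d : ℕ)
    [HasExt.{w₁} GrFunctor] [HasExt.{w₂} (PolyGrFunctor d)]
    [HasExt.{w₃} (ModuleCat.{0} (MonoidAlgebra ℤ (Equiv.Perm (Fin d))))] :
    -- `cr_d` has a right adjoint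
    (cr d).IsLeftAdjoint ∧
    -- and for every right adjoint `β` of `cr_d`:
    ∀ (β : ModuleCat.{0} (MonoidAlgebra ℤ (Equiv.Perm (Fin d))) ⥤ PolyGrFunctor d)
      (_ : cr d ⊣ β),
      -- `β` is exact
      ∃ (_ : β.Additive) (_ : PreservesFiniteLimits β) (_ : PreservesFiniteColimits β),
        ∀ (n : ℕ),
          -- the maps induced by `β` and by the inclusion of `𝓕_d(gr)` are isomorphisms
          (∀ M N : ModuleCat.{0} (MonoidAlgebra ℤ (Equiv.Perm (Fin d))),
            Function.Bijective (β.mapExtAddHom M N n :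
              Ext.{w₃} M N n →+ Ext.{w₂} (β.obj M) (β.obj N) n) ∧
            Function.Bijective ((polyInclusion d).mapExtAddHom (β.obj M) (β.obj N) n :
              Ext.{w₂} (β.obj M) (β.obj N) n →+
                Ext.{w₁} (β.obj M).obj (β.obj N).obj n)) ∧
          -- which are natural in `M` and in `N`
          (∀ (M M' N N' : ModuleCat.{0} (MonoidAlgebra ℤ (Equiv.Perm (Fin d))))
            (f : M' ⟶ M) (g : N ⟶ N'),
            (∀ x : Ext.{w₃} M N n,
              β.mapExtAddHom M' N' n
                  (((Ext.mk₀ f).comp x (zero_add n)).comp (Ext.mk₀ g) (add_zero n)) =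
                ((Ext.mk₀ (β.map f)).comp (β.mapExtAddHom M N n x) (zero_add n)).comp
                  (Ext.mk₀ (β.map g)) (add_zero n)) ∧
            (∀ x : Ext.{w₂} (β.obj M) (β.obj N) n,
              (polyInclusion d).mapExtAddHom (β.obj M') (β.obj N') n
                  (((Ext.mk₀ (β.map f)).comp x (zero_add n)).comp
                    (Ext.mk₀ (β.map g)) (add_zero n)) =
                ((Ext.mk₀ (β.map f).hom).comp
                    ((polyInclusion d).mapExtAddHom (β.obj M) (β.obj N) n x) (zero_add n)).comp
                  (Ext.mk₀ (β.map g).hom) (add_zero n))) := by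
  refine ⟨inferInstance, fun β adj => ?_⟩
  have hadd : β.Additive := adj.right_adjoint_additive
  have := preservesEpimorphisms_of_adjunction.{w₁} adj
  obtain ⟨_, _⟩ := full_and_faithful_of_adjunction.{w₁} adj
  have hlim : PreservesFiniteLimits β :=
    have := adj.rightAdjoint_preservesLimits
    inferInstance
  have hcolim : PreservesFiniteColimits β := preservesFiniteColimits_of_preservesEpimorphisms adj
  -- This holds because the left adjoint `cr d` preserves monomorphisms.
  have : β.PreservesInjectiveObjects :=
    Functor.preservesInjectiveObjects_of_adjunction_of_preservesMonomorphisms adj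
  refine ⟨hadd, hlim, hcolim, fun n => ⟨fun M N =>
    ⟨β.mapExt_bijective_of_preservesInjectiveObjects M N n,
      mapExt_bijective_of_acyclic (polyInclusion d) (fun F => ?_) _ _ n⟩,
    fun M M' N N' f g => ⟨fun x => ?_, fun x => ?_⟩⟩⟩
  -- The covers `polyFree` are projective in `𝓕_d(gr)` and acyclic in `𝓕(gr)` against polynomial
  -- functors, as the comparison requires.
  · obtain ⟨S, p, hp⟩ := exists_epi_polyFree.{w₁} F
    exact ⟨_, p, hp, inferInstance, fun G n => subsingleton_ext_polyFree S G.property n⟩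
  · simp only [Functor.mapExtAddHom_apply, Ext.mapExactFunctor_comp, Ext.mapExactFunctor_mk₀]
  · simp only [Functor.mapExtAddHom_apply, Ext.mapExactFunctor_comp, Ext.mapExactFunctor_mk₀]
    rfl
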